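/- Setting. Let $n,p,k$ be integers with $0\le k<p$, let $\Sigma=\mathrm{diag}(\lambda_1,\dots,\lambda_p)$ with $\lambda_1\ge\dots\ge\lambda_p\ge 0$ and $\lambda_i>0$ for $i\le k$, and let $\mu\in\mathbb R^p$, $\lambda\in\mathbb R$ (a regularization parameter of any sign), $\eta\in[0,1]$. Let $Z\in\mathbb R^{n\times p}$ and $Q=Z\Sigma^{1/2}$. The clean labels $y\in\{-1,1\}^n$ have i.i.d. Rademacher coordinates, and the noisy labels $\hat y$ are obtained from $y$ by flipping the sign of each coordinate independently with probability $\eta$. Put $X=y\mu^\top+Q$, $w=X^\top(XX^\top+\lambda I_n)^{-1}\hat y$, and $\|w\|_\Sigma=\sqrt{w^\top\Sigma w}$. For a matrix or vector, the subscript $0{:}k$ denotes its first $k$ columns or coordinates and $k{:}\infty$ the remaining ones; $\Sigma_{0:k}=\mathrm{diag}(\lambda_1,\dots,\lambda_k)$, $\Sigma_{k:\infty}=\mathrm{diag}(\lambda_{k+1},\dots,\lambda_p)$; $\|u\|_{M}^2=u^\top M u$; terms indexed by $0{:}k$ are zero (and conditions on them void) when $k=0$. Define $$\Lambda=\lambda+\sum_{i>k}\lambda_i,\qquad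 V=\tfrac1n\mathrm{tr}\big((\tfrac{\Lambda}{n}\Sigma_{0:k}^{-1}+I_k)^{-2}\big)+\tfrac{n}{\Lambda^2}\sum_{i>k}\lambda_i^2,$$ $$\Delta V=\min\Big(\tfrac1n,\tfrac{n\lambda_1^2}{\Lambda^2}\Big)+\frac{n\lambda_{k+1}^2+\sum_{i>k}\lambda_i^2}{\Lambda^2},$$ $$\Diamond^2=\tfrac{n}{\Lambda^2}\Big(\tfrac{\Lambda^2}{n^2}\big\|(\tfrac{\Lambda}{n}\Sigma_{0:k}^{-1}+I_k)^{-1}\Sigma_{0:k}^{-1/2}\mu_{0:k}\big\|^2+\|\mu_{k:\infty}\|^2_{\Sigma_{k:\infty}}\Big),\quad \Diamond\ge 0,$$ $$N=\tfrac{n}{\Lambda}\Big(\tfrac{\Lambda}{n}\big\|(\tfrac{\Lambda}{n}\Sigma_{0:k}^{-1}+I_k)^{-1/2}\Sigma_{0:k}^{-1/2}\mu_{0:k}\big\|^2+\|\mu_{k:\infty}\|^2\Big),$$ $$\sigma_\eta=\Big(\ln\tfrac{3+\eta^{-1}}{2}\Big)^{-1/2}\ (\sigma_0=0),\qquad D_t=[1+N\sigma_\eta]\sqrt{V+t^2\Delta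 V}+\Diamond\sqrt n .$$ Let $\mathscr A_k(L)$ be the event that all eigenvalues of $Q_{k:\infty}Q_{k:\infty}^\top+\lambda I_n$ lie in $[\Lambda/L,L\Lambda]$. Let $\mathscr B_k(c_B)$ be the event that all $k$ eigenvalues of $Z_{0:k}^\top Z_{0:k}$ lie in $[n/c_B,c_Bn]$, and $\|Q_{k:\infty}\mu_{k:\infty}\|^2\le c_Bn\|\mu_{k:\infty}\|_{\Sigma_{k:\infty}}^2$, $\mathrm{tr}(Q_{k:\infty}\Sigma_{k:\infty}Q_{k:\infty}^\top)\le c_Bn\sum_{i>k}\lambda_i^2$, $\mathrm{tr}(Z_{0:k}^\top Z_{0:k})\le c_Bnk$, and $\|Q_{k:\infty}\Sigma_{k:\infty}Q_{k:\infty}^\top\|\le c_B\big(\sum_{i>k}\lambda_i^2+n\lambda_{k+1}^2\big)$ (spectral norm). Theorem (Main lower bound). For any $c_B>0$ and $L>1$ there is a constant $c>0$, depending only on $c_B$ and $L$, such that the following holds. Assume $\eta<1/c$, $k<n/c$ and $$\Lambda>\max\Big(cn\lambda_{k+1},\ \sqrt{n\textstyle\sum_{i>k}\lambda_i^2}\Big).$$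 Then for every $t\in(0,\sqrt n/c)$ and every realization of $Z$ in $\mathscr A_k(L)\cap\mathscr B_k(c_B)$, with probability at least $1-ce^{-t^2/2}$ over the draw of $(y,\hat y)$ alone, all of the following hold. The matrix $XX^\top+\lambda I_n$ is invertible, and there is a scalar $S>0$ with $$S\mu^\top w\ge c^{-1}N-ct\Diamond,\qquad S\|w\|_\Sigma\le c\,D_t .$$ Moreover, if $N>2c^2t\Diamond$, then on the same event $\mu^\top w>0$ and, whenever $\|w\|_\Sigma\ne0$, $$\frac{\mu^\top w}{\|w\|_\Sigma}\ge\frac1{2c^2}\cdot\frac{N}{D_t}.$$ -/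

import Mathlib

open MeasureTheory
open scoped Matrix

noncomputable section

namespace RidgeClassification

/-- Indices of the first `k` coordinates (the spiked part). -/
abbrev Head (p k : ℕ) : Type := {i : Fin p // i.val < k}

/-- Indices of the remaining `p - k` coordinates (the tail). -/
abbrev Tail (p k : ℕ) : Type := {i : Fin p // k ≤ i.val}

/-- The matrix of the first `k` columns of `M`. -/
def headCols {n p : ℕ} (k : ℕ) (M : Matrix (Fin n) (Fin p) ℝ) :
    Matrix (Fin n) (Head p k) ℝ :=
  M.submatrix id Subtype.val

/-- The matrix of the last `p - k` columns of `M`. -/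
def tailCols {n p : ℕ} (k : ℕ) (M : Matrix (Fin n) (Fin p) ℝ) :
    Matrix (Fin n) (Tail p k) ℝ :=
  M.submatrix id Subtype.val

/-- The last `p - k` coordinates of `u`. -/
def tailVec {p : ℕ} (k : ℕ) (u : Fin p → ℝ) : Tail p k → ℝ := fun i => u i.val

/-! ### Data, ridge solution.  Coordinates are taken in an eigenbasis of the covariance, which
is therefore the diagonal matrix of its eigenvalues `lam`. -/

/-- The centred covariates `Q = Z Σ^{1/2}`, where `Σ = diag lam`. -/
def covariates {n p : ℕ} (lam : Fin p → ℝ) (Z : Matrix (Fin n) (Fin p) ℝ) :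
    Matrix (Fin n) (Fin p) ℝ :=
  Z * Matrix.diagonal (fun i => √(lam i))

/-- The data matrix `X = y μᵀ + Z Σ^{1/2}`. -/
def dataMatrix {n p : ℕ} (lam mu : Fin p → ℝ) (Z : Matrix (Fin n) (Fin p) ℝ)
    (y : Fin n → ℝ) : Matrix (Fin n) (Fin p) ℝ :=
  Matrix.vecMulVec y mu + covariates lam Z

/-- The regularised Gram matrix `X Xᵀ + λ I`. -/
def ridgeGram {n p : ℕ} (lam mu : Fin p → ℝ) (reg : ℝ) (Z : Matrix (Fin n) (Fin p) ℝ)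
    (y : Fin n → ℝ) : Matrix (Fin n) (Fin n) ℝ :=
  dataMatrix lam mu Z y * (dataMatrix lam mu Z y)ᵀ + reg • (1 : Matrix (Fin n) (Fin n) ℝ)

/-- The ridge solution `w = Xᵀ (X Xᵀ + λ I)⁻¹ ŷ`. -/
def wRidge {n p : ℕ} (lam mu : Fin p → ℝ) (reg : ℝ) (Z : Matrix (Fin n) (Fin p) ℝ)
    (y yhat : Fin n → ℝ) : Fin p → ℝ :=
  (dataMatrix lam mu Z y)ᵀ *ᵥ ((ridgeGram lam mu reg Z y)⁻¹ *ᵥ yhat)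

/-- `‖w‖_Σ = √(wᵀ Σ w)`. -/
def sigmaNorm {p : ℕ} (lam w : Fin p → ℝ) : ℝ :=
  √(w ⬝ᵥ (Matrix.diagonal lam *ᵥ w))

/-! ### The scalar quantities.  All matrices entering them are diagonal, so they act coordinatewise:
`Λ n⁻¹ Σ_{0:k}⁻¹ + I` has diagonal entries `(Λ / n) (lam i)⁻¹ + 1`. -/

/-- `Λ = λ + ∑_{i>k} λ_i`. -/
def Lam {p : ℕ} (lam : Fin p → ℝ) (reg : ℝ) (k : ℕ) : ℝ :=
  reg + ∑ i : Tail p k, lam i.val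

/-- `∑_{i>k} λ_i²`. -/
def tailSq {p : ℕ} (lam : Fin p → ℝ) (k : ℕ) : ℝ :=
  ∑ i : Tail p k, lam i.val ^ 2

/-- The diagonal entries of `Λ n⁻¹ Σ_{0:k}⁻¹ + I_k`. -/
def headShrink {p : ℕ} (n : ℕ) (lam : Fin p → ℝ) (reg : ℝ) (k : ℕ) (i : Head p k) : ℝ :=
  Lam lam reg k / n * (lam i.val)⁻¹ + 1

/-- `V = n⁻¹ tr((Λ n⁻¹ Σ_{0:k}⁻¹ + I_k)⁻²) + Λ⁻² n ∑_{i>k} λ_i²`. -/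
def V {p : ℕ} (n : ℕ) (lam : Fin p → ℝ) (reg : ℝ) (k : ℕ) : ℝ :=
  (n : ℝ)⁻¹ * ∑ i : Head p k, ((headShrink n lam reg k i)⁻¹) ^ 2
    + ((Lam lam reg k)⁻¹) ^ 2 * n * tailSq lam k

/-- `ΔV = min (1/n) (n λ_1² / Λ²) + (n λ_{k+1}² + ∑_{i>k} λ_i²) / Λ²`. -/
def DeltaV {p : ℕ} (n : ℕ) (lam : Fin p → ℝ) (reg : ℝ) (k : ℕ) (hk : k < p) : ℝ :=
  min (1 / (n : ℝ)) (n * lam ⟨0, Nat.zero_lt_of_lt hk⟩ ^ 2 / Lam lam reg k ^ 2)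
    + (n * lam ⟨k, hk⟩ ^ 2 + tailSq lam k) / Lam lam reg k ^ 2

/-- `B = n⁻² Λ² ‖(Λ n⁻¹ Σ_{0:k}⁻¹ + I_k)⁻¹ Σ_{0:k}^{-1/2} μ_{0:k}‖² + ‖μ_{k:∞}‖²_{Σ_{k:∞}}`. -/
def B {p : ℕ} (n : ℕ) (lam mu : Fin p → ℝ) (reg : ℝ) (k : ℕ) : ℝ :=
  ((n : ℝ)⁻¹) ^ 2 * Lam lam reg k ^ 2 *
      ∑ i : Head p k, ((headShrink n lam reg k i)⁻¹ * ((√(lam i.val))⁻¹ * mu i.val)) ^ 2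
    + ∑ i : Tail p k, lam i.val * mu i.val ^ 2

/-- `◊ = √(n Λ⁻² B)`. -/
def Dia {p : ℕ} (n : ℕ) (lam mu : Fin p → ℝ) (reg : ℝ) (k : ℕ) : ℝ :=
  √(n * ((Lam lam reg k)⁻¹) ^ 2 * B n lam mu reg k)

/-- `M = (Λ/n) ‖(Λ n⁻¹ Σ_{0:k}⁻¹ + I_k)^{-1/2} Σ_{0:k}^{-1/2} μ_{0:k}‖² + ‖μ_{k:∞}‖²`. -/
def M {p : ℕ} (n : ℕ) (lam mu : Fin p → ℝ) (reg : ℝ) (k : ℕ) : ℝ :=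
  Lam lam reg k / n *
      ∑ i : Head p k, ((√(headShrink n lam reg k i))⁻¹ * ((√(lam i.val))⁻¹ * mu i.val)) ^ 2
    + ∑ i : Tail p k, mu i.val ^ 2

/-- `N = n Λ⁻¹ M`. -/
def N {p : ℕ} (n : ℕ) (lam mu : Fin p → ℝ) (reg : ℝ) (k : ℕ) : ℝ :=
  n * (Lam lam reg k)⁻¹ * M n lam mu reg k

/-- `σ_η = 1 / √(ln((3 + η⁻¹)/2))`, which is `0` at `η = 0` (where `η⁻¹ = ∞`). -/
def sigmaEta (η : ℝ) : ℝ :=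
  if η = 0 then 0 else 1 / √(Real.log ((3 + η⁻¹) / 2))

/-- The factor `[1 + N σ_η] √(V + t² ΔV) + ◊ √n`. -/
def denomBound {p : ℕ} (n : ℕ) (lam mu : Fin p → ℝ) (reg : ℝ) (k : ℕ) (hk : k < p)
    (η t : ℝ) : ℝ :=
  (1 + N n lam mu reg k * sigmaEta η) * √(V n lam reg k + t ^ 2 * DeltaV n lam reg k hk)
    + Dia n lam mu reg k * √(n : ℝ)

/-! ### The events on the covariates -/

/-- `A_k = Q_{k:∞} Q_{k:∞}ᵀ + λ I`. -/
def tailGram {n p : ℕ} (lam : Fin p → ℝ) (reg : ℝ) (k : ℕ) (Z : Matrix (Fin n) (Fin p) ℝ) :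
    Matrix (Fin n) (Fin n) ℝ :=
  tailCols k (covariates lam Z) * (tailCols k (covariates lam Z))ᵀ
    + reg • (1 : Matrix (Fin n) (Fin n) ℝ)

/-- The event `𝒜_k(L)`: all eigenvalues of the symmetric matrix `A_k` lie in `[Λ/L, LΛ]`. -/
def EventA {n p : ℕ} (lam : Fin p → ℝ) (reg : ℝ) (k : ℕ) (L : ℝ)
    (Z : Matrix (Fin n) (Fin p) ℝ) : Prop :=
  spectrum ℝ (tailGram lam reg k Z) ⊆ Set.Icc (1 / L * Lam lam reg k) (L * Lam lam reg k)

/-- The matrix `Q_{k:∞} Σ_{k:∞} Q_{k:∞}ᵀ`. -/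
def tailSigmaGram {n p : ℕ} (lam : Fin p → ℝ) (k : ℕ) (Z : Matrix (Fin n) (Fin p) ℝ) :
    Matrix (Fin n) (Fin n) ℝ :=
  tailCols k (covariates lam Z) * Matrix.diagonal (tailVec k lam)
    * (tailCols k (covariates lam Z))ᵀ

/-- The event `ℬ_k(c_B)`.  The first clause bounds the largest and the smallest of the `k`
eigenvalues of `Z_{0:k}ᵀ Z_{0:k}`; it is void for `k = 0`. The norm in the last clause is the
spectral norm. -/
structure EventB {n p : ℕ} (lam mu : Fin p → ℝ) (k : ℕ) (hk : k < p) (cB : ℝ)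
    (Z : Matrix (Fin n) (Fin p) ℝ) : Prop where
  head_spectrum :
    spectrum ℝ ((headCols k Z)ᵀ * headCols k Z) ⊆ Set.Icc ((n : ℝ) / cB) (cB * n)
  tail_mu :
    (tailCols k (covariates lam Z) *ᵥ tailVec k mu) ⬝ᵥ
        (tailCols k (covariates lam Z) *ᵥ tailVec k mu)
      ≤ cB * n * ∑ i : Tail p k, lam i.val * mu i.val ^ 2
  tail_trace : (tailSigmaGram lam k Z).trace ≤ cB * n * tailSq lam k
  head_trace : ((headCols k Z)ᵀ * headCols k Z).trace ≤ cB * n * k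
  tail_norm :
    ‖Matrix.toEuclideanCLM (𝕜 := ℝ) (tailSigmaGram lam k Z)‖
      ≤ cB * (tailSq lam k + n * lam ⟨k, hk⟩ ^ 2)

/-! ### The labels -/

/-- The law of a random sign that equals `-1` with probability `q` and `1` otherwise. -/
def signLaw (q : ℝ) : Measure ℝ :=
  ENNReal.ofReal (1 - q) • Measure.dirac 1 + ENNReal.ofReal q • Measure.dirac (-1)

/-- The joint law of the clean labels `y` (i.i.d. Rademacher) and of the label flips `s`
(i.i.d., independent of `y`, equal to `-1` with probability `η`).
The noisy labels are `ŷ = y * s`, coordinatewise. -/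
def labelLaw (n : ℕ) (η : ℝ) : Measure ((Fin n → ℝ) × (Fin n → ℝ)) :=
  (Measure.pi fun _ : Fin n => signLaw (1 / 2)).prod (Measure.pi fun _ : Fin n => signLaw η)

end RidgeClassification

end

open RidgeClassification

/-!
For fixed covariates, write `ν = Q μ` and `F = Q Qᵀ + λ I`. The regularised Gram matrix of the data
is `F + ν yᵀ + y νᵀ + ‖μ‖² y yᵀ`, a perturbation of `F` in the span of `y` and `ν`, so the ridge
solution is explicit (`rank_two_solution`, `Regime.ridge_decomposition`). With
`S = (1 + νᵀ F⁻¹ y)² + (yᵀ F⁻¹ y) (‖μ‖² - νᵀ F⁻¹ ν)`, which is the quotient of the determinants of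
the two Gram matrices, both `S μᵀ w` and the coefficients of `S w` along `Qᵀ F⁻¹ y`,
`Qᵀ F⁻¹ (ŷ - y)` and `μ - Qᵀ F⁻¹ ν` are polynomials in a few quadratic forms of `y` and of the label
noise `e = ŷ - y`.

The matrices in these forms are estimated in two ways. The vector `u = F⁻¹ ν` minimises a quadratic
functional whose minimum `‖μ‖² - νᵀ F⁻¹ ν` is compared with `M` coordinate by coordinate
(`WellConditioned.signal_bounds`). For `‖F⁻¹ ν‖`, `‖μ - Qᵀ F⁻¹ ν‖_Σ`, and the trace and norm of the
matrix `H` with `yᵀ H y = ‖Qᵀ F⁻¹ y‖_Σ²`, a single perturbation estimate suffices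
(`WellConditioned.residual_bounds`). With `A` the tail part of `F` and `Z` the head columns,
inverting `F` amounts to inverting `Σ⁻¹ + Zᵀ A⁻¹ Z` on the head, and there `Zᵀ A⁻¹ Z` may be replaced
by the multiple `n / Λ` of the identity at the cost of a constant factor.

The randomness of the labels enters through six positive semidefinite quadratic forms, all bounded
by one Hanson–Wright inequality (`measure_quadratic_gt_le`). It applies to `y`, with variance proxy
`1`, and directly to `e`, whose entries are independent, symmetric, and nonzero only with
probability `η`, so that their variance proxy is of order `σ_η²` (`isSubGaussianVec_labelNoise`).
Even the bilinear form `yᵀ F⁻¹ e` needs nothing more: by the Cauchy–Schwarz inequality it is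
controlled by `‖e‖²`. The lower bound on `yᵀ F⁻¹ y` comes from projecting `y` off the column space
of the head, whose dimension `k` is small compared with `n` (`WellConditioned.le_dotProduct_full_inv`).
-/

namespace RidgeClassification

/-! ### Quadratic forms of symmetric matrices -/

/-- Diagonalisation of a real symmetric matrix in the form used below: an orthogonal `U` whose
columns are eigenvectors, with the eigenvalues `θ`. -/
lemma exists_orthogonal_diagonalization {ι : Type*} [Fintype ι] [DecidableEq ι]
    {H : Matrix ι ι ℝ} (hH : H.IsHermitian) :
    ∃ (U : Matrix ι ι ℝ) (θ : ι → ℝ), Uᵀ * U = 1 ∧ U * Uᵀ = 1 ∧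
      H = U * Matrix.diagonal θ * Uᵀ ∧ (∀ j, θ j ∈ spectrum ℝ H) ∧ H.trace = ∑ j, θ j := by
  have hU := hH.eigenvectorUnitary.2
  rw [Matrix.mem_unitaryGroup_iff] at hU
  have hU' := hH.eigenvectorUnitary.2
  rw [Matrix.mem_unitaryGroup_iff'] at hU'
  refine ⟨hH.eigenvectorUnitary, hH.eigenvalues, ?_, ?_, ?_, hH.eigenvalues_mem_spectrum_real, ?_⟩
  · simpa [Matrix.star_eq_conjTranspose] using hU'
  · simpa [Matrix.star_eq_conjTranspose] using hU
  · have := hH.spectral_theorem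
    rw [Unitary.conjStarAlgAut_apply] at this
    simpa [Matrix.star_eq_conjTranspose, Function.comp_def] using this
  · simpa using hH.trace_eq_sum_eigenvalues

lemma dotProduct_mulVec_transpose {ι κ : Type*} [Fintype ι] [Fintype κ]
    (M : Matrix ι κ ℝ) (x : ι → ℝ) (v : κ → ℝ) : x ⬝ᵥ (M *ᵥ v) = (Mᵀ *ᵥ x) ⬝ᵥ v := by
  rw [Matrix.dotProduct_mulVec, Matrix.mulVec_transpose]

lemma dotProduct_diagonalized_mulVec {ι : Type*} [Fintype ι] [DecidableEq ι]
    (U : Matrix ι ι ℝ) (θ x : ι → ℝ) :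
    x ⬝ᵥ ((U * Matrix.diagonal θ * Uᵀ) *ᵥ x) = ∑ j, θ j * (Uᵀ *ᵥ x) j ^ 2 := by
  rw [← Matrix.mulVec_mulVec, ← Matrix.mulVec_mulVec, dotProduct_mulVec_transpose]
  simp only [dotProduct, Matrix.mulVec_diagonal]
  exact Finset.sum_congr rfl fun j _ => by ring

lemma dotProduct_orthogonal_mulVec_self {ι : Type*} [Fintype ι] [DecidableEq ι]
    {U : Matrix ι ι ℝ} (hU : Uᵀ * U = 1) (x : ι → ℝ) : (U *ᵥ x) ⬝ᵥ (U *ᵥ x) = x ⬝ᵥ x := by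
  rw [dotProduct_mulVec_transpose, Matrix.mulVec_mulVec, hU, Matrix.one_mulVec]

/-! ### A Hanson–Wright inequality -/

lemma lintegral_pi_prod {ι : Type*} [Fintype ι] (m : ι → Measure ℝ)
    [∀ i, IsProbabilityMeasure (m i)] (f : ι → ℝ → ENNReal) (hf : ∀ i, Measurable (f i)) :
    ∫⁻ x, ∏ i, f i (x i) ∂(Measure.pi m) = ∏ i, ∫⁻ x, f i x ∂(m i) := by
  refine (ProbabilityTheory.lintegral_prod_eq_prod_lintegral_of_indepFun Finset.univ
    (fun i (x : ι → ℝ) => f i (x i)) (ProbabilityTheory.iIndepFun_pi fun i => (hf i).aemeasurable)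
    (fun i => (hf i).comp (measurable_pi_apply i))).trans ?_
  refine Finset.prod_congr rfl fun i _ => ?_
  exact ((measurePreserving_eval m i).lintegral_comp (hf i))

lemma ofReal_exp_sum {ι : Type*} [Fintype ι] (f : ι → ℝ) :
    ENNReal.ofReal (Real.exp (∑ i, f i)) = ∏ i, ENNReal.ofReal (Real.exp (f i)) := by
  rw [Real.exp_sum, ENNReal.ofReal_prod_of_nonneg fun i _ => (Real.exp_pos _).le]

lemma lintegral_exp_mul_gaussian (a : ℝ) :
    ∫⁻ g, ENNReal.ofReal (Real.exp (a * g)) ∂(ProbabilityTheory.gaussianReal 0 1)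
      = ENNReal.ofReal (Real.exp (a ^ 2 / 2)) := by
  rw [← ofReal_integral_eq_lintegral_ofReal (ProbabilityTheory.integrable_exp_mul_gaussianReal a)
    (Filter.Eventually.of_forall fun _ => (Real.exp_pos _).le)]
  have := congrFun (ProbabilityTheory.mgf_fun_id_gaussianReal (μ := 0) (v := 1)) a
  simp only [ProbabilityTheory.mgf] at this
  rw [this]; simp

/-- The moment generating function of `g²` at `b ≤ 1/4` is `(1 - 2b)^{-1/2} ≤ exp (2 b)`. -/
lemma lintegral_exp_mul_sq_gaussian_le {b : ℝ} (hb0 : 0 ≤ b) (hb : b ≤ 1 / 4) :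
    ∫⁻ g, ENNReal.ofReal (Real.exp (b * g ^ 2)) ∂(ProbabilityTheory.gaussianReal 0 1)
      ≤ ENNReal.ofReal (Real.exp (2 * b)) := by
  rw [ProbabilityTheory.gaussianReal_of_var_ne_zero _ one_ne_zero,
    lintegral_withDensity_eq_lintegral_mul _ (ProbabilityTheory.measurable_gaussianPDF 0 1)
      (by fun_prop)]
  have h1 : ∀ g : ℝ, (ProbabilityTheory.gaussianPDF 0 1 *
      fun g => ENNReal.ofReal (Real.exp (b * g ^ 2))) g
      = ENNReal.ofReal ((√(2 * Real.pi))⁻¹ * Real.exp (-(1 / 2 - b) * g ^ 2)) := by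
    intro g
    simp only [Pi.mul_apply, ProbabilityTheory.gaussianPDF, ProbabilityTheory.gaussianPDFReal]
    rw [← ENNReal.ofReal_mul (by positivity), mul_assoc, ← Real.exp_add]
    congr 3
    · simp
    · simp; ring
  simp_rw [h1]
  rw [← ofReal_integral_eq_lintegral_ofReal
    ((integrable_exp_neg_mul_sq (by linarith)).const_mul _)
    (Filter.Eventually.of_forall fun _ => by positivity), integral_const_mul, integral_gaussian]
  apply ENNReal.ofReal_le_ofReal
  rw [← Real.sqrt_inv, ← Real.sqrt_mul (by positivity)]
  apply Real.sqrt_le_iff.2 ⟨(Real.exp_pos _).le, ?_⟩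
  rw [← Real.exp_nat_mul]
  have e1 : (2 * Real.pi)⁻¹ * (Real.pi / (1 / 2 - b)) = (1 - 2 * b)⁻¹ := by
    field_simp
  rw [e1, inv_le_comm₀ (by linarith) (Real.exp_pos _), ← Real.exp_neg]
  -- `exp (-x) ≤ 1 / (1 + x) ≤ 1 - x / 2` for `x = 4 b ∈ [0, 1]`
  have h5 := Real.add_one_le_exp (4 * b)
  have h6 : Real.exp (-(4 * b)) ≤ (1 + 4 * b)⁻¹ := by
    rw [Real.exp_neg]; exact inv_anti₀ (by linarith) (by linarith)
  have h7 : (1 + 4 * b)⁻¹ ≤ 1 - 2 * b := by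
    rw [inv_le_iff_one_le_mul₀ (by linarith)]; nlinarith
  push_cast
  rw [show -(2 * (2 * b)) = -(4 * b) by ring]
  linarith

/-- The random vector `x` is sub-Gaussian with variance proxy `s`. -/
def IsSubGaussianVec {Ω ι : Type*} [MeasurableSpace Ω] [Fintype ι] (P : Measure Ω)
    (x : Ω → ι → ℝ) (s : ℝ) : Prop :=
  ∀ v : ι → ℝ, ∫⁻ ω, ENNReal.ofReal (Real.exp (v ⬝ᵥ x ω)) ∂P
    ≤ ENNReal.ofReal (Real.exp (s / 2 * (v ⬝ᵥ v)))

/-- Gaussian decoupling: for a standard Gaussian `g`, the exponential of `r xᵀ H x` is the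
expectation over `g` of `exp (√(2 r) gᵀ H^{1/2} x)`, and the expectation over `x` of the latter
is controlled by the sub-Gaussian hypothesis. -/
lemma lintegral_exp_quadratic_le {Ω ι : Type*} [MeasurableSpace Ω] [Fintype ι] [DecidableEq ι]
    {P : Measure Ω} [IsProbabilityMeasure P] {x : Ω → ι → ℝ} (hx : Measurable x) {s : ℝ}
    (hs : 0 ≤ s) (hsub : IsSubGaussianVec P x s) {H : Matrix ι ι ℝ} (hH : H.IsHermitian)
    (h0 : ∀ v, 0 ≤ v ⬝ᵥ (H *ᵥ v)) {θ : ℝ} (hθ : ∀ v, v ⬝ᵥ (H *ᵥ v) ≤ θ * (v ⬝ᵥ v))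
    {r : ℝ} (hr : 0 ≤ r) (hrs : s * r * θ ≤ 1 / 4) :
    ∫⁻ ω, ENNReal.ofReal (Real.exp (r * (x ω ⬝ᵥ (H *ᵥ x ω)))) ∂P
      ≤ ENNReal.ofReal (Real.exp (2 * (s * r * H.trace))) := by
  obtain ⟨U, d, hU, hU', hHd, -, htr⟩ := exists_orthogonal_diagonalization hH
  -- the eigenvalues lie in `[0, θ]`
  have hd : ∀ j, d j = (U *ᵥ Pi.single j 1) ⬝ᵥ (H *ᵥ (U *ᵥ Pi.single j 1)) := by
    intro j
    rw [hHd, dotProduct_diagonalized_mulVec, Matrix.mulVec_mulVec, hU, Matrix.one_mulVec,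
      Finset.sum_eq_single j] <;> simp +contextual
  have hd0 : ∀ j, 0 ≤ d j := fun j => by rw [hd]; exact h0 _
  have hd1 : ∀ j, d j ≤ θ := fun j => by
    rw [hd]; refine (hθ _).trans_eq ?_
    rw [dotProduct_orthogonal_mulVec_self hU]; simp
  set γ := Measure.pi fun _ : ι => ProbabilityTheory.gaussianReal 0 1
  set c : ι → ℝ := fun j => √(2 * (r * d j))
  have hc : ∀ j, c j ^ 2 = 2 * (r * d j) := fun j =>
    Real.sq_sqrt (by have := hd0 j; positivity)
  have key : ∀ ω, ENNReal.ofReal (Real.exp (r * (x ω ⬝ᵥ (H *ᵥ x ω))))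
      = ∫⁻ g, ENNReal.ofReal (Real.exp ((U *ᵥ fun j => c j * g j) ⬝ᵥ x ω)) ∂γ := by
    intro ω
    have e1 : ∀ g : ι → ℝ, (U *ᵥ fun j => c j * g j) ⬝ᵥ x ω
        = ∑ j, (c j * (Uᵀ *ᵥ x ω) j) * g j := by
      intro g
      rw [dotProduct_comm, dotProduct_mulVec_transpose]
      exact Finset.sum_congr rfl fun j _ => by ring
    simp_rw [e1, ofReal_exp_sum]
    rw [lintegral_pi_prod _ (fun j g => ENNReal.ofReal (Real.exp (c j * (Uᵀ *ᵥ x ω) j * g)))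
      (fun j => by fun_prop)]
    simp_rw [lintegral_exp_mul_gaussian]
    rw [← ofReal_exp_sum, hHd, dotProduct_diagonalized_mulVec, Finset.mul_sum]
    congr 3
    funext j
    rw [mul_pow, hc]; ring
  simp_rw [key]
  rw [lintegral_lintegral_swap (by
    apply Measurable.aemeasurable
    apply ENNReal.measurable_ofReal.comp
    apply Real.measurable_exp.comp
    simp only [dotProduct, Matrix.mulVec]
    fun_prop)]
  calc _ ≤ ∫⁻ g, ENNReal.ofReal (Real.exp (∑ j, (s * (r * d j)) * g j ^ 2)) ∂γ := by
        refine lintegral_mono fun g => (hsub _).trans_eq ?_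
        rw [dotProduct_orthogonal_mulVec_self hU]
        congr 2
        rw [dotProduct, Finset.mul_sum]
        refine Finset.sum_congr rfl fun j _ => ?_
        have := hc j
        linear_combination s / 2 * g j ^ 2 * this
    _ = ∏ j, ∫⁻ g, ENNReal.ofReal (Real.exp ((s * (r * d j)) * g ^ 2))
          ∂(ProbabilityTheory.gaussianReal 0 1) := by
        simp_rw [ofReal_exp_sum]
        exact lintegral_pi_prod _
          (fun j g => ENNReal.ofReal (Real.exp ((s * (r * d j)) * g ^ 2))) (fun j => by fun_prop)
    _ ≤ ∏ j, ENNReal.ofReal (Real.exp (2 * (s * (r * d j)))) := by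
        refine Finset.prod_le_prod' fun j _ => lintegral_exp_mul_sq_gaussian_le ?_ ?_
        · have := hd0 j; positivity
        · have : s * r * d j ≤ s * r * θ := by gcongr; exact hd1 j
          linarith
    _ = _ := by
        rw [← ofReal_exp_sum, htr]
        congr 2
        simp_rw [Finset.mul_sum]
        exact Finset.sum_congr rfl fun j _ => by ring

/-- Upper tail of a positive semidefinite quadratic form of a sub-Gaussian vector. -/
lemma measure_quadratic_gt_le {Ω ι : Type*} [MeasurableSpace Ω] [Fintype ι] [DecidableEq ι]
    {P : Measure Ω} [IsProbabilityMeasure P] {x : Ω → ι → ℝ} (hx : Measurable x) {s : ℝ}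
    (hs : 0 < s) (hsub : IsSubGaussianVec P x s) {H : Matrix ι ι ℝ} (hH : H.IsHermitian)
    (h0 : ∀ v, 0 ≤ v ⬝ᵥ (H *ᵥ v)) {θ : ℝ} (hθ0 : 0 ≤ θ)
    (hθ : ∀ v, v ⬝ᵥ (H *ᵥ v) ≤ θ * (v ⬝ᵥ v)) (t : ℝ) :
    P {ω | 2 * s * (H.trace + t ^ 2 * θ) < x ω ⬝ᵥ (H *ᵥ x ω)}
      ≤ ENNReal.ofReal (Real.exp (-t ^ 2 / 2)) := by
  rcases hθ0.eq_or_lt with rfl | hθ0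
  · -- a form bounded by `0` vanishes, and its trace is nonnegative
    have htr : 0 ≤ H.trace := Finset.sum_nonneg fun i _ => by
      simpa using h0 (Pi.single i 1)
    have : {ω | 2 * s * (H.trace + t ^ 2 * 0) < x ω ⬝ᵥ (H *ᵥ x ω)} = ∅ := by
      ext ω
      simp only [mul_zero, add_zero, Set.mem_ofPred_eq, Set.mem_empty_iff_false, iff_false, not_lt]
      have := hθ (x ω)
      have h2 : 0 ≤ 2 * s * H.trace := by positivity
      linarith
    rw [this]; simp
  set r := 1 / (4 * s * θ) with hrdef
  have hr : 0 < r := by positivity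
  have hrs : s * r * θ = 1 / 4 := by rw [hrdef]; field_simp
  have hM := lintegral_exp_quadratic_le hx hs.le hsub hH h0 hθ hr.le hrs.le
  set τ := 2 * s * (H.trace + t ^ 2 * θ)
  have hmeas : Measurable fun ω => ENNReal.ofReal (Real.exp (r * (x ω ⬝ᵥ (H *ᵥ x ω)))) := by
    simp only [dotProduct, Matrix.mulVec]
    fun_prop
  have hmk := mul_meas_ge_le_lintegral (μ := P) hmeas (ENNReal.ofReal (Real.exp (r * τ)))
  have hne : ENNReal.ofReal (Real.exp (r * τ)) ≠ 0 := by
    simp [Real.exp_pos]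
  calc P {ω | τ < x ω ⬝ᵥ (H *ᵥ x ω)}
      ≤ P {ω | ENNReal.ofReal (Real.exp (r * τ))
          ≤ ENNReal.ofReal (Real.exp (r * (x ω ⬝ᵥ (H *ᵥ x ω))))} := by
        refine measure_mono fun ω hω => ?_
        exact ENNReal.ofReal_le_ofReal (Real.exp_le_exp.2 (by
          have : τ < x ω ⬝ᵥ (H *ᵥ x ω) := hω
          gcongr))
    _ ≤ ENNReal.ofReal (Real.exp (2 * (s * r * H.trace))) / ENNReal.ofReal (Real.exp (r * τ)) := by
        rw [ENNReal.le_div_iff_mul_le (Or.inl hne) (Or.inl ENNReal.ofReal_ne_top), mul_comm]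
        exact hmk.trans hM
    _ = _ := by
        rw [← ENNReal.ofReal_div_of_pos (Real.exp_pos _), ← Real.exp_sub]
        congr 2
        simp only [τ]
        linear_combination (-2 * t ^ 2) * hrs

/-! ### The random labels -/

lemma isProbabilityMeasure_signLaw {q : ℝ} (h0 : 0 ≤ q) (h1 : q ≤ 1) :
    IsProbabilityMeasure (signLaw q) := by
  constructor
  simp only [signLaw, Measure.coe_add, Measure.coe_smul, Pi.add_apply, Pi.smul_apply,
    measure_univ, smul_eq_mul, mul_one]
  rw [← ENNReal.ofReal_add (by linarith) h0]
  simp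

lemma lintegral_signLaw (q : ℝ) {f : ℝ → ENNReal} (hf : Measurable f) :
    ∫⁻ x, f x ∂(signLaw q) = ENNReal.ofReal (1 - q) * f 1 + ENNReal.ofReal q * f (-1) := by
  rw [signLaw, lintegral_add_measure, lintegral_smul_measure, lintegral_smul_measure,
    lintegral_dirac' _ hf, lintegral_dirac' _ hf]
  rfl

lemma lintegral_exp_mul_signLaw_half (a : ℝ) :
    ∫⁻ x, ENNReal.ofReal (Real.exp (a * x)) ∂(signLaw (1 / 2)) = ENNReal.ofReal (Real.cosh a) := by
  rw [lintegral_signLaw _ (by fun_prop), ← ENNReal.ofReal_mul (by norm_num),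
    ← ENNReal.ofReal_mul (by norm_num), ← ENNReal.ofReal_add (by positivity) (by positivity),
    Real.cosh_eq]
  congr 1
  ring_nf

lemma ae_signLaw (q : ℝ) : ∀ᵐ x ∂(signLaw q), x ^ 2 = 1 := by
  rw [signLaw, ae_add_measure_iff]
  constructor <;> refine Measure.ae_smul_measure ?_ _ <;>
    rw [ae_dirac_iff (measurableSet_eq_fun (by fun_prop) (by fun_prop))] <;> norm_num

instance isProbabilityMeasure_signLaw_half : IsProbabilityMeasure (signLaw (1 / 2)) :=
  isProbabilityMeasure_signLaw (by norm_num) (by norm_num)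

lemma isSubGaussianVec_rademacher (n : ℕ) :
    IsSubGaussianVec (Measure.pi fun _ : Fin n => signLaw (1 / 2)) (fun y => y) 1 := by
  intro v
  simp_rw [dotProduct, ofReal_exp_sum]
  rw [lintegral_pi_prod _ (fun i y => ENNReal.ofReal (Real.exp (v i * y))) (fun i => by fun_prop)]
  simp_rw [lintegral_exp_mul_signLaw_half]
  rw [Finset.mul_sum, ofReal_exp_sum]
  refine Finset.prod_le_prod' fun i _ => ENNReal.ofReal_le_ofReal ?_
  refine (Real.cosh_le_exp_half_sq _).trans_eq ?_
  congr 1; ring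

lemma isProbabilityMeasure_labelLaw (n : ℕ) {η : ℝ} (h0 : 0 ≤ η) (h1 : η ≤ 1) :
    IsProbabilityMeasure (labelLaw n η) := by
  have := isProbabilityMeasure_signLaw h0 h1
  rw [labelLaw]; infer_instance

lemma isSubGaussianVec_cleanLabels (n : ℕ) {η : ℝ} (h0 : 0 ≤ η) (h1 : η ≤ 1) :
    IsSubGaussianVec (labelLaw n η) (fun ω => ω.1) 1 := by
  have := isProbabilityMeasure_signLaw h0 h1
  intro v
  have h := isSubGaussianVec_rademacher n v
  rw [labelLaw, lintegral_prod _ (by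
    apply Measurable.aemeasurable; simp only [dotProduct]; fun_prop)]
  simpa using h

lemma cosh_sub_one_le (x : ℝ) : Real.cosh x - 1 ≤ x ^ 2 / 2 * Real.exp |x| := by
  wlog hx : 0 ≤ x with H
  · have := H (-x) (by linarith)
    simpa using this
  rw [abs_of_nonneg hx]
  -- `cosh x - 1 = 2 sinh² (x/2)` and `sinh u ≤ u exp u`
  have h1 : Real.cosh x - 1 = 2 * Real.sinh (x / 2) ^ 2 := by
    have := Real.cosh_two_mul (x / 2)
    rw [show 2 * (x / 2) = x by ring] at this
    have h2 := Real.cosh_sq (x / 2)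
    linarith
  have h2 : Real.sinh (x / 2) ≤ x / 2 * Real.exp (x / 2) := by
    have h3 := Real.add_one_le_exp (-x)
    have h4 : Real.exp (-(x / 2)) = Real.exp (x / 2) * Real.exp (-x) := by
      rw [← Real.exp_add]; ring_nf
    rw [Real.sinh_eq, h4]
    nlinarith [Real.exp_pos (x / 2)]
  have h0 : 0 ≤ Real.sinh (x / 2) := Real.sinh_nonneg_iff.2 (by linarith)
  have h5 : Real.exp x = Real.exp (x / 2) ^ 2 := by rw [← Real.exp_nat_mul]; ring_nf
  rw [h1, h5]
  have := pow_le_pow_left₀ h0 h2 2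
  linarith [mul_pow (x / 2) (Real.exp (x / 2)) 2]

/-- The left-hand side is the moment generating function of the label noise `y (s - 1)`, which is
`0` with probability `1 - η` and `±2` with probability `η / 2` each. For `|v|` below the order of
the logarithm, `cosh (2 v) - 1` is at most `v²` times a power of `η⁻¹` that the factor `η` absorbs;
for larger `|v|`, the bound `2 |v|` on the exponent is already below the right-hand side. -/
lemma one_add_mul_cosh_sub_one_le {η : ℝ} (h0 : 0 < η) (h1 : η ≤ 1) (v : ℝ) :
    1 + η * (Real.cosh (2 * v) - 1)
      ≤ Real.exp (8 * v ^ 2 / Real.log ((3 + η⁻¹) / 2)) := by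
  have hinv : 1 ≤ η⁻¹ := (one_le_inv₀ h0).2 h1
  set q := (3 + η⁻¹) / 2 with hq
  have hq2 : 2 ≤ q := by rw [hq]; linarith
  set l := Real.log q with hl
  have hl0 : 0 < l := Real.log_pos (by linarith)
  have hηq : η * q ≤ 2 := by
    have : η * η⁻¹ = 1 := mul_inv_cancel₀ h0.ne'
    rw [hq]; nlinarith
  by_cases hv : 2 * |v| ≤ l / 2
  · have hsq : Real.exp (l / 2) = √q := by
      rw [hl, Real.sqrt_eq_rpow, Real.rpow_def_of_pos (by linarith)]; ring_nf
    have hlq : l ≤ 2 * √q := by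
      have := Real.add_one_le_exp (l / 2)
      rw [hsq] at this; linarith
    have hcosh := cosh_sub_one_le (2 * v)
    have hexp : Real.exp |2 * v| ≤ √q := by
      rw [← hsq, abs_mul, abs_of_pos (by norm_num : (0 : ℝ) < 2)]
      exact Real.exp_le_exp.2 hv
    have hb : η * √q * l ≤ 4 := by
      have hs := Real.mul_self_sqrt (show 0 ≤ q by linarith)
      have : η * √q * l ≤ η * √q * (2 * √q) := by gcongr
      nlinarith
    have h3 : η * (Real.cosh (2 * v) - 1) ≤ 8 * v ^ 2 / l := by
      rw [le_div_iff₀ hl0]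
      have e1 : η * (Real.cosh (2 * v) - 1) * l ≤ η * ((2 * v) ^ 2 / 2 * √q) * l := by
        gcongr
        exact hcosh.trans (by gcongr)
      nlinarith [sq_nonneg v]
    have := Real.add_one_le_exp (8 * v ^ 2 / l)
    linarith
  · push Not at hv
    have hcosh : Real.cosh (2 * v) ≤ Real.exp (2 * |v|) := by
      rw [← Real.cosh_abs, abs_mul, abs_of_pos (by norm_num : (0 : ℝ) < 2)]
      rw [Real.cosh_eq]
      have : Real.exp (-(2 * |v|)) ≤ Real.exp (2 * |v|) :=
        Real.exp_le_exp.2 (by linarith [abs_nonneg v])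
      linarith
    have h2 : 1 + η * (Real.cosh (2 * v) - 1) ≤ Real.cosh (2 * v) := by
      nlinarith [Real.one_le_cosh (2 * v)]
    refine h2.trans (hcosh.trans (Real.exp_le_exp.2 ?_))
    rw [le_div_iff₀ hl0]
    nlinarith [abs_nonneg v, sq_abs v]

lemma lintegral_cosh_signLaw_le {η : ℝ} (h0 : 0 < η) (h1 : η ≤ 1) (v : ℝ) :
    ∫⁻ s, ENNReal.ofReal (Real.cosh (v * (s - 1))) ∂(signLaw η)
      ≤ ENNReal.ofReal (Real.exp (16 * sigmaEta η ^ 2 / 2 * (v * v))) := by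
  rw [lintegral_signLaw _ (by fun_prop), ← ENNReal.ofReal_mul (by linarith),
    ← ENNReal.ofReal_mul h0.le, ← ENNReal.ofReal_add
      (mul_nonneg (by linarith) (Real.cosh_pos _).le) (mul_nonneg h0.le (Real.cosh_pos _).le)]
  apply ENNReal.ofReal_le_ofReal
  have hl : 0 ≤ Real.log ((3 + η⁻¹) / 2) := Real.log_nonneg (by
    have := (one_le_inv₀ h0).2 h1
    linarith)
  have h := one_add_mul_cosh_sub_one_le h0 h1 v
  have e : Real.cosh (v * (-1 - 1)) = Real.cosh (2 * v) := by
    rw [← Real.cosh_neg]; ring_nf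
  rw [e, sub_self, mul_zero, Real.cosh_zero, sigmaEta, if_neg h0.ne', div_pow, Real.sq_sqrt hl]
  refine le_trans (by linarith) (h.trans_eq ?_)
  congr 1; ring

lemma isSubGaussianVec_labelNoise (n : ℕ) {η : ℝ} (h0 : 0 < η) (h1 : η ≤ 1) :
    IsSubGaussianVec (labelLaw n η) (fun ω => ω.1 * (ω.2 - 1)) (16 * sigmaEta η ^ 2) := by
  have := isProbabilityMeasure_signLaw h0.le h1
  intro v
  rw [labelLaw, lintegral_prod_symm _ (by
    apply Measurable.aemeasurable
    simp only [dotProduct, Pi.mul_apply, Pi.sub_apply, Pi.one_apply]; fun_prop)]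
  have e1 : ∀ s : Fin n → ℝ, ∫⁻ y, ENNReal.ofReal (Real.exp (v ⬝ᵥ (y * (s - 1))))
      ∂(Measure.pi fun _ : Fin n => signLaw (1 / 2))
      = ∏ i, ENNReal.ofReal (Real.cosh (v i * (s i - 1))) := by
    intro s
    have e2 : ∀ y : Fin n → ℝ, v ⬝ᵥ (y * (s - 1)) = ∑ i, (v i * (s i - 1)) * y i := by
      intro y
      exact Finset.sum_congr rfl fun i _ => by simp; ring
    simp_rw [e2, ofReal_exp_sum]
    rw [lintegral_pi_prod _ (fun i y => ENNReal.ofReal (Real.exp (v i * (s i - 1) * y)))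
      (fun i => by fun_prop)]
    simp_rw [lintegral_exp_mul_signLaw_half]
  simp_rw [e1]
  rw [lintegral_pi_prod _ (fun i s => ENNReal.ofReal (Real.cosh (v i * (s - 1))))
    (fun i => by fun_prop), dotProduct, Finset.mul_sum, ofReal_exp_sum]
  exact Finset.prod_le_prod' fun i _ => lintegral_cosh_signLaw_le h0 h1 _

lemma ae_labelLaw_fst_sq (n : ℕ) {η : ℝ} (h0 : 0 ≤ η) (h1 : η ≤ 1) :
    ∀ᵐ ω ∂(labelLaw n η), ∀ i, ω.1 i ^ 2 = 1 := by
  have := isProbabilityMeasure_signLaw h0 h1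
  have h : ∀ᵐ y ∂(Measure.pi fun _ : Fin n => signLaw (1 / 2)), ∀ i, y i ^ 2 = 1 := by
    rw [ae_all_iff]
    exact fun i => (Measure.quasiMeasurePreserving_eval _ i).ae (p := fun x => x ^ 2 = 1)
      (ae_signLaw _)
  exact Measure.quasiMeasurePreserving_fst.ae h

lemma ae_labelLaw_zero_snd (n : ℕ) : ∀ᵐ ω ∂(labelLaw n 0), ω.2 = 1 := by
  have := isProbabilityMeasure_signLaw le_rfl zero_le_one
  have h : ∀ᵐ s ∂(Measure.pi fun _ : Fin n => signLaw 0), s = 1 := by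
    simp_rw [funext_iff]
    rw [ae_all_iff]
    refine fun i => (Measure.quasiMeasurePreserving_eval _ i).ae (p := fun x => x = 1) ?_
    simp [signLaw]
  exact Measure.quasiMeasurePreserving_snd.ae h

/-! ### Elementary inequalities for dot products -/

lemma dotProduct_sq_le {ι : Type*} [Fintype ι] (u v : ι → ℝ) :
    (u ⬝ᵥ v) ^ 2 ≤ (u ⬝ᵥ u) * (v ⬝ᵥ v) := by
  have := Finset.sum_mul_sq_le_sq_mul_sq Finset.univ u v
  simpa [dotProduct, sq] using this

lemma dotProduct_self_nonneg' {ι : Type*} [Fintype ι] (u : ι → ℝ) : 0 ≤ u ⬝ᵥ u :=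
  Finset.sum_nonneg fun i _ => mul_self_nonneg (u i)

lemma dotProduct_add_self_le {ι : Type*} [Fintype ι] (u v : ι → ℝ) :
    (u + v) ⬝ᵥ (u + v) ≤ 2 * (u ⬝ᵥ u) + 2 * (v ⬝ᵥ v) := by
  have := dotProduct_self_nonneg' (u - v)
  simp only [sub_dotProduct, dotProduct_sub, add_dotProduct, dotProduct_add] at *
  linarith [dotProduct_comm u v]

/-- Weighted Young inequality. -/
lemma two_mul_dotProduct_le {ι : Type*} [Fintype ι] (u v : ι → ℝ) {s : ℝ} (hs : 0 < s) :
    2 * (u ⬝ᵥ v) ≤ s * (u ⬝ᵥ u) + s⁻¹ * (v ⬝ᵥ v) := by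
  have h := dotProduct_self_nonneg' (s • u - v)
  simp only [sub_dotProduct, dotProduct_sub, smul_dotProduct, dotProduct_smul, smul_eq_mul] at h
  have e : s⁻¹ * (s * (s * (u ⬝ᵥ u)) - s * (u ⬝ᵥ v) - (s * (v ⬝ᵥ u) - v ⬝ᵥ v))
      = s * (u ⬝ᵥ u) + s⁻¹ * (v ⬝ᵥ v) - 2 * (u ⬝ᵥ v) := by
    rw [dotProduct_comm v u]; field_simp; ring
  have := mul_nonneg (inv_pos.2 hs).le h
  linarith

/-- A bound on the operator norm passes to the transpose. -/
lemma transpose_mulVec_sq_le {ι κ : Type*} [Fintype ι] [Fintype κ] {M : Matrix ι κ ℝ} {θ : ℝ}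
    (h : ∀ x, (M *ᵥ x) ⬝ᵥ (M *ᵥ x) ≤ θ * (x ⬝ᵥ x)) (y : ι → ℝ) (hθ : 0 ≤ θ) :
    (Mᵀ *ᵥ y) ⬝ᵥ (Mᵀ *ᵥ y) ≤ θ * (y ⬝ᵥ y) := by
  set w := Mᵀ *ᵥ y
  have e : w ⬝ᵥ w = y ⬝ᵥ (M *ᵥ w) := (dotProduct_mulVec_transpose M y w).symm
  have h1 := dotProduct_sq_le y (M *ᵥ w)
  rw [← e] at h1
  have h2 := h w
  have h3 := dotProduct_self_nonneg' w
  have h4 := dotProduct_self_nonneg' y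
  rcases h3.eq_or_lt with h5 | h5
  · rw [← h5]; positivity
  · have : (w ⬝ᵥ w) * (w ⬝ᵥ w) ≤ (θ * (y ⬝ᵥ y)) * (w ⬝ᵥ w) := by nlinarith
    exact le_of_mul_le_mul_right this h5

lemma isUnit_det_of_coercive {ι : Type*} [Fintype ι] [DecidableEq ι] {A : Matrix ι ι ℝ} {δ : ℝ}
    (hδ : 0 < δ) (h : ∀ v, δ * (v ⬝ᵥ v) ≤ v ⬝ᵥ (A *ᵥ v)) : IsUnit A.det := by
  rw [isUnit_iff_ne_zero]
  intro h0
  obtain ⟨v, hv, hv0⟩ := Matrix.exists_mulVec_eq_zero_iff.2 h0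
  have := h v
  rw [hv0, dotProduct_zero] at this
  have h1 := dotProduct_self_nonneg' v
  exact hv (dotProduct_self_eq_zero.1 (by nlinarith))

lemma mulVec_inv_mulVec {ι : Type*} [Fintype ι] [DecidableEq ι] {A : Matrix ι ι ℝ}
    (h : IsUnit A.det) (v : ι → ℝ) : A *ᵥ (A⁻¹ *ᵥ v) = v := by
  rw [Matrix.mulVec_mulVec, Matrix.mul_nonsing_inv _ h, Matrix.one_mulVec]

lemma dotProduct_self_le_of_coercive {ι : Type*} [Fintype ι] {A : Matrix ι ι ℝ} {δ : ℝ}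
    (hδ : 0 < δ) (h : ∀ v, δ * (v ⬝ᵥ v) ≤ v ⬝ᵥ (A *ᵥ v)) (u : ι → ℝ) :
    u ⬝ᵥ u ≤ (δ⁻¹) ^ 2 * ((A *ᵥ u) ⬝ᵥ (A *ᵥ u)) := by
  have h1 := h u
  have h2 := dotProduct_sq_le u (A *ᵥ u)
  have h3 := dotProduct_self_nonneg' u
  have h4 := dotProduct_self_nonneg' (A *ᵥ u)
  set X := u ⬝ᵥ u
  rcases h3.eq_or_lt with h5 | h5
  · rw [← h5]; positivity
  · have h6 : (δ * X) ^ 2 ≤ X * ((A *ᵥ u) ⬝ᵥ (A *ᵥ u)) :=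
      (pow_le_pow_left₀ (by positivity) h1 2).trans h2
    have h7 : δ ^ 2 * X ≤ (A *ᵥ u) ⬝ᵥ (A *ᵥ u) := by
      refine le_of_mul_le_mul_right ?_ h5
      linarith
    rw [inv_pow, ← div_eq_inv_mul, le_div_iff₀ (by positivity)]
    linarith

lemma mulVec_sq_le_of_le {ι : Type*} [Fintype ι] {A : Matrix ι ι ℝ} {θ : ℝ} (hθ : 0 < θ)
    (hA : Aᵀ = A) (h0 : ∀ v, 0 ≤ v ⬝ᵥ (A *ᵥ v)) (h : ∀ v, v ⬝ᵥ (A *ᵥ v) ≤ θ * (v ⬝ᵥ v))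
    (u : ι → ℝ) : (A *ᵥ u) ⬝ᵥ (A *ᵥ u) ≤ θ * (u ⬝ᵥ (A *ᵥ u)) := by
  have h1 := h0 (u - θ⁻¹ • (A *ᵥ u))
  have h2 := h (A *ᵥ u)
  have h3 : u ⬝ᵥ (A *ᵥ (A *ᵥ u)) = (A *ᵥ u) ⬝ᵥ (A *ᵥ u) := by
    rw [dotProduct_mulVec_transpose, hA]
  simp only [Matrix.mulVec_sub, Matrix.mulVec_smul, sub_dotProduct, dotProduct_sub,
    smul_dotProduct, dotProduct_smul, smul_eq_mul, h3] at h1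
  have h4 : θ⁻¹ * (θ⁻¹ * ((A *ᵥ u) ⬝ᵥ (A *ᵥ (A *ᵥ u)))) ≤ θ⁻¹ * ((A *ᵥ u) ⬝ᵥ (A *ᵥ u)) := by
    refine mul_le_mul_of_nonneg_left ?_ (inv_pos.2 hθ).le
    rw [← div_eq_inv_mul, div_le_iff₀ hθ]; linarith
  have h5 : θ⁻¹ * ((A *ᵥ u) ⬝ᵥ (A *ᵥ u)) ≤ u ⬝ᵥ (A *ᵥ u) := by linarith
  rwa [← div_eq_inv_mul, div_le_iff₀ hθ, mul_comm] at h5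

/-! ### Splitting the Gram matrix into a well-conditioned part and spikes -/

/-- The tail Gram matrix `A` has all eigenvalues of order `Λ`, and the columns of the head design
`Z` are nearly orthogonal with squared norms of order `N`, both up to the factor `K`. -/
structure WellConditioned {m ι : Type*} [Fintype m] [Fintype ι] (N Λ K : ℝ) (A : Matrix m m ℝ)
    (Z : Matrix m ι ℝ) : Prop where
  one_le : 1 ≤ K
  N_pos : 0 < N
  Λ_pos : 0 < Λ
  symm : Aᵀ = A
  lower : ∀ v, Λ / K * (v ⬝ᵥ v) ≤ v ⬝ᵥ (A *ᵥ v)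
  upper : ∀ v, v ⬝ᵥ (A *ᵥ v) ≤ K * Λ * (v ⬝ᵥ v)
  head_lower : ∀ x, N / K * (x ⬝ᵥ x) ≤ (Z *ᵥ x) ⬝ᵥ (Z *ᵥ x)
  head_upper : ∀ x, (Z *ᵥ x) ⬝ᵥ (Z *ᵥ x) ≤ K * N * (x ⬝ᵥ x)

namespace WellConditioned

variable {m ι : Type*} [Fintype m] [Fintype ι] {N Λ K : ℝ}
  {A : Matrix m m ℝ} {Z : Matrix m ι ℝ}

lemma K_pos (h : WellConditioned N Λ K A Z) : 0 < K := lt_of_lt_of_le one_pos h.one_le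

lemma nonneg (h : WellConditioned N Λ K A Z) (v : m → ℝ) : 0 ≤ v ⬝ᵥ (A *ᵥ v) := by
  have := h.K_pos; have := h.Λ_pos
  exact le_trans (mul_nonneg (by positivity) (dotProduct_self_nonneg' v)) (h.lower v)

lemma transpose_head_upper (h : WellConditioned N Λ K A Z) (u : m → ℝ) :
    (Zᵀ *ᵥ u) ⬝ᵥ (Zᵀ *ᵥ u) ≤ K * N * (u ⬝ᵥ u) :=
  transpose_mulVec_sq_le h.head_upper u (mul_nonneg h.K_pos.le h.N_pos.le)

/-- The key perturbation estimate. If `A u = Z z + τ` with `z = Σ^{1/2} (ξ - Σ^{1/2} Zᵀ u)`, then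
`(Σ⁻¹ + Zᵀ A⁻¹ Z) z = Σ^{-1/2} ξ - Zᵀ A⁻¹ τ`, and replacing `Zᵀ A⁻¹ Z` by the multiple `(N / Λ) I`
of the identity turns `z` into the explicit vector `g`. The two matrices do not commute, but the
difference `ρ = z - g` satisfies `ρᵀ Zᵀ A⁻¹ Z ρ ≤ ρᵀ (Σ⁻¹ + Zᵀ A⁻¹ Z) ρ`, which gives a bound on `ρ`
that does not involve `Σ`. -/
lemma residual_bounds [DecidableEq m] (h : WellConditioned N Λ K A Z) {l ξ z g : ι → ℝ} (hl : ∀ i, 0 < l i)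
    {u τ : m → ℝ} {β : ℝ} (hτ : τ ⬝ᵥ τ ≤ K * N * β)
    (hz : ∀ i, z i = √(l i) * ξ i - l i * (Zᵀ *ᵥ u) i)
    (hg : ∀ i, g i = Λ / N * (√(l i) * ξ i) / (Λ / N + l i))
    (hu : A *ᵥ u = Z *ᵥ z + τ) :
    z ⬝ᵥ z ≤ 14 * K ^ 8 * (g ⬝ᵥ g + β) ∧
      u ⬝ᵥ u ≤ 30 * K ^ 11 * (N / Λ ^ 2) * (g ⬝ᵥ g + β) := by
  have hK := h.K_pos
  have hK1 := h.one_le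
  have hN := h.N_pos
  have hΛ := h.Λ_pos
  have hδ : 0 < Λ / K := by positivity
  have hdet := isUnit_det_of_coercive hδ h.lower
  set ρ := z - g with hρ
  have hzρ : z = ρ + g := by simp [hρ]
  have hρi : ∀ i, (l i)⁻¹ * ρ i = N / Λ * g i - (Zᵀ *ᵥ u) i := by
    intro i
    have hli := hl i
    have : Λ / N + l i ≠ 0 := by positivity
    have e : (l i)⁻¹ * (√(l i) * ξ i) = ((l i)⁻¹ + N / Λ) * g i := by
      rw [hg]
      have : Λ + l i * N ≠ 0 := by positivity
      field_simp
    simp only [hρ, Pi.sub_apply]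
    rw [mul_sub, hz, mul_sub, e]
    field_simp
    ring
  have hZu : u ⬝ᵥ (Z *ᵥ ρ) ≤ N / Λ * (g ⬝ᵥ ρ) := by
    rw [dotProduct_mulVec_transpose]
    simp only [dotProduct, Finset.mul_sum]
    refine Finset.sum_le_sum fun i _ => ?_
    have h1 := hρi i
    have h2 : 0 ≤ (l i)⁻¹ * ρ i * ρ i := by
      rw [mul_assoc]; exact mul_nonneg (inv_pos.2 (hl i)).le (mul_self_nonneg _)
    rw [h1] at h2
    linarith
  set f := Z *ᵥ ρ with hf
  set q := A⁻¹ *ᵥ f with hq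
  have hAq : A *ᵥ q = f := mulVec_inv_mulVec hdet _
  set q' := u - q with hq'
  have hAq' : A *ᵥ q' = Z *ᵥ g + τ := by
    rw [hq', Matrix.mulVec_sub, hu, hAq, hf, hzρ, Matrix.mulVec_add]; abel
  set X := ρ ⬝ᵥ ρ with hX
  set G := g ⬝ᵥ g with hG
  have hX0 : 0 ≤ X := dotProduct_self_nonneg' _
  have hG0 : 0 ≤ G := dotProduct_self_nonneg' _
  have hβ0 : 0 ≤ β := by
    have := (dotProduct_self_nonneg' τ).trans hτ
    exact nonneg_of_mul_nonneg_right this (by positivity)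
  have hGf : (Z *ᵥ g + τ) ⬝ᵥ (Z *ᵥ g + τ) ≤ 2 * (K * N) * (G + β) := by
    have := dotProduct_add_self_le (Z *ᵥ g) τ
    have := h.head_upper g
    linarith
  have hq'q' : q' ⬝ᵥ q' ≤ (K / Λ) ^ 2 * (2 * (K * N) * (G + β)) := by
    have := dotProduct_self_le_of_coercive hδ h.lower q'
    rw [hAq', inv_div] at this
    exact this.trans (by gcongr)
  have hff : f ⬝ᵥ f ≤ K * Λ * (q ⬝ᵥ f) := by
    have := mulVec_sq_le_of_le (by positivity) h.symm h.nonneg h.upper q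
    rwa [hAq] at this
  have hfl : N / K * X ≤ f ⬝ᵥ f := h.head_lower ρ
  have hfu : f ⬝ᵥ f ≤ K * N * X := h.head_upper ρ
  -- the Young weights leave half of the coercive term `N / Λ * (X / K ^ 2)`
  have hY := two_mul_dotProduct_le (-f) q' (s := 1 / (2 * K ^ 3 * Λ)) (by positivity)
  have hYg := two_mul_dotProduct_le ρ g (s := 1 / (2 * K ^ 2)) (by positivity)
  rw [neg_dotProduct, neg_dotProduct_neg, one_div, inv_inv, dotProduct_comm f q'] at hY
  rw [one_div, inv_inv, dotProduct_comm ρ g] at hYg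
  have hsum : q ⬝ᵥ f = u ⬝ᵥ f - q' ⬝ᵥ f := by rw [hq', sub_dotProduct]; ring
  -- every term is measured in units of `N / Λ`
  have s1 : N / Λ * (X / K ^ 2) ≤ q ⬝ᵥ f := by
    have : N / K * X ≤ K * Λ * (q ⬝ᵥ f) := hfl.trans hff
    rw [← div_le_iff₀' (by positivity)] at this
    refine le_of_eq_of_le ?_ this
    field_simp
  have s2 : (2 * K ^ 3 * Λ)⁻¹ * (f ⬝ᵥ f) ≤ N / Λ * (X / (2 * K ^ 2)) := by
    calc _ ≤ (2 * K ^ 3 * Λ)⁻¹ * (K * N * X) := by gcongr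
      _ = _ := by field_simp
  have s3 : 2 * K ^ 3 * Λ * (q' ⬝ᵥ q') ≤ N / Λ * (4 * K ^ 6 * (G + β)) := by
    calc _ ≤ 2 * K ^ 3 * Λ * ((K / Λ) ^ 2 * (2 * (K * N) * (G + β))) := by gcongr
      _ = _ := by field_simp; ring
  have s4 : N / Λ * (g ⬝ᵥ ρ) ≤ N / Λ * ((2 * K ^ 2)⁻¹ * X / 2 + K ^ 2 * G) := by
    gcongr; linarith
  have s5 : X / K ^ 2 ≤ (2 * K ^ 2)⁻¹ * X / 2 + K ^ 2 * G + X / (4 * K ^ 2)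
      + 2 * K ^ 6 * (G + β) := by
    refine le_of_mul_le_mul_left ?_ (show 0 < N / Λ by positivity)
    have : N / Λ * (X / (4 * K ^ 2)) = N / Λ * (X / (2 * K ^ 2)) / 2 := by ring
    linarith
  have hKK : K ^ 2 ≤ K ^ 6 := pow_le_pow_right₀ hK1 (by norm_num)
  have s6 : X ≤ 6 * K ^ 8 * (G + β) := by
    have e : X / K ^ 2 - ((2 * K ^ 2)⁻¹ * X / 2 + X / (4 * K ^ 2)) = X / (2 * K ^ 2) := by
      field_simp; ring
    have : X / (2 * K ^ 2) ≤ 3 * K ^ 6 * (G + β) := by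
      have : K ^ 2 * G ≤ K ^ 6 * (G + β) := by gcongr; linarith
      linarith
    rw [div_le_iff₀ (by positivity)] at this
    linarith [show 3 * K ^ 6 * (G + β) * (2 * K ^ 2) = 6 * K ^ 8 * (G + β) by ring]
  have hzz : z ⬝ᵥ z ≤ 14 * K ^ 8 * (G + β) := by
    have h1 := dotProduct_add_self_le ρ g
    rw [← hzρ] at h1
    have : G ≤ K ^ 8 * (G + β) := by
      have : 1 ≤ K ^ 8 := one_le_pow₀ hK1
      nlinarith
    linarith
  refine ⟨hzz, ?_⟩
  have h1 := dotProduct_self_le_of_coercive hδ h.lower u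
  rw [hu, inv_div] at h1
  have h2 := dotProduct_add_self_le (Z *ᵥ z) τ
  have h3 := h.head_upper z
  have h4 : (Z *ᵥ z + τ) ⬝ᵥ (Z *ᵥ z + τ) ≤ 30 * K ^ 9 * N * (G + β) := by
    have e1 : K * N * (z ⬝ᵥ z) ≤ K * N * (14 * K ^ 8 * (G + β)) := by gcongr
    have e2 : K * N * β ≤ K ^ 9 * N * (G + β) := by
      have : K ≤ K ^ 9 := le_self_pow₀ hK1 (by norm_num)
      gcongr; linarith
    linarith [show K * N * (14 * K ^ 8 * (G + β)) = 14 * K ^ 9 * N * (G + β) by ring]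
  refine h1.trans ((mul_le_mul_of_nonneg_left h4 (by positivity)).trans_eq ?_)
  field_simp

/-! ### The full Gram matrix -/

lemma full_mulVec [DecidableEq ι] (l : ι → ℝ) (v : m → ℝ) :
    (Z * Matrix.diagonal l * Zᵀ + A) *ᵥ v = Z *ᵥ (fun i => l i * (Zᵀ *ᵥ v) i) + A *ᵥ v := by
  rw [Matrix.add_mulVec, ← Matrix.mulVec_mulVec, ← Matrix.mulVec_mulVec]
  congr 2
  ext i
  rw [Matrix.mulVec_diagonal]

lemma dotProduct_full_mulVec [DecidableEq ι] (l : ι → ℝ) (u v : m → ℝ) :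
    u ⬝ᵥ ((Z * Matrix.diagonal l * Zᵀ + A) *ᵥ v)
      = ∑ i, l i * (Zᵀ *ᵥ u) i * (Zᵀ *ᵥ v) i + u ⬝ᵥ (A *ᵥ v) := by
  rw [full_mulVec, dotProduct_add, dotProduct_mulVec_transpose]
  congr 1
  exact Finset.sum_congr rfl fun i _ => by ring

lemma full_lower [DecidableEq ι] (h : WellConditioned N Λ K A Z) {l : ι → ℝ} (hl : ∀ i, 0 < l i) (v : m → ℝ) :
    Λ / K * (v ⬝ᵥ v) ≤ v ⬝ᵥ ((Z * Matrix.diagonal l * Zᵀ + A) *ᵥ v) := by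
  rw [dotProduct_full_mulVec]
  have : 0 ≤ ∑ i, l i * (Zᵀ *ᵥ v) i * (Zᵀ *ᵥ v) i := Finset.sum_nonneg fun i _ => by
    rw [mul_assoc]; exact mul_nonneg (hl i).le (mul_self_nonneg _)
  linarith [h.lower v]

lemma full_isUnit_det [DecidableEq m] [DecidableEq ι]
    (h : WellConditioned N Λ K A Z) {l : ι → ℝ} (hl : ∀ i, 0 < l i) :
    IsUnit (Z * Matrix.diagonal l * Zᵀ + A).det :=
  isUnit_det_of_coercive (div_pos h.Λ_pos h.K_pos) (h.full_lower hl)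

lemma full_transpose [DecidableEq ι] (h : WellConditioned N Λ K A Z) (l : ι → ℝ) :
    (Z * Matrix.diagonal l * Zᵀ + A)ᵀ = Z * Matrix.diagonal l * Zᵀ + A := by
  simp [Matrix.transpose_mul, h.symm, Matrix.mul_assoc]

lemma full_inv_transpose [DecidableEq m] [DecidableEq ι]
    (h : WellConditioned N Λ K A Z) (l : ι → ℝ) :
    ((Z * Matrix.diagonal l * Zᵀ + A)⁻¹)ᵀ = (Z * Matrix.diagonal l * Zᵀ + A)⁻¹ := by
  rw [Matrix.transpose_nonsing_inv, h.full_transpose]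

lemma full_inv_mulVec_sq_le [DecidableEq m] [DecidableEq ι]
    (h : WellConditioned N Λ K A Z) {l : ι → ℝ} (hl : ∀ i, 0 < l i)
    (y : m → ℝ) :
    ((Z * Matrix.diagonal l * Zᵀ + A)⁻¹ *ᵥ y) ⬝ᵥ ((Z * Matrix.diagonal l * Zᵀ + A)⁻¹ *ᵥ y)
      ≤ (K / Λ) ^ 2 * (y ⬝ᵥ y) := by
  have h1 := dotProduct_self_le_of_coercive (div_pos h.Λ_pos h.K_pos) (h.full_lower hl)
    ((Z * Matrix.diagonal l * Zᵀ + A)⁻¹ *ᵥ y)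
  rwa [mulVec_inv_mulVec (h.full_isUnit_det hl), inv_div] at h1

lemma dotProduct_full_inv_le [DecidableEq m] [DecidableEq ι]
    (h : WellConditioned N Λ K A Z) {l : ι → ℝ} (hl : ∀ i, 0 < l i)
    (y : m → ℝ) :
    y ⬝ᵥ ((Z * Matrix.diagonal l * Zᵀ + A)⁻¹ *ᵥ y) ≤ K / Λ * (y ⬝ᵥ y) := by
  have h1 := h.full_inv_mulVec_sq_le hl y
  have h2 := two_mul_dotProduct_le y ((Z * Matrix.diagonal l * Zᵀ + A)⁻¹ *ᵥ y)
    (div_pos h.K_pos h.Λ_pos)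
  have h3 : (K / Λ)⁻¹ * (((Z * Matrix.diagonal l * Zᵀ + A)⁻¹ *ᵥ y) ⬝ᵥ
      ((Z * Matrix.diagonal l * Zᵀ + A)⁻¹ *ᵥ y)) ≤ K / Λ * (y ⬝ᵥ y) := by
    have := h.K_pos
    have := h.Λ_pos
    refine (mul_le_mul_of_nonneg_left h1 (by positivity)).trans_eq ?_
    field_simp
  linarith

/-! ### The head projection -/

lemma head_dotProduct (x : ι → ℝ) : x ⬝ᵥ ((Zᵀ * Z) *ᵥ x) = (Z *ᵥ x) ⬝ᵥ (Z *ᵥ x) := by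
  rw [← Matrix.mulVec_mulVec, dotProduct_mulVec_transpose, Matrix.transpose_transpose]

lemma head_isUnit_det [DecidableEq ι] (h : WellConditioned N Λ K A Z) : IsUnit (Zᵀ * Z).det :=
  isUnit_det_of_coercive (div_pos h.N_pos h.K_pos) fun x => by
    rw [head_dotProduct]; exact h.head_lower x

/-- The orthogonal projection onto the column space of `Z`, for `Z` of full column rank. -/
noncomputable def colProj [DecidableEq ι] (Z : Matrix m ι ℝ) : Matrix m m ℝ := Z * (Zᵀ * Z)⁻¹ * Zᵀ

lemma colProj_transpose [DecidableEq ι] (Z : Matrix m ι ℝ) : (colProj Z)ᵀ = colProj Z := by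
  rw [colProj, Matrix.transpose_mul, Matrix.transpose_mul, Matrix.transpose_nonsing_inv,
    Matrix.transpose_mul, Matrix.transpose_transpose, Matrix.mul_assoc]

lemma transpose_mul_colProj [DecidableEq ι] (h : WellConditioned N Λ K A Z) : Zᵀ * colProj Z = Zᵀ := by
  rw [colProj, ← Matrix.mul_assoc, ← Matrix.mul_assoc, Matrix.mul_nonsing_inv _ h.head_isUnit_det,
    Matrix.one_mul]

lemma colProj_mul_self [DecidableEq ι] (h : WellConditioned N Λ K A Z) : colProj Z * colProj Z = colProj Z := by
  conv_lhs => enter [1]; rw [colProj]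
  rw [Matrix.mul_assoc, h.transpose_mul_colProj, colProj]

lemma dotProduct_colProj [DecidableEq ι] (h : WellConditioned N Λ K A Z) (y : m → ℝ) :
    y ⬝ᵥ (colProj Z *ᵥ y) = (colProj Z *ᵥ y) ⬝ᵥ (colProj Z *ᵥ y) := by
  conv_lhs => rw [← h.colProj_mul_self, ← Matrix.mulVec_mulVec, dotProduct_mulVec_transpose,
    colProj_transpose]

lemma dotProduct_colProj_nonneg [DecidableEq ι] (h : WellConditioned N Λ K A Z) (y : m → ℝ) :
    0 ≤ y ⬝ᵥ (colProj Z *ᵥ y) := by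
  rw [h.dotProduct_colProj]; exact dotProduct_self_nonneg' _

lemma dotProduct_colProj_le [DecidableEq ι] (h : WellConditioned N Λ K A Z) (y : m → ℝ) :
    y ⬝ᵥ (colProj Z *ᵥ y) ≤ 1 * (y ⬝ᵥ y) := by
  have h1 := h.dotProduct_colProj y
  have h2 := two_mul_dotProduct_le y (colProj Z *ᵥ y) one_pos
  simp only [inv_one, one_mul] at *
  linarith

lemma trace_colProj [DecidableEq ι] (h : WellConditioned N Λ K A Z) : (colProj Z).trace = Fintype.card ι := by
  rw [colProj, Matrix.mul_assoc, Matrix.trace_mul_comm, Matrix.mul_assoc,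
    Matrix.nonsing_inv_mul _ h.head_isUnit_det, Matrix.trace_one]

/-- On the orthogonal complement of the columns of `Z` the full Gram matrix agrees with its tail
part, so the spikes can only affect the form `yᵀ F⁻¹ y` through the projection of `y` onto these
columns. -/
lemma le_dotProduct_full_inv [DecidableEq m] [DecidableEq ι]
    (h : WellConditioned N Λ K A Z) {l : ι → ℝ} (hl : ∀ i, 0 < l i)
    (y : m → ℝ) :
    (y ⬝ᵥ y - y ⬝ᵥ (colProj Z *ᵥ y)) / (K * Λ)
      ≤ y ⬝ᵥ ((Z * Matrix.diagonal l * Zᵀ + A)⁻¹ *ᵥ y) := by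
  have hK := h.K_pos
  have hΛ := h.Λ_pos
  set F := Z * Matrix.diagonal l * Zᵀ + A with hF
  set p := F⁻¹ *ᵥ y
  have hp : F *ᵥ p = y := mulVec_inv_mulVec (h.full_isUnit_det hl) y
  set q := y - colProj Z *ᵥ y with hq
  have hZq : Zᵀ *ᵥ q = 0 := by
    rw [hq, Matrix.mulVec_sub, Matrix.mulVec_mulVec, h.transpose_mul_colProj, sub_self]
  have hqq : q ⬝ᵥ q = y ⬝ᵥ y - y ⬝ᵥ (colProj Z *ᵥ y) := by
    have := h.dotProduct_colProj y
    rw [hq, sub_dotProduct, dotProduct_sub, dotProduct_sub, ← this,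
      dotProduct_comm (colProj Z *ᵥ y) y]
    ring
  have hqy : q ⬝ᵥ y = y ⬝ᵥ y - y ⬝ᵥ (colProj Z *ᵥ y) := by
    rw [hq, sub_dotProduct, dotProduct_comm (colProj Z *ᵥ y) y]
  set s := (K * Λ)⁻¹ with hs
  have hs0 : 0 < s := by positivity
  -- expand the positive form of `F` at `p - s q`
  have h1 : 0 ≤ (p - s • q) ⬝ᵥ (F *ᵥ (p - s • q)) :=
    le_trans (mul_nonneg (by positivity) (dotProduct_self_nonneg' _)) (h.full_lower hl _)
  have h2 : q ⬝ᵥ (F *ᵥ q) ≤ K * Λ * (q ⬝ᵥ q) := by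
    rw [hF, dotProduct_full_mulVec, hZq]
    simpa using h.upper q
  have h3 : p ⬝ᵥ (F *ᵥ q) = q ⬝ᵥ y := by
    rw [dotProduct_mulVec_transpose, hF, h.full_transpose, ← hF, hp, dotProduct_comm]
  simp only [Matrix.mulVec_sub, Matrix.mulVec_smul, sub_dotProduct, dotProduct_sub,
    smul_dotProduct, dotProduct_smul, smul_eq_mul, hp, h3] at h1
  have h4 : s * (s * (q ⬝ᵥ (F *ᵥ q))) ≤ s * (q ⬝ᵥ q) := by
    refine mul_le_mul_of_nonneg_left ?_ hs0.le
    rw [hs, ← div_eq_inv_mul, div_le_iff₀ (by positivity)]; linarith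
  rw [hqy] at h1
  rw [hqq] at h4
  rw [div_eq_mul_inv, ← hs, dotProduct_comm y p]
  linarith

/-! ### The signal -/

/-- The quantity `‖μ‖² - νᵀ F⁻¹ ν` is the minimum over `v` of
`‖μ_head - Σ^{1/2} Zᵀ v‖² + ‖μ_tail‖² - 2 vᵀ τ + vᵀ A v`. Its size is found by bounding this
functional from below, coordinate by coordinate in the head, and by evaluating it at the `v` in the
column space of `Z` with `(Zᵀ v)_i = √l_i μ_i / (Λ / N + l_i)`. -/
lemma signal_bounds [DecidableEq ι] (h : WellConditioned N Λ K A Z) {l ξ : ι → ℝ} (hl : ∀ i, 0 < l i)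
    {τ u : m → ℝ} {s : ℝ} (hτ : K / Λ * (τ ⬝ᵥ τ) ≤ s / 4)
    (hu : (Z * Matrix.diagonal l * Zᵀ + A) *ᵥ u = Z *ᵥ (fun i => √(l i) * ξ i) + τ) :
    (∑ i, Λ / N * ξ i ^ 2 / (Λ / N + l i) + s) / (2 * K ^ 2)
        ≤ ξ ⬝ᵥ ξ + s - (Z *ᵥ (fun i => √(l i) * ξ i) + τ) ⬝ᵥ u ∧
      ξ ⬝ᵥ ξ + s - (Z *ᵥ (fun i => √(l i) * ξ i) + τ) ⬝ᵥ u
        ≤ 2 * K ^ 2 * (∑ i, Λ / N * ξ i ^ 2 / (Λ / N + l i) + s) := by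
  have hK := h.K_pos
  have hK1 := h.one_le
  have hN := h.N_pos
  have hΛ := h.Λ_pos
  have hKK : 1 ≤ K ^ 2 := one_le_pow₀ hK1
  set κ := Λ / N with hκ
  have hκ0 : 0 < κ := by positivity
  set F := Z * Matrix.diagonal l * Zᵀ + A with hF
  set ν := Z *ᵥ (fun i => √(l i) * ξ i) + τ with hν
  have hττ : τ ⬝ᵥ τ * Λ⁻¹ ≤ s / 4 := by
    refine le_trans ?_ hτ
    rw [div_mul_eq_mul_div, ← div_eq_mul_inv]
    gcongr
    nlinarith [dotProduct_self_nonneg' τ]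
  have hs : 0 ≤ s := by
    have := dotProduct_self_nonneg' τ
    have : 0 ≤ K / Λ * (τ ⬝ᵥ τ) := by positivity
    linarith
  -- the functional
  have hJ : ∀ v : m → ℝ, ξ ⬝ᵥ ξ + s - 2 * (v ⬝ᵥ ν) + v ⬝ᵥ (F *ᵥ v)
      = ∑ i, (ξ i - √(l i) * (Zᵀ *ᵥ v) i) ^ 2 + s - 2 * (v ⬝ᵥ τ) + v ⬝ᵥ (A *ᵥ v) := by
    intro v
    rw [hF, dotProduct_full_mulVec, hν, dotProduct_add, dotProduct_mulVec_transpose]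
    have : ∑ i, (ξ i - √(l i) * (Zᵀ *ᵥ v) i) ^ 2
        = ξ ⬝ᵥ ξ - 2 * ((Zᵀ *ᵥ v) ⬝ᵥ fun i => √(l i) * ξ i)
          + ∑ i, l i * (Zᵀ *ᵥ v) i * (Zᵀ *ᵥ v) i := by
      simp only [dotProduct, Finset.mul_sum, ← Finset.sum_sub_distrib, ← Finset.sum_add_distrib]
      refine Finset.sum_congr rfl fun i _ => ?_
      have := Real.sq_sqrt (hl i).le
      linear_combination ((Zᵀ *ᵥ v) i) ^ 2 * this
    linarith
  constructor
  · have h1 := hJ u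
    rw [hu, dotProduct_comm u ν] at h1
    have h2 := two_mul_dotProduct_le u τ (s := Λ / (2 * K)) (by positivity)
    have h3 : (Λ / (2 * K))⁻¹ * (τ ⬝ᵥ τ) = 2 * (K / Λ * (τ ⬝ᵥ τ)) := by
      field_simp
    have h4 := h.lower u
    have h5 : Λ / (2 * K) * (u ⬝ᵥ u) = Λ / K * (u ⬝ᵥ u) / 2 := by field_simp
    have h6 := h.transpose_head_upper u
    have h7 : κ / K ^ 2 * ((Zᵀ *ᵥ u) ⬝ᵥ (Zᵀ *ᵥ u)) ≤ Λ / K * (u ⬝ᵥ u) := by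
      calc _ ≤ κ / K ^ 2 * (K * N * (u ⬝ᵥ u)) := by gcongr
        _ = _ := by rw [hκ]; field_simp
    have h8 : ξ ⬝ᵥ ξ + s - ν ⬝ᵥ u ≥ ∑ i, (ξ i - √(l i) * (Zᵀ *ᵥ u) i) ^ 2
        + κ / K ^ 2 * ((Zᵀ *ᵥ u) ⬝ᵥ (Zᵀ *ᵥ u)) / 2 + s / 2 := by linarith
    refine le_trans ?_ h8
    rw [div_le_iff₀ (by positivity)]
    have h9 : ∑ i, κ * ξ i ^ 2 / (κ + l i)
        ≤ ∑ i, (ξ i - √(l i) * (Zᵀ *ᵥ u) i) ^ 2 + κ * ((Zᵀ *ᵥ u) ⬝ᵥ (Zᵀ *ᵥ u)) := by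
      rw [dotProduct, Finset.mul_sum, ← Finset.sum_add_distrib]
      refine Finset.sum_le_sum fun i _ => ?_
      have hli := hl i
      rw [div_le_iff₀ (by positivity)]
      have e := Real.sq_sqrt hli.le
      set w := (Zᵀ *ᵥ u) i
      set r := √(l i)
      rw [← e]
      nlinarith [sq_nonneg (r * ξ i - (κ + r ^ 2) * w)]
    have h10 : 0 ≤ ∑ i, (ξ i - √(l i) * (Zᵀ *ᵥ u) i) ^ 2 :=
      Finset.sum_nonneg fun i _ => sq_nonneg _
    have h11 : κ / K ^ 2 * ((Zᵀ *ᵥ u) ⬝ᵥ (Zᵀ *ᵥ u)) / 2 * (2 * K ^ 2)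
        = κ * ((Zᵀ *ᵥ u) ⬝ᵥ (Zᵀ *ᵥ u)) := by field_simp
    nlinarith
  · set v0 : ι → ℝ := fun i => √(l i) * ξ i / (κ + l i) with hv0
    set x := (Zᵀ * Z)⁻¹ *ᵥ v0 with hx
    have hGx : (Zᵀ * Z) *ᵥ x = v0 := mulVec_inv_mulVec h.head_isUnit_det v0
    set v := Z *ᵥ x with hv
    have hZv : Zᵀ *ᵥ v = v0 := by rw [hv, Matrix.mulVec_mulVec, hGx]
    have hvv : v ⬝ᵥ v = x ⬝ᵥ v0 := by
      rw [← hGx, head_dotProduct]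
    have hvv' : v ⬝ᵥ v ≤ K / N * (v0 ⬝ᵥ v0) := by
      have h1 := h.head_lower x
      have h2 := two_mul_dotProduct_le x v0 (s := N / K) (by positivity)
      rw [inv_div] at h2
      linarith
    have h1 : 0 ≤ (v - u) ⬝ᵥ (F *ᵥ (v - u)) :=
      le_trans (mul_nonneg (by positivity) (dotProduct_self_nonneg' _)) (h.full_lower hl _)
    have h3 : u ⬝ᵥ (F *ᵥ v) = v ⬝ᵥ ν := by
      rw [dotProduct_mulVec_transpose, hF, h.full_transpose, ← hF, hu, dotProduct_comm]
    simp only [Matrix.mulVec_sub, sub_dotProduct, dotProduct_sub, hu, h3] at h1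
    have h2 := hJ v
    rw [hZv] at h2
    have h4 := two_mul_dotProduct_le (-v) τ hΛ
    rw [neg_dotProduct, neg_dotProduct_neg] at h4
    have h5 := h.upper v
    have h6 : (K * Λ + Λ) * (v ⬝ᵥ v) ≤ 2 * K ^ 2 * (κ * (v0 ⬝ᵥ v0)) := by
      calc _ ≤ (K * Λ + K * Λ) * (K / N * (v0 ⬝ᵥ v0)) := by
            gcongr
            · exact dotProduct_self_nonneg' _
            · nlinarith
        _ = _ := by rw [hκ]; field_simp; ring
    have h7 : ∑ i, (ξ i - √(l i) * v0 i) ^ 2 + κ * (v0 ⬝ᵥ v0) = ∑ i, κ * ξ i ^ 2 / (κ + l i) := by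
      rw [dotProduct, Finset.mul_sum, ← Finset.sum_add_distrib]
      refine Finset.sum_congr rfl fun i _ => ?_
      have hli := hl i
      have e := Real.sq_sqrt hli.le
      have : κ + l i ≠ 0 := by positivity
      simp only [hv0]
      set r := √(l i)
      rw [← e] at this ⊢
      field_simp
      ring
    have h8 : 0 ≤ ∑ i, (ξ i - √(l i) * v0 i) ^ 2 :=
      Finset.sum_nonneg fun i _ => sq_nonneg _
    rw [dotProduct_comm ν u, ← h7]
    nlinarith

variable {κ : Type*} [Fintype κ]

/-! ### The noise covariance of the ridge map -/

lemma trace_mul_transpose_eq_sum [DecidableEq κ] (M : Matrix m κ ℝ) :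
    (M * Mᵀ).trace = ∑ j, (M *ᵥ Pi.single j 1) ⬝ᵥ (M *ᵥ Pi.single j 1) := by
  rw [Matrix.trace_mul_comm]
  simp [Matrix.trace, Matrix.mul_apply, dotProduct]

/-- The matrix `H = F⁻¹ Q Σ Qᵀ F⁻¹` for which `yᵀ H y = ‖Qᵀ F⁻¹ y‖_Σ²`, written in terms of the
head design `Z`, the head eigenvalues `l` and a root `R` of the tail contribution. -/
noncomputable def noiseGram [DecidableEq m] [DecidableEq ι] (A : Matrix m m ℝ) (Z : Matrix m ι ℝ)
    (l : ι → ℝ) (R : Matrix m κ ℝ) : Matrix m m ℝ :=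
  let F := Z * Matrix.diagonal l * Zᵀ + A
  (F⁻¹ * (Z * Matrix.diagonal l)) * (F⁻¹ * (Z * Matrix.diagonal l))ᵀ + (F⁻¹ * R) * (F⁻¹ * R)ᵀ

lemma noiseGram_isHermitian [DecidableEq m] [DecidableEq ι] (l : ι → ℝ) (R : Matrix m κ ℝ) :
    (noiseGram A Z l R).IsHermitian := by
  simp_rw [noiseGram, ← Matrix.conjTranspose_eq_transpose_of_trivial]
  exact (Matrix.isHermitian_mul_conjTranspose_self _).add
    (Matrix.isHermitian_mul_conjTranspose_self _)

lemma dotProduct_mul_transpose_mulVec (M : Matrix m κ ℝ) (y : m → ℝ) :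
    y ⬝ᵥ ((M * Mᵀ) *ᵥ y) = (Mᵀ *ᵥ y) ⬝ᵥ (Mᵀ *ᵥ y) := by
  rw [← Matrix.mulVec_mulVec, dotProduct_mulVec_transpose]

lemma dotProduct_noiseGram_mulVec [DecidableEq m] [DecidableEq ι]
    (h : WellConditioned N Λ K A Z) (l : ι → ℝ) (R : Matrix m κ ℝ) (y : m → ℝ) :
    y ⬝ᵥ (noiseGram A Z l R *ᵥ y)
      = ∑ i, (l i * (Zᵀ *ᵥ ((Z * Matrix.diagonal l * Zᵀ + A)⁻¹ *ᵥ y)) i) ^ 2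
        + (Rᵀ *ᵥ ((Z * Matrix.diagonal l * Zᵀ + A)⁻¹ *ᵥ y)) ⬝ᵥ
          (Rᵀ *ᵥ ((Z * Matrix.diagonal l * Zᵀ + A)⁻¹ *ᵥ y)) := by
  rw [noiseGram, Matrix.add_mulVec, dotProduct_add, dotProduct_mul_transpose_mulVec,
    dotProduct_mul_transpose_mulVec, Matrix.transpose_mul, Matrix.transpose_mul,
    Matrix.transpose_mul, Matrix.diagonal_transpose, h.full_inv_transpose]
  simp only [← Matrix.mulVec_mulVec]
  congr 1
  refine Finset.sum_congr rfl fun i _ => ?_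
  rw [Matrix.mulVec_diagonal]; ring

lemma dotProduct_noiseGram_nonneg [DecidableEq m] [DecidableEq ι]
    (h : WellConditioned N Λ K A Z) (l : ι → ℝ) (R : Matrix m κ ℝ) (y : m → ℝ) :
    0 ≤ y ⬝ᵥ (noiseGram A Z l R *ᵥ y) := by
  rw [h.dotProduct_noiseGram_mulVec]
  exact add_nonneg (Finset.sum_nonneg fun i _ => sq_nonneg _) (dotProduct_self_nonneg' _)

lemma spike_sq_le [DecidableEq m] [DecidableEq ι] (h : WellConditioned N Λ K A Z)
    {l : ι → ℝ} (hl : ∀ i, 0 < l i) (x : ι → ℝ) :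
    (((Z * Matrix.diagonal l * Zᵀ + A)⁻¹ * (Z * Matrix.diagonal l)) *ᵥ x) ⬝ᵥ
        (((Z * Matrix.diagonal l * Zᵀ + A)⁻¹ * (Z * Matrix.diagonal l)) *ᵥ x)
      ≤ 30 * K ^ 11 * (1 / N * ∑ i, (l i / (Λ / N + l i)) ^ 2 * x i ^ 2) := by
  have hΛ := h.Λ_pos
  set F := Z * Matrix.diagonal l * Zᵀ + A with hF
  set u := (F⁻¹ * (Z * Matrix.diagonal l)) *ᵥ x with hu
  have hFu : F *ᵥ u = Z *ᵥ (fun i => l i * x i) := by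
    rw [hu, ← Matrix.mulVec_mulVec, mulVec_inv_mulVec (h.full_isUnit_det hl),
      ← Matrix.mulVec_mulVec]
    congr 1
    ext i; rw [Matrix.mulVec_diagonal]
  -- the residual estimate for the head vector `Σ^{1/2} x` and no tail part
  have key := (h.residual_bounds hl (ξ := fun i => √(l i) * x i)
    (z := fun i => √(l i) * (√(l i) * x i) - l i * (Zᵀ *ᵥ u) i)
    (g := fun i => Λ / N * (√(l i) * (√(l i) * x i)) / (Λ / N + l i)) (u := u) (τ := 0) (β := 0)
    (by simp) (fun i => rfl) (fun i => rfl) (by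
      rw [hF, full_mulVec] at hFu
      rw [add_zero, ← sub_eq_iff_eq_add'.2 hFu.symm, ← Matrix.mulVec_sub]
      congr 1
      ext i
      have := Real.mul_self_sqrt (hl i).le
      simp only [Pi.sub_apply, ← mul_assoc, this])).2
  refine key.trans_eq ?_
  rw [mul_assoc]
  congr 1
  rw [dotProduct, add_zero, Finset.mul_sum, Finset.mul_sum]
  refine Finset.sum_congr rfl fun i _ => ?_
  have := Real.mul_self_sqrt (hl i).le
  rw [← mul_assoc (√(l i)), this]
  field_simp

lemma trace_noiseGram_le [DecidableEq m] [DecidableEq ι] [DecidableEq κ]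
    (h : WellConditioned N Λ K A Z) {l : ι → ℝ} (hl : ∀ i, 0 < l i) (R : Matrix m κ ℝ) :
    (noiseGram A Z l R).trace
      ≤ 30 * K ^ 11 * (1 / N * ∑ i, (l i / (Λ / N + l i)) ^ 2)
        + (K / Λ) ^ 2 * (R * Rᵀ).trace := by
  rw [noiseGram, Matrix.trace_add, trace_mul_transpose_eq_sum, trace_mul_transpose_eq_sum,
    trace_mul_transpose_eq_sum]
  refine add_le_add ?_ ?_
  · rw [Finset.mul_sum, Finset.mul_sum]
    refine Finset.sum_le_sum fun j _ => (h.spike_sq_le hl _).trans_eq ?_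
    congr 2
    rw [Finset.sum_eq_single j] <;> simp +contextual
  · rw [Finset.mul_sum]
    refine Finset.sum_le_sum fun j _ => ?_
    rw [← Matrix.mulVec_mulVec]
    exact h.full_inv_mulVec_sq_le hl _

lemma dotProduct_noiseGram_le [DecidableEq m] [DecidableEq ι]
    (h : WellConditioned N Λ K A Z) {l : ι → ℝ} (hl : ∀ i, 0 < l i) {R : Matrix m κ ℝ}
    {a θ : ℝ} (ha : ∀ i, 1 / N * (l i / (Λ / N + l i)) ^ 2 ≤ a) (ha0 : 0 ≤ a) (hθ0 : 0 ≤ θ)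
    (hθ : ∀ v, v ⬝ᵥ ((R * Rᵀ) *ᵥ v) ≤ θ * (v ⬝ᵥ v)) (y : m → ℝ) :
    y ⬝ᵥ (noiseGram A Z l R *ᵥ y) ≤ (30 * K ^ 11 * a + (K / Λ) ^ 2 * θ) * (y ⬝ᵥ y) := by
  have hK := h.K_pos
  rw [noiseGram, Matrix.add_mulVec, dotProduct_add, add_mul]
  refine add_le_add ?_ ?_
  · rw [dotProduct_mul_transpose_mulVec]
    refine transpose_mulVec_sq_le (fun x => (h.spike_sq_le hl x).trans ?_) y (by positivity)
    rw [mul_assoc (30 * K ^ 11)]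
    refine mul_le_mul_of_nonneg_left ?_ (by positivity)
    rw [dotProduct, Finset.mul_sum, Finset.mul_sum]
    refine Finset.sum_le_sum fun i _ => ?_
    rw [← mul_assoc, ← sq]
    exact mul_le_mul_of_nonneg_right (ha i) (sq_nonneg _)
  · rw [dotProduct_mul_transpose_mulVec, Matrix.transpose_mul, h.full_inv_transpose,
      ← Matrix.mulVec_mulVec, ← dotProduct_mul_transpose_mulVec]
    refine (hθ _).trans ?_
    rw [mul_comm ((K / Λ) ^ 2), mul_assoc]
    exact mul_le_mul_of_nonneg_left (h.full_inv_mulVec_sq_le hl y) hθ0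

end WellConditioned
/-! ### The ridge solution as a rank-two perturbation -/

lemma transpose_data_mulVec {m κ : Type*} [Fintype m] [Fintype κ] (Q : Matrix m κ ℝ) (y x : m → ℝ)
    (mu : κ → ℝ) :
    (Matrix.vecMulVec y mu + Q)ᵀ *ᵥ x = (y ⬝ᵥ x) • mu + Qᵀ *ᵥ x := by
  rw [Matrix.transpose_add, Matrix.transpose_vecMulVec, Matrix.add_mulVec, Matrix.vecMulVec_mulVec]
  simp

lemma data_gram_mulVec {m κ : Type*} [Fintype m] [Fintype κ] [DecidableEq m] (Q : Matrix m κ ℝ)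
    (y x : m → ℝ) (mu : κ → ℝ) (reg : ℝ) :
    ((Matrix.vecMulVec y mu + Q) * (Matrix.vecMulVec y mu + Q)ᵀ + reg • (1 : Matrix m m ℝ)) *ᵥ x
      = (Q * Qᵀ + reg • (1 : Matrix m m ℝ)) *ᵥ x
        + ((mu ⬝ᵥ mu) * (y ⬝ᵥ x) + (Q *ᵥ mu) ⬝ᵥ x) • y + (y ⬝ᵥ x) • (Q *ᵥ mu) := by
  rw [Matrix.add_mulVec, ← Matrix.mulVec_mulVec, transpose_data_mulVec, Matrix.add_mulVec,
    Matrix.add_mulVec, ← Matrix.mulVec_mulVec, Matrix.vecMulVec_mulVec, Matrix.mulVec_add,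
    Matrix.mulVec_smul, dotProduct_add, dotProduct_smul, dotProduct_mulVec_transpose Qᵀ,
    Matrix.transpose_transpose]
  ext i
  simp
  ring

/-- The determinant of the full regularised Gram matrix relative to the one of the centred data:
`S = (1 + νᵀ p)² + (yᵀ p) (‖μ‖² - νᵀ u)`, where `p = F⁻¹ y`, `u = F⁻¹ ν` and `m = ‖μ‖²`. -/
def detFactor {m : Type*} [Fintype m] (y ν p u : m → ℝ) (M : ℝ) : ℝ :=
  (1 + ν ⬝ᵥ p) ^ 2 + (y ⬝ᵥ p) * (M - ν ⬝ᵥ u)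

/-- Solving `(F + ν yᵀ + y νᵀ + ‖μ‖² y yᵀ) x = f`: pairing `x = F⁻¹ f - α p - β u` with `y` and `ν`
gives a `2 × 2` linear system for `α` and `β` whose determinant is `detFactor`. -/
lemma rank_two_solution {m : Type*} [Fintype m] [DecidableEq m] {F : Matrix m m ℝ} (hF : Fᵀ = F)
    (hdet : IsUnit F.det) {y ν f x : m → ℝ} {M α β : ℝ} (hβ : β = y ⬝ᵥ x)
    (hα : α = M * β + ν ⬝ᵥ x) (hx : F *ᵥ x + α • y + β • ν = f) :
    x = F⁻¹ *ᵥ f - α • (F⁻¹ *ᵥ y) - β • (F⁻¹ *ᵥ ν) ∧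
      detFactor y ν (F⁻¹ *ᵥ y) (F⁻¹ *ᵥ ν) M * α
        = (M - ν ⬝ᵥ (F⁻¹ *ᵥ ν)) * (y ⬝ᵥ (F⁻¹ *ᵥ f))
          + (1 + ν ⬝ᵥ (F⁻¹ *ᵥ y)) * (ν ⬝ᵥ (F⁻¹ *ᵥ f)) ∧
      detFactor y ν (F⁻¹ *ᵥ y) (F⁻¹ *ᵥ ν) M * β
        = (1 + ν ⬝ᵥ (F⁻¹ *ᵥ y)) * (y ⬝ᵥ (F⁻¹ *ᵥ f)) - (y ⬝ᵥ (F⁻¹ *ᵥ y)) * (ν ⬝ᵥ (F⁻¹ *ᵥ f)) := by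
  have hxe : x = F⁻¹ *ᵥ f - α • (F⁻¹ *ᵥ y) - β • (F⁻¹ *ᵥ ν) := by
    rw [← hx]
    simp only [Matrix.mulVec_add, Matrix.mulVec_smul, Matrix.mulVec_mulVec,
      Matrix.nonsing_inv_mul _ hdet, Matrix.one_mulVec]
    abel
  have hsymm : y ⬝ᵥ (F⁻¹ *ᵥ ν) = ν ⬝ᵥ (F⁻¹ *ᵥ y) := by
    rw [dotProduct_mulVec_transpose, Matrix.transpose_nonsing_inv, hF, dotProduct_comm]
  have e1 : β = y ⬝ᵥ (F⁻¹ *ᵥ f) - α * (y ⬝ᵥ (F⁻¹ *ᵥ y)) - β * (ν ⬝ᵥ (F⁻¹ *ᵥ y)) := by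
    conv_lhs => rw [hβ, hxe]
    simp only [dotProduct_sub, dotProduct_smul, smul_eq_mul, hsymm]
  have e2 : α = M * β + (ν ⬝ᵥ (F⁻¹ *ᵥ f) - α * (ν ⬝ᵥ (F⁻¹ *ᵥ y)) - β * (ν ⬝ᵥ (F⁻¹ *ᵥ ν))) := by
    conv_lhs => rw [hα, hxe]
    simp only [dotProduct_sub, dotProduct_smul, smul_eq_mul]
  refine ⟨hxe, ?_, ?_⟩
  · rw [detFactor]
    linear_combination (M - ν ⬝ᵥ (F⁻¹ *ᵥ ν)) * e1 + (1 + ν ⬝ᵥ (F⁻¹ *ᵥ y)) * e2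
  · rw [detFactor]
    linear_combination (1 + ν ⬝ᵥ (F⁻¹ *ᵥ y)) * e1 - (y ⬝ᵥ (F⁻¹ *ᵥ y)) * e2

/-! ### Combining the estimates -/

/-- The quadratic forms of the labels that determine the ridge solution, with their sizes: `a` and
`ae` pair `y` with `F⁻¹ y` and `F⁻¹ (ŷ - y)`, `b` and `be` pair `ν` with the same vectors, and
`φ = ‖μ‖² - νᵀ F⁻¹ ν`. Here `a₀` stands for `n / Λ`, and `T` for `t ◊`. -/
structure FormBounds (C N a₀ σ T a ae b be φ : ℝ) : Prop where
  one_le : 1 ≤ C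
  σ_nonneg : 0 ≤ σ
  T_nonneg : 0 ≤ T
  T_sq : 8 * C ^ 4 * T ^ 2 ≤ N
  σ_le : 4 * C ^ 4 * σ ≤ 1
  a₀_pos : 0 < a₀
  a_lower : a₀ / C ≤ a
  a_upper : a ≤ C * a₀
  φ_lower : N / C ≤ φ * a₀
  φ_upper : φ * a₀ ≤ C * N
  ae_le : |ae| ≤ C * σ * a₀
  b_le : |b| ≤ C * T
  be_le : |be| ≤ C * σ * T

namespace FormBounds

variable {C N a₀ σ T a ae b be φ : ℝ}

lemma C_pos (h : FormBounds C N a₀ σ T a ae b be φ) : 0 < C := lt_of_lt_of_le one_pos h.one_le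

lemma N_nonneg (h : FormBounds C N a₀ σ T a ae b be φ) : 0 ≤ N :=
  le_trans (by have := h.C_pos; positivity) h.T_sq

lemma φ_nonneg (h : FormBounds C N a₀ σ T a ae b be φ) : 0 ≤ φ :=
  nonneg_of_mul_nonneg_left (le_trans (div_nonneg h.N_nonneg h.C_pos.le) h.φ_lower) h.a₀_pos

lemma a_pos (h : FormBounds C N a₀ σ T a ae b be φ) : 0 < a :=
  lt_of_lt_of_le (div_pos h.a₀_pos h.C_pos) h.a_lower

lemma σ_le_one (h : FormBounds C N a₀ σ T a ae b be φ) : σ ≤ 1 := by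
  have : 1 ≤ C ^ 4 := one_le_pow₀ h.one_le
  nlinarith [h.σ_le, h.σ_nonneg]

lemma T_sq_le (h : FormBounds C N a₀ σ T a ae b be φ) : C ^ 2 * T ^ 2 ≤ N := by
  have h1 : C ^ 2 ≤ C ^ 4 := pow_le_pow_right₀ h.one_le (by norm_num)
  have h2 : C ^ 2 * T ^ 2 ≤ C ^ 4 * T ^ 2 := by gcongr
  have h3 : 0 ≤ C ^ 4 * T ^ 2 := by positivity
  linarith [h.T_sq]

lemma detFactor_pos (h : FormBounds C N a₀ σ T a ae b be φ) : 0 < (1 + b) ^ 2 + a * φ := by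
  rcases h.N_nonneg.eq_or_lt with hN | hN
  · -- without signal the cross term `b` vanishes
    have hT : T = 0 := by
      have h1 := h.T_sq_le
      have h2 : 0 < C ^ 2 := by have := h.C_pos; positivity
      have h3 : T ^ 2 ≤ 0 := by
        by_contra hc
        push Not at hc
        nlinarith
      exact pow_eq_zero_iff two_ne_zero |>.1 (le_antisymm h3 (sq_nonneg T))
    have hb : b = 0 := by
      have := h.b_le
      rw [hT, mul_zero] at this
      exact abs_nonpos_iff.1 this
    have := mul_nonneg h.a_pos.le h.φ_nonneg
    rw [hb]; linarith
  · have hφ : 0 < φ := by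
      have h1 := h.φ_lower
      have h2 : 0 < N / C := div_pos hN h.C_pos
      exact pos_of_mul_pos_left (lt_of_lt_of_le h2 h1) h.a₀_pos.le
    have := mul_pos h.a_pos hφ
    positivity

lemma margin_lower (h : FormBounds C N a₀ σ T a ae b be φ) :
    N / (2 * C ^ 2) - 2 * C * T ≤ φ * (a + ae) + (1 + b) * (b + be) := by
  have hC := h.C_pos
  have hσ := h.σ_nonneg
  have hT := h.T_nonneg
  have hN := h.N_nonneg
  have hφ := h.φ_nonneg
  have h1 : N / C ^ 2 ≤ φ * a := by
    calc N / C ^ 2 = N / C / C := by rw [sq, div_div]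
      _ ≤ φ * a₀ / C := by have := h.φ_lower; gcongr
      _ = φ * (a₀ / C) := by ring
      _ ≤ φ * a := by have := h.a_lower; gcongr
  have h2 : |φ * ae| ≤ N / (4 * C ^ 2) := by
    rw [abs_mul, abs_of_nonneg hφ]
    calc φ * |ae| ≤ φ * (C * σ * a₀) := by have := h.ae_le; gcongr
      _ = C * σ * (φ * a₀) := by ring
      _ ≤ C * σ * (C * N) := by have := h.φ_upper; gcongr
      _ = (4 * C ^ 4 * σ) * (N / (4 * C ^ 2)) := by field_simp
      _ ≤ 1 * (N / (4 * C ^ 2)) := by have := h.σ_le; gcongr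
      _ = _ := one_mul _
  have hb := h.b_le
  have hbe : |be| ≤ C * T := h.be_le.trans (by
    have := h.σ_le_one
    have : C * T * σ ≤ C * T * 1 := by gcongr
    linarith)
  have h3 : |(1 + b) * (b + be)| ≤ 2 * C * T + 2 * C ^ 2 * T ^ 2 := by
    rw [abs_mul]
    have e1 : |1 + b| ≤ 1 + C * T := (abs_add_le _ _).trans (by rw [abs_one]; linarith)
    have e2 : |b + be| ≤ 2 * (C * T) := (abs_add_le _ _).trans (by linarith)
    calc _ ≤ (1 + C * T) * (2 * (C * T)) := by gcongr
      _ = _ := by ring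
  have h4 : 2 * C ^ 2 * T ^ 2 ≤ N / (4 * C ^ 2) := by
    rw [le_div_iff₀ (by positivity)]
    linarith [h.T_sq]
  have e : N / C ^ 2 = N / (2 * C ^ 2) + N / (4 * C ^ 2) + N / (4 * C ^ 2) := by field_simp; ring
  have := neg_abs_le (φ * ae)
  have := neg_abs_le ((1 + b) * (b + be))
  rw [mul_add]
  linarith

/-- The norm of the rescaled solution. Here `R` stands for `√(V + t² ΔV)`, `d` for `◊`, `rn` for
`√n`, and `x`, `xe`, `xr` for the norms of `Qᵀ F⁻¹ y`, `Qᵀ F⁻¹ (ŷ - y)` and `μ - Qᵀ F⁻¹ ν`. -/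
lemma norm_upper (h : FormBounds C N a₀ σ T a ae b be φ) {R d rn x xe xr : ℝ} (hR : 0 ≤ R)
    (hRC : R ≤ C) (hTd : T ≤ d * rn) (hTR : d * rn * T ≤ N * R) (hx0 : 0 ≤ x)
    (hxe0 : 0 ≤ xe) (hxr0 : 0 ≤ xr) (hx : x ≤ C * R) (hxe : xe ≤ C * σ * R)
    (hxr : a₀ * xr ≤ C * (d * rn)) :
    |1 + b - φ * ae - (1 + b) * be| * x + ((1 + b) ^ 2 + a * φ) * xe
        + |a + (1 + b) * ae - a * be| * xr
      ≤ 12 * C ^ 3 * ((1 + N * σ) * R + d * rn) := by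
  have hC := h.C_pos
  have hC1 := h.one_le
  have hσ := h.σ_nonneg
  have hσ1 := h.σ_le_one
  have hT := h.T_nonneg
  have hN := h.N_nonneg
  have hφ := h.φ_nonneg
  have ha₀ := h.a₀_pos
  have hdr : 0 ≤ d * rn := hT.trans hTd
  have hb := h.b_le
  have hbe := h.be_le
  have hae := h.ae_le
  have hC12 : C ≤ C ^ 2 := le_self_pow₀ hC1 (by norm_num)
  have hC13 : C ≤ C ^ 3 := le_self_pow₀ hC1 (by norm_num)
  have hC23 : C ^ 2 ≤ C ^ 3 := pow_le_pow_right₀ hC1 (by norm_num)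
  have hNσ : 0 ≤ N * σ := by positivity
  have hb1 : |1 + b| ≤ 1 + C * T := (abs_add_le _ _).trans (by rw [abs_one]; linarith)
  have hφae : |φ * ae| ≤ C ^ 2 * (N * σ) := by
    rw [abs_mul, abs_of_nonneg hφ]
    calc φ * |ae| ≤ φ * (C * σ * a₀) := by gcongr
      _ = C * σ * (φ * a₀) := by ring
      _ ≤ C * σ * (C * N) := by have := h.φ_upper; gcongr
      _ = _ := by ring
  -- the term along `Qᵀ F⁻¹ y`
  have t1 : |1 + b - φ * ae - (1 + b) * be| * x
      ≤ 4 * C ^ 3 * ((1 + N * σ) * R) + 2 * C ^ 3 * (d * rn) := by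
    have e1 : |(1 + b) * be| ≤ C * T + N * σ := by
      rw [abs_mul]
      calc _ ≤ (1 + C * T) * (C * σ * T) := by gcongr
        _ = C * T * σ + (C ^ 2 * T ^ 2) * σ := by ring
        _ ≤ C * T * 1 + N * σ := by have := h.T_sq_le; gcongr
        _ = _ := by ring
    have e2 : |1 + b - φ * ae - (1 + b) * be| ≤ 1 + 2 * C * T + 2 * C ^ 2 * (N * σ) := by
      have s1 := abs_sub (1 + b - φ * ae) ((1 + b) * be)
      have s2 := abs_sub (1 + b) (φ * ae)
      have s3 : N * σ ≤ C ^ 2 * (N * σ) := le_mul_of_one_le_left hNσ (one_le_pow₀ hC1)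
      linarith
    calc _ ≤ (1 + 2 * C * T + 2 * C ^ 2 * (N * σ)) * (C * R) := by gcongr
      _ = C * R + 2 * C ^ 2 * (T * R) + 2 * C ^ 3 * (N * σ * R) := by ring
      _ ≤ C ^ 3 * R + 2 * C ^ 2 * (d * rn * C) + 2 * C ^ 3 * (N * σ * R) := by gcongr
      _ ≤ _ := by
        have : 0 ≤ C ^ 3 * R := by positivity
        have : 0 ≤ C ^ 3 * (N * σ * R) := by positivity
        linarith
  -- the term along `Qᵀ F⁻¹ (ŷ - y)`
  have t2 : ((1 + b) ^ 2 + a * φ) * xe ≤ 5 * C ^ 3 * ((1 + N * σ) * R) := by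
    have e1 : (1 + b) ^ 2 ≤ 2 + 2 * N := by
      have s1 : b ^ 2 ≤ C ^ 2 * T ^ 2 := by
        rw [← sq_abs, ← mul_pow]; gcongr
      have := h.T_sq_le
      nlinarith [sq_nonneg (1 - b)]
    have e2 : a * φ ≤ C ^ 2 * N := by
      calc a * φ ≤ C * a₀ * φ := by have := h.a_upper; gcongr
        _ = C * (φ * a₀) := by ring
        _ ≤ C * (C * N) := by have := h.φ_upper; gcongr
        _ = _ := by ring
    have e3 : (1 + b) ^ 2 + a * φ ≤ 2 + 3 * C ^ 2 * N := by
      have : N ≤ C ^ 2 * N := le_mul_of_one_le_left hN (one_le_pow₀ hC1)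
      linarith
    calc _ ≤ (2 + 3 * C ^ 2 * N) * (C * σ * R) := by gcongr
      _ = 2 * C * (σ * R) + 3 * C ^ 3 * (N * σ * R) := by ring
      _ ≤ 2 * C ^ 3 * (1 * R) + 3 * C ^ 3 * (N * σ * R) := by gcongr
      _ ≤ _ := by
        have : 0 ≤ C ^ 3 * R := by positivity
        have : 0 ≤ C ^ 3 * (N * σ * R) := by positivity
        linarith
  -- the term along `μ - Qᵀ F⁻¹ ν`
  have t3 : |a + (1 + b) * ae - a * be| * xr
      ≤ 2 * C ^ 3 * (d * rn) + 2 * C ^ 3 * ((1 + N * σ) * R) := by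
    have ha := h.a_pos
    have e1 : |(1 + b) * ae| ≤ (1 + C * T) * (C * σ * a₀) := by rw [abs_mul]; gcongr
    have e2 : |a * be| ≤ C * a₀ * (C * σ * T) := by
      rw [abs_mul, abs_of_pos ha]; have := h.a_upper; gcongr
    have e3 : |a + (1 + b) * ae - a * be| ≤ (2 * C + 2 * C ^ 2 * (σ * T)) * a₀ := by
      have s1 := abs_sub (a + (1 + b) * ae) (a * be)
      have s2 := abs_add_le a ((1 + b) * ae)
      have s3 : C * σ * a₀ ≤ C * 1 * a₀ := by gcongr
      rw [abs_of_pos ha] at s2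
      linarith [h.a_upper]
    calc _ ≤ (2 * C + 2 * C ^ 2 * (σ * T)) * a₀ * xr := by gcongr
      _ = (2 * C + 2 * C ^ 2 * (σ * T)) * (a₀ * xr) := by ring
      _ ≤ (2 * C + 2 * C ^ 2 * (σ * T)) * (C * (d * rn)) := by gcongr
      _ = 2 * C ^ 2 * (d * rn) + 2 * C ^ 3 * σ * (d * rn * T) := by ring
      _ ≤ 2 * C ^ 3 * (d * rn) + 2 * C ^ 3 * σ * (N * R) := by gcongr
      _ ≤ _ := by
        have : 0 ≤ C ^ 3 * R := by positivity
        linarith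
  have : 0 ≤ C ^ 3 * (d * rn) := by positivity
  have : 0 ≤ C ^ 3 * ((1 + N * σ) * R) := by positivity
  linarith

end FormBounds

/-! ### Head and tail of the model -/

lemma sum_head_add_sum_tail {p : ℕ} (k : ℕ) (f : Fin p → ℝ) :
    ∑ i : Head p k, f i.val + ∑ i : Tail p k, f i.val = ∑ i, f i := by
  rw [← Fintype.sum_subtype_add_sum_subtype (fun i : Fin p => i.val < k) f]
  congr 1
  exact Fintype.sum_equiv (Equiv.subtypeEquivRight fun i => by simp) _ _ fun _ => rfl

lemma le_dotProduct_mulVec_of_spectrum {ι : Type*} [Fintype ι] [DecidableEq ι] {H : Matrix ι ι ℝ}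
    (hH : Hᵀ = H) {a b : ℝ} (hs : spectrum ℝ H ⊆ Set.Icc a b) (v : ι → ℝ) :
    a * (v ⬝ᵥ v) ≤ v ⬝ᵥ (H *ᵥ v) ∧ v ⬝ᵥ (H *ᵥ v) ≤ b * (v ⬝ᵥ v) := by
  have hH' : H.IsHermitian := by
    rwa [Matrix.IsHermitian, Matrix.conjTranspose_eq_transpose_of_trivial]
  obtain ⟨U, d, hU, hU', hHd, hd, -⟩ := exists_orthogonal_diagonalization hH'
  have e : v ⬝ᵥ v = ∑ j, (Uᵀ *ᵥ v) j ^ 2 := by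
    rw [← dotProduct_orthogonal_mulVec_self (U := Uᵀ) (by rwa [Matrix.transpose_transpose]) v]
    exact Finset.sum_congr rfl fun j _ => by ring
  have hq : v ⬝ᵥ (H *ᵥ v) = ∑ j, d j * (Uᵀ *ᵥ v) j ^ 2 := by
    rw [hHd]; exact dotProduct_diagonalized_mulVec U d v
  rw [hq, e, Finset.mul_sum, Finset.mul_sum]
  exact ⟨Finset.sum_le_sum fun j _ => mul_le_mul_of_nonneg_right (hs (hd j)).1 (sq_nonneg _),
    Finset.sum_le_sum fun j _ => mul_le_mul_of_nonneg_right (hs (hd j)).2 (sq_nonneg _)⟩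

lemma dotProduct_mulVec_le_of_norm_le {ι : Type*} [Fintype ι] [DecidableEq ι] {H : Matrix ι ι ℝ}
    {θ : ℝ} (h : ‖Matrix.toEuclideanCLM (𝕜 := ℝ) H‖ ≤ θ) (v : ι → ℝ) :
    v ⬝ᵥ (H *ᵥ v) ≤ θ * (v ⬝ᵥ v) := by
  have h1 := Matrix.inner_toEuclideanCLM H (WithLp.toLp 2 v) (WithLp.toLp 2 v)
  have h2 := real_inner_le_norm (WithLp.toLp 2 v)
    (Matrix.toEuclideanCLM (𝕜 := ℝ) H (WithLp.toLp 2 v))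
  have h3 := (Matrix.toEuclideanCLM (𝕜 := ℝ) H).le_of_opNorm_le h (WithLp.toLp 2 v)
  have h4 : ‖WithLp.toLp 2 v‖ ^ 2 = v ⬝ᵥ v := by
    rw [EuclideanSpace.real_norm_sq_eq]
    exact Finset.sum_congr rfl fun i _ => by simp [sq]
  rw [h1] at h2
  rw [← h4]
  refine h2.trans ?_
  nlinarith [norm_nonneg (WithLp.toLp 2 v)]

/-- The centred part `Q Qᵀ + λ I` of the Gram matrix. -/
noncomputable def centredGram {n p : ℕ} (lam : Fin p → ℝ) (reg : ℝ) (Z : Matrix (Fin n) (Fin p) ℝ) :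
    Matrix (Fin n) (Fin n) ℝ :=
  covariates lam Z * (covariates lam Z)ᵀ + reg • (1 : Matrix (Fin n) (Fin n) ℝ)

/-- The eigenvalues of the head. -/
def headEig {p : ℕ} (lam : Fin p → ℝ) (k : ℕ) : Head p k → ℝ := fun i => lam i.val

/-- The matrix `Q_{k:∞} Σ_{k:∞}^{1/2}`. -/
noncomputable def tailRoot {n p : ℕ} (lam : Fin p → ℝ) (k : ℕ) (Z : Matrix (Fin n) (Fin p) ℝ) :
    Matrix (Fin n) (Tail p k) ℝ :=
  tailCols k (covariates lam Z) * Matrix.diagonal (fun i => √(tailVec k lam i))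

lemma covariates_apply {n p : ℕ} (lam : Fin p → ℝ) (Z : Matrix (Fin n) (Fin p) ℝ) (i : Fin n)
    (j : Fin p) : covariates lam Z i j = Z i j * √(lam j) := by
  rw [covariates, Matrix.mul_diagonal]

lemma centredGram_eq {n p : ℕ} {lam : Fin p → ℝ} (h0 : ∀ i, 0 ≤ lam i) (reg : ℝ) (k : ℕ)
    (Z : Matrix (Fin n) (Fin p) ℝ) :
    centredGram lam reg Z = headCols k Z * Matrix.diagonal (headEig lam k) * (headCols k Z)ᵀ
      + tailGram lam reg k Z := by
  rw [centredGram, tailGram, ← add_assoc]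
  congr 1
  ext i j
  rw [Matrix.mul_apply, ← sum_head_add_sum_tail k, Matrix.add_apply, Matrix.mul_apply,
    Matrix.mul_apply]
  congr 1
  refine Finset.sum_congr rfl fun s _ => ?_
  rw [Matrix.mul_diagonal]
  simp only [Matrix.transpose_apply, covariates_apply, headCols, headEig, Matrix.submatrix_apply,
    id]
  linear_combination Z i s.val * Z j s.val * Real.mul_self_sqrt (h0 s.val)

lemma covariates_mulVec_eq {n p : ℕ} (lam mu : Fin p → ℝ) (k : ℕ)
    (Z : Matrix (Fin n) (Fin p) ℝ) :
    covariates lam Z *ᵥ mu = headCols k Z *ᵥ (fun i => √(headEig lam k i) * mu i.val)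
      + tailCols k (covariates lam Z) *ᵥ tailVec k mu := by
  ext i
  simp only [Matrix.mulVec, dotProduct, Pi.add_apply]
  rw [← sum_head_add_sum_tail k]
  congr 1
  refine Finset.sum_congr rfl fun s _ => ?_
  simp only [covariates_apply, headCols, headEig, Matrix.submatrix_apply, id]
  ring

lemma transpose_covariates_mulVec_head {n p : ℕ} (lam : Fin p → ℝ) (k : ℕ)
    (Z : Matrix (Fin n) (Fin p) ℝ) (v : Fin n → ℝ) (i : Head p k) :
    ((covariates lam Z)ᵀ *ᵥ v) i.val = √(headEig lam k i) * ((headCols k Z)ᵀ *ᵥ v) i := by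
  simp only [Matrix.mulVec, dotProduct, Matrix.transpose_apply, covariates_apply, headCols,
    headEig, Matrix.submatrix_apply, id, Finset.mul_sum]
  exact Finset.sum_congr rfl fun s _ => by ring

lemma transpose_tailRoot_mulVec {n p : ℕ} (lam : Fin p → ℝ) (k : ℕ)
    (Z : Matrix (Fin n) (Fin p) ℝ) (v : Fin n → ℝ) (i : Tail p k) :
    ((tailRoot lam k Z)ᵀ *ᵥ v) i = √(lam i.val) * ((covariates lam Z)ᵀ *ᵥ v) i.val := by
  rw [tailRoot, Matrix.transpose_mul, Matrix.diagonal_transpose, ← Matrix.mulVec_mulVec,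
    Matrix.mulVec_diagonal]
  rfl

lemma tailRoot_mul_transpose {n p : ℕ} {lam : Fin p → ℝ} (h0 : ∀ i, 0 ≤ lam i) (k : ℕ)
    (Z : Matrix (Fin n) (Fin p) ℝ) :
    tailRoot lam k Z * (tailRoot lam k Z)ᵀ = tailSigmaGram lam k Z := by
  rw [tailRoot, tailSigmaGram, Matrix.transpose_mul, Matrix.diagonal_transpose,
    ← Matrix.mul_assoc, Matrix.mul_assoc (tailCols k (covariates lam Z)),
    Matrix.diagonal_mul_diagonal]
  congr 3
  ext i
  exact Real.mul_self_sqrt (h0 _)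

/-! ### The norm weighted by the covariance -/

lemma sigmaNorm_nonneg {p : ℕ} (lam w : Fin p → ℝ) : 0 ≤ sigmaNorm lam w := Real.sqrt_nonneg _

lemma sigmaNorm_sq {p : ℕ} {lam : Fin p → ℝ} (h0 : ∀ i, 0 ≤ lam i) (k : ℕ) (w : Fin p → ℝ) :
    sigmaNorm lam w ^ 2 = ∑ i : Head p k, lam i.val * w i.val ^ 2
      + ∑ i : Tail p k, lam i.val * w i.val ^ 2 := by
  rw [sum_head_add_sum_tail k fun i => lam i * w i ^ 2, sigmaNorm]
  have e : w ⬝ᵥ (Matrix.diagonal lam *ᵥ w) = ∑ i, lam i * w i ^ 2 := by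
    simp only [dotProduct, Matrix.mulVec_diagonal]
    exact Finset.sum_congr rfl fun i _ => by ring
  rw [e, Real.sq_sqrt (Finset.sum_nonneg fun i _ => mul_nonneg (h0 i) (sq_nonneg _))]

lemma sigmaNorm_eq_norm {p : ℕ} {lam : Fin p → ℝ} (h0 : ∀ i, 0 ≤ lam i) (w : Fin p → ℝ) :
    sigmaNorm lam w = ‖WithLp.toLp 2 (fun i => √(lam i) * w i)‖ := by
  rw [EuclideanSpace.norm_eq, sigmaNorm]
  congr 1
  simp only [dotProduct, Matrix.mulVec_diagonal, Real.norm_eq_abs, sq_abs]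
  refine Finset.sum_congr rfl fun i _ => ?_
  rw [mul_pow, Real.sq_sqrt (h0 i)]; ring

lemma sigmaNorm_add_le {p : ℕ} {lam : Fin p → ℝ} (h0 : ∀ i, 0 ≤ lam i) (v w : Fin p → ℝ) :
    sigmaNorm lam (v + w) ≤ sigmaNorm lam v + sigmaNorm lam w := by
  simp only [sigmaNorm_eq_norm h0]
  refine le_of_eq_of_le ?_ (norm_add_le _ _)
  rw [← WithLp.toLp_add]
  congr 2
  ext i
  simp [mul_add]

lemma sigmaNorm_smul {p : ℕ} {lam : Fin p → ℝ} (h0 : ∀ i, 0 ≤ lam i) (c : ℝ) (w : Fin p → ℝ) :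
    sigmaNorm lam (c • w) = |c| * sigmaNorm lam w := by
  simp only [sigmaNorm_eq_norm h0]
  rw [← Real.norm_eq_abs, ← norm_smul, ← WithLp.toLp_smul]
  congr 2
  ext i
  simp; ring

lemma mul_sigmaNorm_le {p : ℕ} {lam : Fin p → ℝ} (h0 : ∀ i, 0 ≤ lam i) {S c₁ c₂ : ℝ} (hS : 0 < S)
    {w v₁ v₂ v₃ : Fin p → ℝ} (hw : S • w = c₁ • v₁ + S • v₂ + c₂ • v₃) :
    S * sigmaNorm lam w
      ≤ |c₁| * sigmaNorm lam v₁ + S * sigmaNorm lam v₂ + |c₂| * sigmaNorm lam v₃ := by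
  have e : S * sigmaNorm lam w = sigmaNorm lam (S • w) := by
    rw [sigmaNorm_smul h0, abs_of_pos hS]
  rw [e, hw]
  refine (sigmaNorm_add_le h0 _ _).trans (add_le_add
    ((sigmaNorm_add_le h0 _ _).trans (add_le_add (sigmaNorm_smul h0 _ _).le ?_))
    (sigmaNorm_smul h0 _ _).le)
  rw [sigmaNorm_smul h0, abs_of_pos hS]

/-! ### Deterministic estimates on the good event -/

/-- The covariates lie in both events, with the single constant `K`, and the tail eigenvalues are
small compared with `Λ`. -/
structure Regime {n p : ℕ} (lam mu : Fin p → ℝ) (reg : ℝ) (k : ℕ) (hk : k < p) (K : ℝ)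
    (Z : Matrix (Fin n) (Fin p) ℝ) : Prop where
  wc : WellConditioned (n : ℝ) (Lam lam reg k) K (tailGram lam reg k Z) (headCols k Z)
  anti : Antitone lam
  nonneg : ∀ i, 0 ≤ lam i
  pos : ∀ i : Head p k, 0 < headEig lam k i
  tail_mu :
    (tailCols k (covariates lam Z) *ᵥ tailVec k mu) ⬝ᵥ
        (tailCols k (covariates lam Z) *ᵥ tailVec k mu)
      ≤ K * n * ∑ i : Tail p k, lam i.val * mu i.val ^ 2
  tail_trace : (tailSigmaGram lam k Z).trace ≤ K * n * tailSq lam k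
  tail_norm : ∀ v : Fin n → ℝ, v ⬝ᵥ (tailSigmaGram lam k Z *ᵥ v)
    ≤ K * (tailSq lam k + n * lam ⟨k, hk⟩ ^ 2) * (v ⬝ᵥ v)
  gap : 4 * K ^ 2 * (n * lam ⟨k, hk⟩) ≤ Lam lam reg k
  sq_gap : n * tailSq lam k ≤ Lam lam reg k ^ 2

lemma tailSq_nonneg {p : ℕ} (lam : Fin p → ℝ) (k : ℕ) : 0 ≤ tailSq lam k :=
  Finset.sum_nonneg fun _ _ => sq_nonneg _

lemma headShrink_inv {p n : ℕ} {lam : Fin p → ℝ} {reg : ℝ} {k : ℕ} (i : Head p k)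
    (h : 0 < headEig lam k i) (hΛ : 0 < Lam lam reg k / n) :
    (headShrink n lam reg k i)⁻¹ = headEig lam k i / (Lam lam reg k / n + headEig lam k i) := by
  rw [headShrink]
  change (Lam lam reg k / n * (headEig lam k i)⁻¹ + 1)⁻¹ = _
  set κ := Lam lam reg k / n
  field_simp

namespace Regime

variable {n p : ℕ} {lam mu : Fin p → ℝ} {reg : ℝ} {k : ℕ} {hk : k < p} {K : ℝ}
  {Z : Matrix (Fin n) (Fin p) ℝ}

lemma ratio_pos (h : Regime lam mu reg k hk K Z) : 0 < Lam lam reg k / n :=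
  div_pos h.wc.Λ_pos h.wc.N_pos

lemma isUnit_det (h : Regime lam mu reg k hk K Z) : IsUnit (centredGram lam reg Z).det := by
  rw [centredGram_eq h.nonneg reg k]; exact h.wc.full_isUnit_det h.pos

lemma transpose_centredGram : (centredGram lam reg Z)ᵀ = centredGram lam reg Z := by
  simp [centredGram, Matrix.transpose_mul]

/-- The head part of `B` is the squared norm of the vector `g` of `residual_bounds`. -/
lemma B_eq (h : Regime lam mu reg k hk K Z) :
    B n lam mu reg k = ∑ i : Head p k, (Lam lam reg k / n * (√(headEig lam k i) * mu i.val) /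
        (Lam lam reg k / n + headEig lam k i)) ^ 2
      + ∑ i : Tail p k, lam i.val * mu i.val ^ 2 := by
  rw [B, ← mul_pow, Finset.mul_sum]
  congr 1
  refine Finset.sum_congr rfl fun i _ => ?_
  have hi := h.pos i
  have hκ := h.ratio_pos
  rw [headShrink_inv i hi hκ, ← mul_pow]
  congr 1
  change (n : ℝ)⁻¹ * Lam lam reg k * (_ * ((√(headEig lam k i))⁻¹ * mu i.val)) = _
  rw [← div_eq_inv_mul]
  set κ := Lam lam reg k / n
  have e := Real.mul_self_sqrt hi.le
  have : 0 < √(headEig lam k i) := Real.sqrt_pos.2 hi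
  set r := √(headEig lam k i)
  rw [← e]
  field_simp

lemma M_eq (h : Regime lam mu reg k hk K Z) :
    M n lam mu reg k = ∑ i : Head p k, Lam lam reg k / n * mu i.val ^ 2 /
        (Lam lam reg k / n + headEig lam k i)
      + ∑ i : Tail p k, mu i.val ^ 2 := by
  rw [M, Finset.mul_sum]
  congr 1
  refine Finset.sum_congr rfl fun i _ => ?_
  have hi := h.pos i
  have hκ := h.ratio_pos
  have hs : 0 ≤ headShrink n lam reg k i := by
    rw [headShrink]
    have : 0 < lam i.val := hi
    positivity
  rw [mul_pow, mul_pow, inv_pow, Real.sq_sqrt hs, headShrink_inv i hi hκ, inv_pow]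
  change _ * (_ * ((√(headEig lam k i) ^ 2)⁻¹ * _)) = _
  rw [Real.sq_sqrt hi.le]
  set κ := Lam lam reg k / n
  field_simp

lemma V_eq (h : Regime lam mu reg k hk K Z) :
    V n lam reg k = 1 / n * ∑ i : Head p k,
        (headEig lam k i / (Lam lam reg k / n + headEig lam k i)) ^ 2
      + n * tailSq lam k / Lam lam reg k ^ 2 := by
  rw [V]
  congr 1
  · rw [one_div]
    congr 1
    exact Finset.sum_congr rfl fun i _ => by rw [headShrink_inv i (h.pos i) h.ratio_pos]
  · rw [inv_pow]; ring

lemma B_nonneg (h : Regime lam mu reg k hk K Z) : 0 ≤ B n lam mu reg k := by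
  rw [h.B_eq]
  exact add_nonneg (Finset.sum_nonneg fun _ _ => sq_nonneg _)
    (Finset.sum_nonneg fun i _ => mul_nonneg (h.nonneg _) (sq_nonneg _))

lemma M_nonneg (h : Regime lam mu reg k hk K Z) : 0 ≤ M n lam mu reg k := by
  rw [h.M_eq]
  refine add_nonneg (Finset.sum_nonneg fun i _ => ?_) (Finset.sum_nonneg fun i _ => sq_nonneg _)
  have := h.pos i
  have := h.ratio_pos
  positivity

lemma N_eq : N n lam mu reg k = n / Lam lam reg k * M n lam mu reg k := by
  rw [N, div_eq_mul_inv]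

lemma Dia_sq (h : Regime lam mu reg k hk K Z) :
    Dia n lam mu reg k ^ 2 = n / Lam lam reg k ^ 2 * B n lam mu reg k := by
  have := h.B_nonneg
  rw [Dia, Real.sq_sqrt (by positivity), inv_pow, div_eq_mul_inv]

/-- Both comparisons of `B` with `M`: each coordinate of `B` carries an additional factor at most
`Λ / n`, and at most the largest eigenvalue. -/
lemma B_le_mul_M (h : Regime lam mu reg k hk K Z) {θ : ℝ}
    (h1 : ∀ i : Head p k, Lam lam reg k / n * headEig lam k i /
      (Lam lam reg k / n + headEig lam k i) ≤ θ)
    (h2 : ∀ i : Tail p k, lam i.val ≤ θ) :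
    B n lam mu reg k ≤ θ * M n lam mu reg k := by
  rw [h.B_eq, h.M_eq, mul_add, Finset.mul_sum, Finset.mul_sum]
  refine add_le_add (Finset.sum_le_sum fun i _ => ?_) (Finset.sum_le_sum fun i _ =>
    mul_le_mul_of_nonneg_right (h2 i) (sq_nonneg _))
  have hi := h.pos i
  have hκ := h.ratio_pos
  have h1i := h1 i
  set κ := Lam lam reg k / n
  have e := Real.sq_sqrt hi.le
  have : (κ * (√(headEig lam k i) * mu i.val) / (κ + headEig lam k i)) ^ 2
      = κ * headEig lam k i / (κ + headEig lam k i)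
        * (κ * mu i.val ^ 2 / (κ + headEig lam k i)) := by
    rw [div_pow, mul_pow, mul_pow, e]
    field_simp
  rw [this]
  gcongr

lemma tail_le (h : Regime lam mu reg k hk K Z) (i : Tail p k) : lam i.val ≤ lam ⟨k, hk⟩ :=
  h.anti i.2

lemma le_first (h : Regime lam mu reg k hk K Z) (i : Fin p) :
    lam i ≤ lam ⟨0, Nat.zero_lt_of_lt hk⟩ := h.anti (Nat.zero_le i.val)

lemma tail_le_ratio (h : Regime lam mu reg k hk K Z) : lam ⟨k, hk⟩ ≤ Lam lam reg k / n := by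
  rw [le_div_iff₀ h.wc.N_pos]
  have h1 : 1 ≤ K ^ 2 := one_le_pow₀ h.wc.one_le
  have := mul_nonneg h.wc.N_pos.le (h.nonneg ⟨k, hk⟩)
  nlinarith [h.gap]

lemma B_le (h : Regime lam mu reg k hk K Z) :
    B n lam mu reg k ≤ Lam lam reg k / n * M n lam mu reg k := by
  refine h.B_le_mul_M (fun i => ?_) fun i => (h.tail_le i).trans h.tail_le_ratio
  have hi := h.pos i
  have hκ := h.ratio_pos
  rw [div_le_iff₀ (by positivity)]
  nlinarith

lemma B_le' (h : Regime lam mu reg k hk K Z) :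
    B n lam mu reg k ≤ lam ⟨0, Nat.zero_lt_of_lt hk⟩ * M n lam mu reg k := by
  refine h.B_le_mul_M (fun i => ?_) fun i => h.le_first _
  have hi := h.pos i
  have hκ := h.ratio_pos
  rw [div_le_iff₀ (by positivity)]
  have : headEig lam k i ≤ lam ⟨0, Nat.zero_lt_of_lt hk⟩ := h.le_first _
  nlinarith

lemma N_nonneg (h : Regime lam mu reg k hk K Z) : 0 ≤ N n lam mu reg k := by
  rw [N_eq]
  exact mul_nonneg (div_nonneg h.wc.N_pos.le h.wc.Λ_pos.le) h.M_nonneg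

lemma mul_Dia_sq_le (h : Regime lam mu reg k hk K Z) :
    n * Dia n lam mu reg k ^ 2 ≤ N n lam mu reg k := by
  have hn := h.wc.N_pos
  have hΛ := h.wc.Λ_pos
  rw [h.Dia_sq, N_eq]
  calc _ ≤ n * (n / Lam lam reg k ^ 2 * (Lam lam reg k / n * M n lam mu reg k)) := by
        gcongr; exact h.B_le
    _ = _ := by field_simp

lemma sqrt_mul_Dia_sq_le (h : Regime lam mu reg k hk K Z) :
    √(n : ℝ) * Dia n lam mu reg k ^ 2 ≤ N n lam mu reg k * √(DeltaV n lam reg k hk) := by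
  have hn := h.wc.N_pos
  have hΛ := h.wc.Λ_pos
  have hN := h.N_nonneg
  have h1 := h.mul_Dia_sq_le
  have h2 : Dia n lam mu reg k ^ 2
      ≤ N n lam mu reg k * (lam ⟨0, Nat.zero_lt_of_lt hk⟩ / Lam lam reg k) := by
    rw [h.Dia_sq, N_eq]
    calc _ ≤ n / Lam lam reg k ^ 2 * (lam ⟨0, Nat.zero_lt_of_lt hk⟩ * M n lam mu reg k) := by
          gcongr; exact h.B_le'
      _ = _ := by field_simp
  have hmin : min (1 / (n : ℝ)) (n * lam ⟨0, Nat.zero_lt_of_lt hk⟩ ^ 2 / Lam lam reg k ^ 2)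
      ≤ DeltaV n lam reg k hk := by
    rw [DeltaV]
    have : 0 ≤ (n * lam ⟨k, hk⟩ ^ 2 + tailSq lam k) / Lam lam reg k ^ 2 := by
      have := tailSq_nonneg lam k
      positivity
    linarith
  refine le_trans ?_ (mul_le_mul_of_nonneg_left (Real.sqrt_le_sqrt hmin) hN)
  have hs := Real.sqrt_pos.2 hn
  have hss := Real.mul_self_sqrt hn.le
  rcases le_total (1 / (n : ℝ)) (n * lam ⟨0, Nat.zero_lt_of_lt hk⟩ ^ 2 / Lam lam reg k ^ 2)
    with hc | hc
  · rw [min_eq_left hc, Real.sqrt_div' _ hn.le, Real.sqrt_one, mul_one_div, le_div_iff₀ hs]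
    calc _ = √(n : ℝ) * √(n : ℝ) * Dia n lam mu reg k ^ 2 := by ring
      _ ≤ _ := by rwa [hss]
  · have hl := h.nonneg ⟨0, Nat.zero_lt_of_lt hk⟩
    rw [min_eq_right hc, Real.sqrt_div' _ (by positivity), Real.sqrt_mul' _ (by positivity),
      Real.sqrt_sq hl, Real.sqrt_sq hΛ.le]
    calc _ ≤ √(n : ℝ) * (N n lam mu reg k * (lam ⟨0, Nat.zero_lt_of_lt hk⟩ / Lam lam reg k)) := by
          gcongr
      _ = _ := by ring

lemma n_mul_tail_le (h : Regime lam mu reg k hk K Z) : n * lam ⟨k, hk⟩ ≤ Lam lam reg k := by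
  have := h.tail_le_ratio
  rwa [le_div_iff₀ h.wc.N_pos, mul_comm] at this

lemma n_mul_noise_le (h : Regime lam mu reg k hk K Z) :
    n * (tailSq lam k + n * lam ⟨k, hk⟩ ^ 2) ≤ 2 * Lam lam reg k ^ 2 := by
  have h1 := h.sq_gap
  have h2 := pow_le_pow_left₀ (mul_nonneg h.wc.N_pos.le (h.nonneg _)) h.n_mul_tail_le 2
  nlinarith

lemma V_nonneg (h : Regime lam mu reg k hk K Z) : 0 ≤ V n lam reg k := by
  rw [h.V_eq]
  have := tailSq_nonneg lam k
  have : 0 ≤ ∑ i : Head p k, (headEig lam k i / (Lam lam reg k / n + headEig lam k i)) ^ 2 :=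
    Finset.sum_nonneg fun _ _ => sq_nonneg _
  positivity

lemma DeltaV_nonneg : 0 ≤ DeltaV n lam reg k hk := by
  have := tailSq_nonneg lam k
  rw [DeltaV]
  positivity

lemma card_head : (Fintype.card (Head p k) : ℝ) ≤ k := by
  rw [Fintype.card_subtype, Fin.card_filter_val_lt]
  exact_mod_cast min_le_right _ _

/-- For `t² ≤ n` the noise level is bounded by an absolute constant. -/
lemma V_add_le (h : Regime lam mu reg k hk K Z) {t : ℝ} (ht : t ^ 2 ≤ n) (hkn : (k : ℝ) ≤ n) :
    V n lam reg k + t ^ 2 * DeltaV n lam reg k hk ≤ 5 := by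
  have hn := h.wc.N_pos
  have hΛ := h.wc.Λ_pos
  have hsum : ∑ i : Head p k, (headEig lam k i / (Lam lam reg k / n + headEig lam k i)) ^ 2
      ≤ n := by
    calc _ ≤ ∑ _i : Head p k, (1 : ℝ) := Finset.sum_le_sum fun i _ => by
          have hi := h.pos i
          have hκ := h.ratio_pos
          refine pow_le_one₀ (by positivity) ?_
          rw [div_le_one (by positivity)]
          linarith
      _ = Fintype.card (Head p k) := by simp
      _ ≤ n := card_head.trans hkn
  have h1 : V n lam reg k ≤ 2 := by
    rw [h.V_eq]
    have e1 : 1 / (n : ℝ) * ∑ i : Head p k,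
        (headEig lam k i / (Lam lam reg k / n + headEig lam k i)) ^ 2 ≤ 1 := by
      rw [one_div_mul_eq_div, div_le_one hn]; exact hsum
    have e2 : n * tailSq lam k / Lam lam reg k ^ 2 ≤ 1 := by
      rw [div_le_one (by positivity)]; exact h.sq_gap
    linarith
  have h2 : n * DeltaV n lam reg k hk ≤ 3 := by
    rw [DeltaV, mul_add]
    have e1 : n * min (1 / (n : ℝ)) (n * lam ⟨0, Nat.zero_lt_of_lt hk⟩ ^ 2 / Lam lam reg k ^ 2)
        ≤ n * (1 / n) := by gcongr; exact min_le_left _ _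
    rw [mul_one_div_cancel hn.ne'] at e1
    have e2 : n * ((n * lam ⟨k, hk⟩ ^ 2 + tailSq lam k) / Lam lam reg k ^ 2) ≤ 2 := by
      rw [← mul_div_assoc, div_le_iff₀ (by positivity), add_comm]
      exact h.n_mul_noise_le
    linarith
  have h3 : t ^ 2 * DeltaV n lam reg k hk ≤ n * DeltaV n lam reg k hk :=
    mul_le_mul_of_nonneg_right ht DeltaV_nonneg
  linarith

/-- The estimates for `u = F⁻¹ ν` and for the residual `μ - Qᵀ u`. -/
lemma mean_bounds (h : Regime lam mu reg k hk K Z) {u : Fin n → ℝ}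
    (hu : u = (centredGram lam reg Z)⁻¹ *ᵥ (covariates lam Z *ᵥ mu)) :
    u ⬝ᵥ u ≤ 30 * K ^ 11 * Dia n lam mu reg k ^ 2 ∧
      sigmaNorm lam (mu - (covariates lam Z)ᵀ *ᵥ u) ^ 2 ≤ 136 * K ^ 12 * B n lam mu reg k := by
  have hK1 := h.wc.one_le
  have hK := h.wc.K_pos
  have hn := h.wc.N_pos
  have hΛ := h.wc.Λ_pos
  have hB := h.B_nonneg
  have hFu : centredGram lam reg Z *ᵥ u = covariates lam Z *ᵥ mu := by
    rw [hu, mulVec_inv_mulVec h.isUnit_det]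
  have hz : ∀ i : Head p k, √(headEig lam k i) * (mu - (covariates lam Z)ᵀ *ᵥ u) i.val
      = √(headEig lam k i) * mu i.val - headEig lam k i * ((headCols k Z)ᵀ *ᵥ u) i := by
    intro i
    rw [Pi.sub_apply, transpose_covariates_mulVec_head]
    linear_combination (-((headCols k Z)ᵀ *ᵥ u) i) * Real.mul_self_sqrt (h.pos i).le
  obtain ⟨h1, h2⟩ := h.wc.residual_bounds h.pos (ξ := fun i => mu i.val)
    (z := fun i => √(headEig lam k i) * (mu - (covariates lam Z)ᵀ *ᵥ u) i.val)
    (g := fun i => Lam lam reg k / n * (√(headEig lam k i) * mu i.val) /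
        (Lam lam reg k / n + headEig lam k i))
    (u := u) (τ := tailCols k (covariates lam Z) *ᵥ tailVec k mu)
    (β := ∑ i : Tail p k, lam i.val * mu i.val ^ 2) h.tail_mu hz (fun i => rfl) (by
      rw [centredGram_eq h.nonneg reg k, WellConditioned.full_mulVec,
        covariates_mulVec_eq lam mu k] at hFu
      rw [← sub_eq_iff_eq_add'.2 hFu.symm, add_sub_right_comm, ← Matrix.mulVec_sub]
      congr 2
      ext i
      exact (hz i).symm)
  have eB : ((fun i : Head p k => Lam lam reg k / n * (√(headEig lam k i) * mu i.val) /
        (Lam lam reg k / n + headEig lam k i)) ⬝ᵥ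
      (fun i : Head p k => Lam lam reg k / n * (√(headEig lam k i) * mu i.val) /
        (Lam lam reg k / n + headEig lam k i))) + ∑ i : Tail p k, lam i.val * mu i.val ^ 2
      = B n lam mu reg k := by
    rw [h.B_eq, dotProduct]
    simp only [sq]
  rw [eB] at h1 h2
  have huu : u ⬝ᵥ u ≤ 30 * K ^ 11 * Dia n lam mu reg k ^ 2 := by
    rw [h.Dia_sq]; linarith
  refine ⟨huu, ?_⟩
  rw [sigmaNorm_sq h.nonneg k]
  have e1 : ∑ i : Head p k, lam i.val * (mu - (covariates lam Z)ᵀ *ᵥ u) i.val ^ 2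
      ≤ 14 * K ^ 8 * B n lam mu reg k := by
    refine le_of_eq_of_le (Finset.sum_congr rfl fun i _ => ?_) h1
    have : √(headEig lam k i) * √(headEig lam k i) = lam i.val := Real.mul_self_sqrt (h.pos i).le
    linear_combination (-(mu - (covariates lam Z)ᵀ *ᵥ u) i.val ^ 2) * this
  have e2 : ∑ i : Tail p k, lam i.val * ((covariates lam Z)ᵀ *ᵥ u) i.val ^ 2
      ≤ 60 * K ^ 12 * B n lam mu reg k := by
    have s1 : ∑ i : Tail p k, lam i.val * ((covariates lam Z)ᵀ *ᵥ u) i.val ^ 2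
        = u ⬝ᵥ (tailSigmaGram lam k Z *ᵥ u) := by
      rw [← tailRoot_mul_transpose h.nonneg, WellConditioned.dotProduct_mul_transpose_mulVec]
      refine Finset.sum_congr rfl fun i _ => ?_
      rw [transpose_tailRoot_mulVec]
      linear_combination
        (-((covariates lam Z)ᵀ *ᵥ u) i.val ^ 2) * Real.mul_self_sqrt (h.nonneg i.val)
    rw [s1]
    have hts := tailSq_nonneg lam k
    calc _ ≤ K * (tailSq lam k + n * lam ⟨k, hk⟩ ^ 2) * (u ⬝ᵥ u) := h.tail_norm u
      _ ≤ K * (tailSq lam k + n * lam ⟨k, hk⟩ ^ 2)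
          * (30 * K ^ 11 * (n / Lam lam reg k ^ 2) * B n lam mu reg k) := by gcongr
      _ = 30 * K ^ 12 * ((n * (tailSq lam k + n * lam ⟨k, hk⟩ ^ 2)) / Lam lam reg k ^ 2)
          * B n lam mu reg k := by ring
      _ ≤ 30 * K ^ 12 * 2 * B n lam mu reg k := by
          gcongr
          rw [div_le_iff₀ (by positivity)]
          exact h.n_mul_noise_le
      _ = _ := by ring
  have e3 : ∑ i : Tail p k, lam i.val * mu i.val ^ 2 ≤ B n lam mu reg k := by
    rw [h.B_eq]
    have : 0 ≤ ∑ i : Head p k, (Lam lam reg k / n * (√(headEig lam k i) * mu i.val) /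
        (Lam lam reg k / n + headEig lam k i)) ^ 2 := Finset.sum_nonneg fun _ _ => sq_nonneg _
    linarith
  have e4 : ∑ i : Tail p k, lam i.val * (mu - (covariates lam Z)ᵀ *ᵥ u) i.val ^ 2
      ≤ 2 * ∑ i : Tail p k, lam i.val * mu i.val ^ 2
        + 2 * ∑ i : Tail p k, lam i.val * ((covariates lam Z)ᵀ *ᵥ u) i.val ^ 2 := by
    rw [Finset.mul_sum, Finset.mul_sum, ← Finset.sum_add_distrib]
    refine Finset.sum_le_sum fun i _ => ?_
    rw [Pi.sub_apply]
    nlinarith [mul_nonneg (h.nonneg i.val)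
      (sq_nonneg (mu i.val + ((covariates lam Z)ᵀ *ᵥ u) i.val))]
  have k1 : K ^ 8 * B n lam mu reg k ≤ K ^ 12 * B n lam mu reg k := by
    gcongr
    norm_num
  have k2 : B n lam mu reg k ≤ K ^ 12 * B n lam mu reg k :=
    le_mul_of_one_le_left hB (one_le_pow₀ hK1)
  linarith

/-- The matrix of the quadratic form `y ↦ ‖Qᵀ F⁻¹ y‖_Σ²`. -/
noncomputable abbrev noiseMatrix (lam : Fin p → ℝ) (reg : ℝ) (k : ℕ)
    (Z : Matrix (Fin n) (Fin p) ℝ) : Matrix (Fin n) (Fin n) ℝ :=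
  WellConditioned.noiseGram (tailGram lam reg k Z) (headCols k Z) (headEig lam k) (tailRoot lam k Z)

lemma sigmaNorm_sq_eq (h : Regime lam mu reg k hk K Z) (y : Fin n → ℝ) :
    sigmaNorm lam ((covariates lam Z)ᵀ *ᵥ ((centredGram lam reg Z)⁻¹ *ᵥ y)) ^ 2
      = y ⬝ᵥ (noiseMatrix lam reg k Z *ᵥ y) := by
  rw [h.wc.dotProduct_noiseGram_mulVec, sigmaNorm_sq h.nonneg k,
    ← centredGram_eq h.nonneg reg k]
  set v := (centredGram lam reg Z)⁻¹ *ᵥ y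
  congr 1
  · refine Finset.sum_congr rfl fun i _ => ?_
    rw [transpose_covariates_mulVec_head, mul_pow, Real.sq_sqrt (h.pos i).le]
    change headEig lam k i * _ = _
    ring
  · refine Finset.sum_congr rfl fun i _ => ?_
    rw [transpose_tailRoot_mulVec]
    linear_combination
      (-((covariates lam Z)ᵀ *ᵥ v) i.val ^ 2) * Real.mul_self_sqrt (h.nonneg i.val)

lemma trace_noiseMatrix_le (h : Regime lam mu reg k hk K Z) :
    (noiseMatrix lam reg k Z).trace ≤ 30 * K ^ 11 * V n lam reg k := by
  have hK1 := h.wc.one_le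
  have hK := h.wc.K_pos
  have hn := h.wc.N_pos
  have hΛ := h.wc.Λ_pos
  refine (h.wc.trace_noiseGram_le h.pos _).trans ?_
  rw [tailRoot_mul_transpose h.nonneg, h.V_eq, mul_add]
  refine add_le_add le_rfl ?_
  have hts := tailSq_nonneg lam k
  calc _ ≤ (K / Lam lam reg k) ^ 2 * (K * n * tailSq lam k) := by
        gcongr; exact h.tail_trace
    _ = K ^ 3 * (n * tailSq lam k / Lam lam reg k ^ 2) := by field_simp
    _ ≤ 30 * K ^ 11 * (n * tailSq lam k / Lam lam reg k ^ 2) := by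
        have : K ^ 3 ≤ K ^ 11 := pow_le_pow_right₀ hK1 (by norm_num)
        have : 0 ≤ K ^ 11 := by positivity
        gcongr
        linarith

lemma noiseMatrix_le (h : Regime lam mu reg k hk K Z) (y : Fin n → ℝ) :
    y ⬝ᵥ (noiseMatrix lam reg k Z *ᵥ y) ≤ 30 * K ^ 11 * DeltaV n lam reg k hk * (y ⬝ᵥ y) := by
  have hK1 := h.wc.one_le
  have hK := h.wc.K_pos
  have hn := h.wc.N_pos
  have hΛ := h.wc.Λ_pos
  have hts := tailSq_nonneg lam k
  have ha : ∀ i : Head p k, 1 / n * (headEig lam k i / (Lam lam reg k / n + headEig lam k i)) ^ 2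
      ≤ min (1 / (n : ℝ)) (n * lam ⟨0, Nat.zero_lt_of_lt hk⟩ ^ 2 / Lam lam reg k ^ 2) := by
    intro i
    have hi := h.pos i
    have hκ := h.ratio_pos
    refine le_min ?_ ?_
    · refine mul_le_of_le_one_right (by positivity) (pow_le_one₀ (by positivity) ?_)
      rw [div_le_one (by positivity)]
      linarith
    · have hle : headEig lam k i ≤ lam ⟨0, Nat.zero_lt_of_lt hk⟩ := h.le_first _
      calc _ ≤ 1 / n * (lam ⟨0, Nat.zero_lt_of_lt hk⟩ / (Lam lam reg k / n)) ^ 2 := by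
            gcongr
            · exact h.nonneg _
            · linarith
        _ = _ := by field_simp
  refine (h.wc.dotProduct_noiseGram_le h.pos ha (by positivity)
    (θ := K * (tailSq lam k + n * lam ⟨k, hk⟩ ^ 2)) (by positivity) (fun v => ?_) y).trans ?_
  · rw [tailRoot_mul_transpose h.nonneg]; exact h.tail_norm v
  · refine mul_le_mul_of_nonneg_right ?_ (dotProduct_self_nonneg' y)
    rw [DeltaV, mul_add (30 * K ^ 11)]
    refine add_le_add le_rfl ?_
    calc (K / Lam lam reg k) ^ 2 * (K * (tailSq lam k + n * lam ⟨k, hk⟩ ^ 2))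
        = K ^ 3 * ((n * lam ⟨k, hk⟩ ^ 2 + tailSq lam k) / Lam lam reg k ^ 2) := by
          field_simp; ring
      _ ≤ _ := by
          have : K ^ 3 ≤ K ^ 11 := pow_le_pow_right₀ hK1 (by norm_num)
          have : 0 ≤ K ^ 11 := by positivity
          gcongr
          linarith

lemma signal_le (h : Regime lam mu reg k hk K Z) :
    N n lam mu reg k / (2 * K ^ 2) ≤ (mu ⬝ᵥ mu - (covariates lam Z *ᵥ mu) ⬝ᵥ
        ((centredGram lam reg Z)⁻¹ *ᵥ (covariates lam Z *ᵥ mu))) * (n / Lam lam reg k) ∧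
      (mu ⬝ᵥ mu - (covariates lam Z *ᵥ mu) ⬝ᵥ
        ((centredGram lam reg Z)⁻¹ *ᵥ (covariates lam Z *ᵥ mu))) * (n / Lam lam reg k)
        ≤ 2 * K ^ 2 * N n lam mu reg k := by
  have hK1 := h.wc.one_le
  have hK := h.wc.K_pos
  have hn := h.wc.N_pos
  have hΛ := h.wc.Λ_pos
  set u := (centredGram lam reg Z)⁻¹ *ᵥ (covariates lam Z *ᵥ mu) with hu
  have hFu : centredGram lam reg Z *ᵥ u = covariates lam Z *ᵥ mu := by
    rw [hu, mulVec_inv_mulVec h.isUnit_det]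
  have hτ : K / Lam lam reg k * ((tailCols k (covariates lam Z) *ᵥ tailVec k mu) ⬝ᵥ
        (tailCols k (covariates lam Z) *ᵥ tailVec k mu))
      ≤ (∑ i : Tail p k, mu i.val ^ 2) / 4 := by
    have h1 : ∑ i : Tail p k, lam i.val * mu i.val ^ 2
        ≤ lam ⟨k, hk⟩ * ∑ i : Tail p k, mu i.val ^ 2 := by
      rw [Finset.mul_sum]
      exact Finset.sum_le_sum fun i _ => mul_le_mul_of_nonneg_right (h.tail_le i) (sq_nonneg _)
    have h0 : 0 ≤ ∑ i : Tail p k, mu i.val ^ 2 := Finset.sum_nonneg fun _ _ => sq_nonneg _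
    calc _ ≤ K / Lam lam reg k * (K * n * (lam ⟨k, hk⟩ * ∑ i : Tail p k, mu i.val ^ 2)) := by
          gcongr
          exact h.tail_mu.trans (by gcongr)
      _ = (4 * K ^ 2 * (n * lam ⟨k, hk⟩)) / Lam lam reg k
          * ((∑ i : Tail p k, mu i.val ^ 2) / 4) := by field_simp
      _ ≤ 1 * ((∑ i : Tail p k, mu i.val ^ 2) / 4) := by
          gcongr
          rw [div_le_one hΛ]; exact h.gap
      _ = _ := one_mul _
  rw [centredGram_eq h.nonneg reg k, covariates_mulVec_eq lam mu k] at hFu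
  have key := h.wc.signal_bounds h.pos (ξ := fun i => mu i.val) hτ hFu
  have em : (fun i : Head p k => mu i.val) ⬝ᵥ (fun i : Head p k => mu i.val)
      + ∑ i : Tail p k, mu i.val ^ 2 = mu ⬝ᵥ mu := by
    rw [dotProduct, dotProduct, ← sum_head_add_sum_tail k fun i => mu i * mu i]
    simp only [sq]
  rw [← covariates_mulVec_eq lam mu k, em, ← h.M_eq] at key
  have ha : 0 < n / Lam lam reg k := by positivity
  rw [N_eq]
  constructor
  · calc _ = M n lam mu reg k / (2 * K ^ 2) * (n / Lam lam reg k) := by ring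
      _ ≤ _ := mul_le_mul_of_nonneg_right key.1 ha.le
  · calc _ ≤ _ := mul_le_mul_of_nonneg_right key.2 ha.le
      _ = _ := by ring

end Regime
/-! ### The ridge solution on the good event -/

lemma abs_le_of_sq_le_mul_sq {x c z : ℝ} (hc : 1 ≤ c) (hz : 0 ≤ z) (h : x ^ 2 ≤ c * z ^ 2) :
    |x| ≤ c * z := by
  refine abs_le_of_sq_le_sq (h.trans ?_) (by positivity)
  rw [mul_pow]
  gcongr
  exact le_self_pow₀ hc (by norm_num)

/-- The event on the labels, in deterministic form: six quadratic forms of the clean labels `y` and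
of the label noise `e = ŷ - y` do not exceed the bounds that hold for sub-Gaussian vectors with
variance proxies `1` and `16 s²`. -/
structure LabelBounds {n p : ℕ} (lam mu : Fin p → ℝ) (reg : ℝ) (k : ℕ) (hk : k < p) (K s t : ℝ)
    (Z : Matrix (Fin n) (Fin p) ℝ) (y e : Fin n → ℝ) : Prop where
  sq_eq : y ⬝ᵥ y = n
  mean_clean : (((centredGram lam reg Z)⁻¹ *ᵥ (covariates lam Z *ᵥ mu)) ⬝ᵥ y) ^ 2
    ≤ 120 * K ^ 11 * (t * Dia n lam mu reg k) ^ 2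
  mean_noise : (((centredGram lam reg Z)⁻¹ *ᵥ (covariates lam Z *ᵥ mu)) ⬝ᵥ e) ^ 2
    ≤ 1920 * K ^ 11 * (s * (t * Dia n lam mu reg k)) ^ 2
  norm_clean : y ⬝ᵥ (Regime.noiseMatrix lam reg k Z *ᵥ y)
    ≤ 60 * K ^ 11 * (V n lam reg k + t ^ 2 * DeltaV n lam reg k hk)
  norm_noise : e ⬝ᵥ (Regime.noiseMatrix lam reg k Z *ᵥ e)
    ≤ 960 * K ^ 11 * (s ^ 2 * (V n lam reg k + t ^ 2 * DeltaV n lam reg k hk))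
  noise_sq : e ⬝ᵥ e ≤ 64 * s ^ 2 * n
  proj_clean : y ⬝ᵥ (WellConditioned.colProj (headCols k Z) *ᵥ y) ≤ n / 2

namespace Regime

variable {n p : ℕ} {lam mu : Fin p → ℝ} {reg : ℝ} {k : ℕ} {hk : k < p} {K s t : ℝ}
  {Z : Matrix (Fin n) (Fin p) ℝ} {y e : Fin n → ℝ}

lemma centredGram_inv_symm (u v : Fin n → ℝ) :
    u ⬝ᵥ ((centredGram lam reg Z)⁻¹ *ᵥ v) = ((centredGram lam reg Z)⁻¹ *ᵥ u) ⬝ᵥ v := by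
  rw [dotProduct_mulVec_transpose, Matrix.transpose_nonsing_inv, transpose_centredGram]

lemma formBounds (h : Regime lam mu reg k hk K Z) (hy : LabelBounds lam mu reg k hk K s t Z y e)
    {C : ℝ} (hC : C = 2000 * K ^ 12) (hs : 0 ≤ s) (hsC : 4 * C ^ 4 * s ≤ 1) (ht : 0 ≤ t)
    (htn : 8 * C ^ 4 * t ^ 2 ≤ n) :
    FormBounds C (N n lam mu reg k) (n / Lam lam reg k) s (t * Dia n lam mu reg k)
      (y ⬝ᵥ ((centredGram lam reg Z)⁻¹ *ᵥ y)) (y ⬝ᵥ ((centredGram lam reg Z)⁻¹ *ᵥ e))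
      ((covariates lam Z *ᵥ mu) ⬝ᵥ ((centredGram lam reg Z)⁻¹ *ᵥ y))
      ((covariates lam Z *ᵥ mu) ⬝ᵥ ((centredGram lam reg Z)⁻¹ *ᵥ e))
      (mu ⬝ᵥ mu - (covariates lam Z *ᵥ mu) ⬝ᵥ
        ((centredGram lam reg Z)⁻¹ *ᵥ (covariates lam Z *ᵥ mu))) := by
  have hK1 := h.wc.one_le
  have hK := h.wc.K_pos
  have hn := h.wc.N_pos
  have hΛ := h.wc.Λ_pos
  have hd : 0 ≤ Dia n lam mu reg k := Real.sqrt_nonneg _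
  have k1 : K ≤ K ^ 12 := le_self_pow₀ hK1 (by norm_num)
  have k2 : K ^ 2 ≤ K ^ 12 := pow_le_pow_right₀ hK1 (by norm_num)
  have k11 : K ^ 11 ≤ K ^ 12 := pow_le_pow_right₀ hK1 (by norm_num)
  have k11' : 1 ≤ K ^ 11 := one_le_pow₀ hK1
  have hC1 : 1 ≤ C := by linarith
  have ha₀ : 0 < n / Lam lam reg k := by positivity
  have hN := h.N_nonneg
  obtain ⟨hφ1, hφ2⟩ := h.signal_le
  have ha1 := h.wc.le_dotProduct_full_inv h.pos y
  have ha2 := h.wc.dotProduct_full_inv_le h.pos y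
  have hee := h.wc.full_inv_mulVec_sq_le h.pos e
  rw [← centredGram_eq h.nonneg reg k] at ha1 ha2 hee
  rw [hy.sq_eq] at ha1 ha2
  have hp := hy.proj_clean
  refine ⟨hC1, hs, by positivity, ?_, hsC, ha₀, ?_, ?_, ?_, ?_, ?_, ?_, ?_⟩
  · have := h.mul_Dia_sq_le
    calc 8 * C ^ 4 * (t * Dia n lam mu reg k) ^ 2
        = (8 * C ^ 4 * t ^ 2) * Dia n lam mu reg k ^ 2 := by ring
      _ ≤ n * Dia n lam mu reg k ^ 2 := by gcongr
      _ ≤ _ := this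
  · refine le_trans ?_ ha1
    calc n / Lam lam reg k / C ≤ n / Lam lam reg k / (2 * K) := by
          gcongr; linarith
      _ = (n / 2) / (K * Lam lam reg k) := by field_simp
      _ ≤ _ := by gcongr; linarith
  · refine ha2.trans ?_
    calc K / Lam lam reg k * n = K * (n / Lam lam reg k) := by ring
      _ ≤ _ := by gcongr; linarith
  · refine le_trans ?_ hφ1
    gcongr
    linarith
  · refine hφ2.trans ?_
    gcongr
    linarith
  · have h1 := dotProduct_sq_le y ((centredGram lam reg Z)⁻¹ *ᵥ e)
    rw [hy.sq_eq] at h1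
    have h2 : (y ⬝ᵥ ((centredGram lam reg Z)⁻¹ *ᵥ e)) ^ 2
        ≤ (64 * K ^ 2) * (s * (n / Lam lam reg k)) ^ 2 := by
      calc _ ≤ n * ((K / Lam lam reg k) ^ 2 * (64 * s ^ 2 * n)) := by
            refine h1.trans ?_
            gcongr
            refine hee.trans ?_
            gcongr
            exact hy.noise_sq
        _ = _ := by field_simp
    have k3 : 1 ≤ K ^ 2 := one_le_pow₀ hK1
    refine (abs_le_of_sq_le_mul_sq (by linarith) (by positivity) h2).trans ?_
    rw [mul_assoc C]
    gcongr
    linarith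
  · have h1 := hy.mean_clean
    rw [← centredGram_inv_symm] at h1
    refine (abs_le_of_sq_le_mul_sq (by linarith) (by positivity) h1).trans ?_
    gcongr
    linarith
  · have h1 := hy.mean_noise
    rw [← centredGram_inv_symm] at h1
    refine (abs_le_of_sq_le_mul_sq (by linarith) (by positivity) h1).trans ?_
    rw [mul_assoc C]
    gcongr
    linarith

/-- The three directions of the ridge solution: with `p = F⁻¹ y`, `pe = F⁻¹ e`, `u = F⁻¹ ν` and
`S = detFactor`, the vector `S w` is a combination of `Qᵀ p`, `Qᵀ pe` and `μ - Qᵀ u`. The two terms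
`(1 + νᵀ p)²` and `(yᵀ p) (‖μ‖² - νᵀ u)` of `S` cancel in the coefficient of `Qᵀ p`. -/
lemma ridge_decomposition {y ν p pe u : Fin n → ℝ} {F : Matrix (Fin n) (Fin n) ℝ}
    (hFs : Fᵀ = F) (hF : F = centredGram lam reg Z) (hdet : IsUnit F.det)
    (hν : ν = covariates lam Z *ᵥ mu)
    (hp : p = F⁻¹ *ᵥ y) (hpe : pe = F⁻¹ *ᵥ e) (hu : u = F⁻¹ *ᵥ ν)
    (hS : detFactor y ν p u (mu ⬝ᵥ mu) ≠ 0) :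
    IsUnit (ridgeGram lam mu reg Z y).det ∧
      detFactor y ν p u (mu ⬝ᵥ mu) * (mu ⬝ᵥ wRidge lam mu reg Z y (y + e))
        = (mu ⬝ᵥ mu - ν ⬝ᵥ u) * (y ⬝ᵥ p + y ⬝ᵥ pe) + (1 + ν ⬝ᵥ p) * (ν ⬝ᵥ p + ν ⬝ᵥ pe) ∧
      detFactor y ν p u (mu ⬝ᵥ mu) • wRidge lam mu reg Z y (y + e)
        = (1 + ν ⬝ᵥ p - (mu ⬝ᵥ mu - ν ⬝ᵥ u) * (y ⬝ᵥ pe) - (1 + ν ⬝ᵥ p) * (ν ⬝ᵥ pe)) •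
            ((covariates lam Z)ᵀ *ᵥ p)
          + detFactor y ν p u (mu ⬝ᵥ mu) • ((covariates lam Z)ᵀ *ᵥ pe)
          + (y ⬝ᵥ p + (1 + ν ⬝ᵥ p) * (y ⬝ᵥ pe) - (y ⬝ᵥ p) * (ν ⬝ᵥ pe)) •
            (mu - (covariates lam Z)ᵀ *ᵥ u) := by
  have hgram : ∀ x, ridgeGram lam mu reg Z y *ᵥ x
      = F *ᵥ x + ((mu ⬝ᵥ mu) * (y ⬝ᵥ x) + ν ⬝ᵥ x) • y + (y ⬝ᵥ x) • ν := by
    rw [hF, hν]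
    exact fun x => data_gram_mulVec _ y x mu reg
  have hunit : IsUnit (ridgeGram lam mu reg Z y).det := by
    rw [isUnit_iff_ne_zero]
    intro h0
    obtain ⟨v, hv, hv0⟩ := Matrix.exists_mulVec_eq_zero_iff.2 h0
    obtain ⟨e1, e2, e3⟩ := rank_two_solution hFs hdet rfl rfl ((hgram v).symm.trans hv0)
    rw [Matrix.mulVec_zero, ← hp, ← hu] at e1 e2 e3
    rw [dotProduct_zero, dotProduct_zero, mul_zero, mul_zero, add_zero] at e2
    rw [dotProduct_zero, dotProduct_zero, mul_zero, mul_zero, sub_zero] at e3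
    rw [(mul_eq_zero.1 e2).resolve_left hS, (mul_eq_zero.1 e3).resolve_left hS] at e1
    exact hv (by simpa using e1)
  refine ⟨hunit, ?_⟩
  set x := (ridgeGram lam mu reg Z y)⁻¹ *ᵥ (y + e) with hx
  have hGx : ridgeGram lam mu reg Z y *ᵥ x = y + e := mulVec_inv_mulVec hunit _
  obtain ⟨hxe, hα, hβ⟩ := rank_two_solution hFs hdet rfl rfl ((hgram x).symm.trans hGx)
  set β := y ⬝ᵥ x with hβdef
  set α := (mu ⬝ᵥ mu) * β + ν ⬝ᵥ x with hαdef
  have hw : wRidge lam mu reg Z y (y + e) = β • mu + (covariates lam Z)ᵀ *ᵥ x :=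
    transpose_data_mulVec _ y x mu
  rw [Matrix.mulVec_add, ← hp, ← hpe, ← hu] at hxe hα hβ
  rw [dotProduct_add, dotProduct_add] at hα hβ
  have hmuw : mu ⬝ᵥ wRidge lam mu reg Z y (y + e) = α := by
    rw [hw, dotProduct_add, dotProduct_smul, smul_eq_mul, dotProduct_mulVec_transpose,
      Matrix.transpose_transpose, ← hν, hαdef, mul_comm β]
  refine ⟨by rw [hmuw, hα], ?_⟩
  have e1 : detFactor y ν p u (mu ⬝ᵥ mu) • wRidge lam mu reg Z y (y + e)
      = (detFactor y ν p u (mu ⬝ᵥ mu) - detFactor y ν p u (mu ⬝ᵥ mu) * α) •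
          ((covariates lam Z)ᵀ *ᵥ p)
        + detFactor y ν p u (mu ⬝ᵥ mu) • ((covariates lam Z)ᵀ *ᵥ pe)
        + (detFactor y ν p u (mu ⬝ᵥ mu) * β) • (mu - (covariates lam Z)ᵀ *ᵥ u) := by
    rw [hw, hxe]
    simp only [Matrix.mulVec_add, Matrix.mulVec_sub, Matrix.mulVec_smul]
    module
  rw [e1]
  congr 3
  · rw [hα, detFactor]; ring
  · rw [hβ]; ring

/-- The norms of the three directions of the ridge solution. -/
lemma direction_bounds (h : Regime lam mu reg k hk K Z)
    (hy : LabelBounds lam mu reg k hk K s t Z y e) {C : ℝ} (hC : C = 2000 * K ^ 12) (hs : 0 ≤ s) :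
    sigmaNorm lam ((covariates lam Z)ᵀ *ᵥ ((centredGram lam reg Z)⁻¹ *ᵥ y))
        ≤ C * √(V n lam reg k + t ^ 2 * DeltaV n lam reg k hk) ∧
      sigmaNorm lam ((covariates lam Z)ᵀ *ᵥ ((centredGram lam reg Z)⁻¹ *ᵥ e))
        ≤ C * s * √(V n lam reg k + t ^ 2 * DeltaV n lam reg k hk) ∧
      n / Lam lam reg k * sigmaNorm lam (mu - (covariates lam Z)ᵀ *ᵥ
          ((centredGram lam reg Z)⁻¹ *ᵥ (covariates lam Z *ᵥ mu)))
        ≤ C * (Dia n lam mu reg k * √(n : ℝ)) := by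
  have hK1 := h.wc.one_le
  have hn := h.wc.N_pos
  have hΛ := h.wc.Λ_pos
  have hd : 0 ≤ Dia n lam mu reg k := Real.sqrt_nonneg _
  have hV := h.V_nonneg
  have hΔ : 0 ≤ DeltaV n lam reg k hk := DeltaV_nonneg
  have hRsq := Real.sq_sqrt (show 0 ≤ V n lam reg k + t ^ 2 * DeltaV n lam reg k hk by positivity)
  have hR := Real.sqrt_nonneg (V n lam reg k + t ^ 2 * DeltaV n lam reg k hk)
  set R := √(V n lam reg k + t ^ 2 * DeltaV n lam reg k hk)
  have k11 : K ^ 11 ≤ K ^ 12 := pow_le_pow_right₀ hK1 (by norm_num)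
  have k11' : 1 ≤ K ^ 11 := one_le_pow₀ hK1
  refine ⟨?_, ?_, ?_⟩
  · have h2 := hy.norm_clean
    rw [← h.sigmaNorm_sq_eq y, ← hRsq] at h2
    refine (le_abs_self _).trans ((abs_le_of_sq_le_mul_sq (by linarith) hR h2).trans ?_)
    gcongr
    linarith
  · have h2 := hy.norm_noise
    rw [← h.sigmaNorm_sq_eq e, ← hRsq, ← mul_pow] at h2
    refine (le_abs_self _).trans ((abs_le_of_sq_le_mul_sq (by linarith) (by positivity)
      h2).trans ?_)
    rw [mul_assoc C]
    gcongr
    linarith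
  · have h1 := (h.mean_bounds rfl).2
    set r := sigmaNorm lam (mu - (covariates lam Z)ᵀ *ᵥ
          ((centredGram lam reg Z)⁻¹ *ᵥ (covariates lam Z *ᵥ mu)))
    have h2 : (n / Lam lam reg k * r) ^ 2
        ≤ (136 * K ^ 12) * (Dia n lam mu reg k * √(n : ℝ)) ^ 2 := by
      rw [mul_pow, mul_pow, Real.sq_sqrt hn.le, h.Dia_sq]
      calc _ ≤ (n / Lam lam reg k) ^ 2 * (136 * K ^ 12 * B n lam mu reg k) := by gcongr
        _ = _ := by field_simp
    refine (le_abs_self _).trans ((abs_le_of_sq_le_mul_sq (by linarith) (by positivity)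
      h2).trans ?_)
    gcongr
    linarith

/-- The conclusion of the theorem for fixed covariates and labels, with `S` the factor by which the
signal changes the determinant of the Gram matrix. -/
lemma ridge_bounds (h : Regime lam mu reg k hk K Z)
    (hy : LabelBounds lam mu reg k hk K s t Z y e)
    {C : ℝ} (hC : C = 2000 * K ^ 12) (hs : 0 ≤ s) (hsC : 4 * C ^ 4 * s ≤ 1) (ht : 0 ≤ t)
    (htn : 8 * C ^ 4 * t ^ 2 ≤ n) (hkn : (k : ℝ) ≤ n) :
    IsUnit (ridgeGram lam mu reg Z y).det ∧ ∃ S : ℝ, 0 < S ∧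
      N n lam mu reg k / (2 * C ^ 2) - 2 * C * (t * Dia n lam mu reg k)
        ≤ S * (mu ⬝ᵥ wRidge lam mu reg Z y (y + e)) ∧
      S * sigmaNorm lam (wRidge lam mu reg Z y (y + e))
        ≤ 12 * C ^ 3 * ((1 + N n lam mu reg k * s) *
            √(V n lam reg k + t ^ 2 * DeltaV n lam reg k hk) + Dia n lam mu reg k * √(n : ℝ)) := by
  have hK1 := h.wc.one_le
  have hd : 0 ≤ Dia n lam mu reg k := Real.sqrt_nonneg _
  have fb := h.formBounds hy hC hs hsC ht htn
  have hC1 := fb.one_le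
  have hN := h.N_nonneg
  have hV := h.V_nonneg
  have htn' : t ^ 2 ≤ n := by
    refine le_trans ?_ htn
    have : 1 ≤ C ^ 4 := one_le_pow₀ hC1
    nlinarith [sq_nonneg t]
  obtain ⟨hx1, hx2, hx3⟩ := h.direction_bounds hy hC hs
  have hS0 := fb.detFactor_pos
  obtain ⟨hunit, hmuw, hdec⟩ := ridge_decomposition (e := e) transpose_centredGram rfl h.isUnit_det
    rfl rfl rfl rfl hS0.ne'
  refine ⟨hunit, _, hS0, fb.margin_lower.trans_eq hmuw.symm, ?_⟩
  have hRR := h.V_add_le htn' hkn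
  have hTd : t * Dia n lam mu reg k ≤ Dia n lam mu reg k * √(n : ℝ) := by
    rw [mul_comm]
    exact mul_le_mul_of_nonneg_left (Real.le_sqrt_of_sq_le htn') hd
  have hTR : Dia n lam mu reg k * √(n : ℝ) * (t * Dia n lam mu reg k)
      ≤ N n lam mu reg k * √(V n lam reg k + t ^ 2 * DeltaV n lam reg k hk) := by
    calc _ = t * (√(n : ℝ) * Dia n lam mu reg k ^ 2) := by ring
      _ ≤ t * (N n lam mu reg k * √(DeltaV n lam reg k hk)) :=
          mul_le_mul_of_nonneg_left h.sqrt_mul_Dia_sq_le ht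
      _ = N n lam mu reg k * √(t ^ 2 * DeltaV n lam reg k hk) := by
          rw [Real.sqrt_mul (sq_nonneg t), Real.sqrt_sq ht]; ring
      _ ≤ _ := mul_le_mul_of_nonneg_left (Real.sqrt_le_sqrt (by linarith)) hN
  have hRC : √(V n lam reg k + t ^ 2 * DeltaV n lam reg k hk) ≤ C := by
    have : 1 ≤ K ^ 12 := one_le_pow₀ hK1
    refine Real.sqrt_le_iff.2 ⟨by linarith, hRR.trans ?_⟩
    have : 2000 ≤ C := by linarith
    nlinarith
  have key := fb.norm_upper (Real.sqrt_nonneg _) hRC hTd hTR (sigmaNorm_nonneg _ _)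
    (sigmaNorm_nonneg _ _) (sigmaNorm_nonneg _ _) hx1 hx2 hx3
  exact (mul_sigmaNorm_le h.nonneg hS0 hdec).trans key

end Regime
/-! ### The probability of the good event -/

/-- Tail bound for quadratic forms of the label noise `e = y (s - 1)`. It includes the noiseless case
`η = 0`, where the variance proxy vanishes and `e = 0` almost surely. -/
lemma measure_noise_quadratic_gt_le {n : ℕ} {η : ℝ} (h0 : 0 ≤ η) (h1 : η ≤ 1)
    {H : Matrix (Fin n) (Fin n) ℝ} (hH : H.IsHermitian) (hH0 : ∀ v, 0 ≤ v ⬝ᵥ (H *ᵥ v)) {θ : ℝ}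
    (hθ0 : 0 ≤ θ) (hθ : ∀ v, v ⬝ᵥ (H *ᵥ v) ≤ θ * (v ⬝ᵥ v)) (t : ℝ) :
    labelLaw n η {ω | 2 * (16 * sigmaEta η ^ 2) * (H.trace + t ^ 2 * θ)
        < (ω.1 * (ω.2 - 1)) ⬝ᵥ (H *ᵥ (ω.1 * (ω.2 - 1)))}
      ≤ ENNReal.ofReal (Real.exp (-t ^ 2 / 2)) := by
  rcases h0.eq_or_lt with rfl | h0
  · refine le_of_eq_of_le ?_ zero_le
    refine measure_mono_null (fun ω hω => ?_) (ae_iff.1 (ae_labelLaw_zero_snd n))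
    intro hs
    simp [hs, sigmaEta] at hω
  · have := isProbabilityMeasure_labelLaw n h0.le h1
    have hq : 1 < (3 + η⁻¹) / 2 := by
      have : 0 < η⁻¹ := inv_pos.2 h0
      have := (one_le_inv₀ h0).2 h1
      linarith
    have hσ : 0 < sigmaEta η := by
      rw [sigmaEta, if_neg h0.ne']
      have := Real.log_pos hq
      positivity
    exact measure_quadratic_gt_le (x := fun ω : (Fin n → ℝ) × (Fin n → ℝ) => ω.1 * (ω.2 - 1))
      (by fun_prop) (by positivity) (isSubGaussianVec_labelNoise n h0 h1) hH hH0 hθ0 hθ t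

lemma measure_clean_quadratic_gt_le {n : ℕ} {η : ℝ} (h0 : 0 ≤ η) (h1 : η ≤ 1)
    {H : Matrix (Fin n) (Fin n) ℝ} (hH : H.IsHermitian) (hH0 : ∀ v, 0 ≤ v ⬝ᵥ (H *ᵥ v)) {θ : ℝ}
    (hθ0 : 0 ≤ θ) (hθ : ∀ v, v ⬝ᵥ (H *ᵥ v) ≤ θ * (v ⬝ᵥ v)) (t : ℝ) :
    labelLaw n η {ω | 2 * 1 * (H.trace + t ^ 2 * θ) < ω.1 ⬝ᵥ (H *ᵥ ω.1)}
      ≤ ENNReal.ofReal (Real.exp (-t ^ 2 / 2)) := by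
  have := isProbabilityMeasure_labelLaw n h0 h1
  exact measure_quadratic_gt_le (x := fun ω : (Fin n → ℝ) × (Fin n → ℝ) => ω.1) measurable_fst
    one_pos (isSubGaussianVec_cleanLabels n h0 h1) hH hH0 hθ0 hθ t

lemma dotProduct_vecMulVec_mulVec {n : ℕ} (u v : Fin n → ℝ) :
    v ⬝ᵥ (Matrix.vecMulVec u u *ᵥ v) = (u ⬝ᵥ v) ^ 2 := by
  rw [Matrix.vecMulVec_mulVec]
  simp [dotProduct_comm v u, sq]

lemma vecMulVec_self_isHermitian {n : ℕ} (u : Fin n → ℝ) : (Matrix.vecMulVec u u).IsHermitian := by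
  rw [Matrix.IsHermitian, Matrix.conjTranspose_eq_transpose_of_trivial, Matrix.transpose_vecMulVec]

/-- The label bounds fail with probability at most `6 exp (-t² / 2)`, one term for each of the six
quadratic forms. Requiring `t ≥ 1` lets `t²` times the norm absorb the trace of the rank-one forms. -/
lemma Regime.measure_not_labelBounds_le {n p : ℕ} {lam mu : Fin p → ℝ} {reg : ℝ} {k : ℕ}
    {hk : k < p} {K t η : ℝ} {Z : Matrix (Fin n) (Fin p) ℝ} (h : Regime lam mu reg k hk K Z)
    (h0 : 0 ≤ η) (h1 : η ≤ 1) (ht : 1 ≤ t) (htn : 8 * t ^ 2 ≤ n) (hkn : 8 * (k : ℝ) ≤ n) :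
    labelLaw n η {ω | LabelBounds lam mu reg k hk K (sigmaEta η) t Z ω.1 (ω.1 * (ω.2 - 1))}ᶜ
      ≤ 6 * ENNReal.ofReal (Real.exp (-t ^ 2 / 2)) := by
  have hK1 := h.wc.one_le
  have hK := h.wc.K_pos
  have hn := h.wc.N_pos
  have hΔ : 0 ≤ DeltaV n lam reg k hk := DeltaV_nonneg
  have ht2 : 1 ≤ t ^ 2 := one_le_pow₀ ht
  set u := (centredGram lam reg Z)⁻¹ *ᵥ (covariates lam Z *ᵥ mu) with hu
  have huu := (h.mean_bounds hu).1
  have hu0 := dotProduct_self_nonneg' u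
  set U := Matrix.vecMulVec u u with hU
  set H := noiseMatrix lam reg k Z with hH
  set P := WellConditioned.colProj (headCols k Z) with hP
  have hUtr : U.trace = u ⬝ᵥ u := by rw [hU, Matrix.trace_vecMulVec]
  have hU0 : ∀ v, 0 ≤ v ⬝ᵥ (U *ᵥ v) := fun v => by
    rw [hU, dotProduct_vecMulVec_mulVec]; positivity
  have hU1 : ∀ v, v ⬝ᵥ (U *ᵥ v) ≤ (u ⬝ᵥ u) * (v ⬝ᵥ v) := fun v => by
    rw [hU, dotProduct_vecMulVec_mulVec]; exact dotProduct_sq_le u v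
  have hPh : P.IsHermitian := by
    rw [Matrix.IsHermitian, Matrix.conjTranspose_eq_transpose_of_trivial,
      WellConditioned.colProj_transpose]
  have hHh : H.IsHermitian := WellConditioned.noiseGram_isHermitian _ _
  have hH0 : ∀ v, 0 ≤ v ⬝ᵥ (H *ᵥ v) := h.wc.dotProduct_noiseGram_nonneg _ _
  have hHθ : 0 ≤ 30 * K ^ 11 * DeltaV n lam reg k hk := by positivity
  have hHtr := h.trace_noiseMatrix_le
  have hPtr : P.trace ≤ k := h.wc.trace_colProj.trans_le card_head
  have b1 := measure_clean_quadratic_gt_le (n := n) h0 h1 (vecMulVec_self_isHermitian u) hU0 hu0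
    hU1 t
  have b2 := measure_noise_quadratic_gt_le (n := n) h0 h1 (vecMulVec_self_isHermitian u) hU0 hu0
    hU1 t
  have b3 := measure_clean_quadratic_gt_le (n := n) h0 h1 hHh hH0 hHθ h.noiseMatrix_le t
  have b4 := measure_noise_quadratic_gt_le (n := n) h0 h1 hHh hH0 hHθ h.noiseMatrix_le t
  have b5 := measure_noise_quadratic_gt_le (n := n) (H := 1) h0 h1 Matrix.isHermitian_one
    (fun v => by rw [Matrix.one_mulVec]; exact dotProduct_self_nonneg' v) zero_le_one
    (fun v => by rw [Matrix.one_mulVec, one_mul]) t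
  have b6 := measure_clean_quadratic_gt_le (n := n) h0 h1 hPh h.wc.dotProduct_colProj_nonneg
    zero_le_one h.wc.dotProduct_colProj_le t
  have b0 : labelLaw n η {ω | ¬ ∀ i, ω.1 i ^ 2 = 1} = 0 := ae_iff.1 (ae_labelLaw_fst_sq n h0 h1)
  set A1 := {ω : (Fin n → ℝ) × (Fin n → ℝ) |
    2 * 1 * (U.trace + t ^ 2 * (u ⬝ᵥ u)) < ω.1 ⬝ᵥ (U *ᵥ ω.1)} with hA1
  set A2 := {ω : (Fin n → ℝ) × (Fin n → ℝ) |
    2 * (16 * sigmaEta η ^ 2) * (U.trace + t ^ 2 * (u ⬝ᵥ u))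
      < (ω.1 * (ω.2 - 1)) ⬝ᵥ (U *ᵥ (ω.1 * (ω.2 - 1)))} with hA2
  set A3 := {ω : (Fin n → ℝ) × (Fin n → ℝ) |
    2 * 1 * (H.trace + t ^ 2 * (30 * K ^ 11 * DeltaV n lam reg k hk)) < ω.1 ⬝ᵥ (H *ᵥ ω.1)} with hA3
  set A4 := {ω : (Fin n → ℝ) × (Fin n → ℝ) |
    2 * (16 * sigmaEta η ^ 2) * (H.trace + t ^ 2 * (30 * K ^ 11 * DeltaV n lam reg k hk))
      < (ω.1 * (ω.2 - 1)) ⬝ᵥ (H *ᵥ (ω.1 * (ω.2 - 1)))} with hA4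
  set A5 := {ω : (Fin n → ℝ) × (Fin n → ℝ) |
    2 * (16 * sigmaEta η ^ 2) * ((1 : Matrix (Fin n) (Fin n) ℝ).trace + t ^ 2 * 1)
      < (ω.1 * (ω.2 - 1)) ⬝ᵥ ((1 : Matrix (Fin n) (Fin n) ℝ) *ᵥ (ω.1 * (ω.2 - 1)))} with hA5
  set A6 := {ω : (Fin n → ℝ) × (Fin n → ℝ) |
    2 * 1 * (P.trace + t ^ 2 * 1) < ω.1 ⬝ᵥ (P *ᵥ ω.1)} with hA6
  set A0 := {ω : (Fin n → ℝ) × (Fin n → ℝ) | ¬ ∀ i, ω.1 i ^ 2 = 1} with hA0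
  have hsub : {ω : (Fin n → ℝ) × (Fin n → ℝ) |
      LabelBounds lam mu reg k hk K (sigmaEta η) t Z ω.1 (ω.1 * (ω.2 - 1))}ᶜ
      ⊆ A0 ∪ (A1 ∪ (A2 ∪ (A3 ∪ (A4 ∪ (A5 ∪ A6))))) := by
    rw [Set.compl_subset_comm]
    intro ω hω
    simp only [Set.compl_union, Set.mem_inter_iff, Set.mem_compl_iff, hA0, hA1, hA2, hA3, hA4,
      hA5, hA6, Set.mem_ofPred_eq, not_lt, not_not] at hω
    obtain ⟨w0, w1, w2, w3, w4, w5, w6⟩ := hω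
    have huu' : (u ⬝ᵥ u) + t ^ 2 * (u ⬝ᵥ u) ≤ 60 * K ^ 11 * (t * Dia n lam mu reg k) ^ 2 := by
      have e1 : (u ⬝ᵥ u) + t ^ 2 * (u ⬝ᵥ u) ≤ 2 * t ^ 2 * (u ⬝ᵥ u) := by nlinarith
      have e2 : 2 * t ^ 2 * (u ⬝ᵥ u) ≤ 2 * t ^ 2 * (30 * K ^ 11 * Dia n lam mu reg k ^ 2) := by
        gcongr
      rw [mul_pow]; linarith
    have hHH : H.trace + t ^ 2 * (30 * K ^ 11 * DeltaV n lam reg k hk)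
        ≤ 30 * K ^ 11 * (V n lam reg k + t ^ 2 * DeltaV n lam reg k hk) := by linarith
    rw [hU, dotProduct_vecMulVec_mulVec, ← hU, hUtr] at w1 w2
    rw [Matrix.one_mulVec, Matrix.trace_one, Fintype.card_fin] at w5
    have hs := sq_nonneg (sigmaEta η)
    refine ⟨?_, ?_, ?_, ?_, ?_, ?_, ?_⟩
    · simp only [dotProduct, ← sq, w0]
      simp
    · linarith
    · refine w2.trans ((mul_le_mul_of_nonneg_left huu' (by positivity)).trans_eq ?_)
      ring
    · linarith
    · refine w4.trans ((mul_le_mul_of_nonneg_left hHH (by positivity)).trans_eq ?_)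
      ring
    · refine w5.trans ?_
      have : 2 * (16 * sigmaEta η ^ 2) * (n + t ^ 2 * 1) ≤ 2 * (16 * sigmaEta η ^ 2) * (n + n) := by
        gcongr; linarith
      linarith
    · linarith
  refine (measure_mono hsub).trans ?_
  set x := ENNReal.ofReal (Real.exp (-t ^ 2 / 2))
  calc _ ≤ labelLaw n η A0 + (labelLaw n η A1 + (labelLaw n η A2 + (labelLaw n η A3
        + (labelLaw n η A4 + (labelLaw n η A5 + labelLaw n η A6))))) := by
        iterate 5 refine (measure_union_le _ _).trans (add_le_add le_rfl ?_)
        exact measure_union_le _ _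
    _ ≤ 0 + (x + (x + (x + (x + (x + x))))) := by
        gcongr
        exact b0.le
    _ = 6 * x := by ring

lemma regime_of_events {n p k : ℕ} {hk : k < p} {lam mu : Fin p → ℝ} {reg cB L K c : ℝ}
    {Z : Matrix (Fin n) (Fin p) ℝ} (hcB : 0 < cB) (hL : 1 < L) (hcK : cB ≤ K) (hLK : L ≤ K)
    (hc : 4 * K ^ 2 ≤ c) (hn : 0 < n) (hanti : Antitone lam) (hlam : ∀ i, 0 ≤ lam i)
    (hpos : ∀ i : Fin p, i.val < k → 0 < lam i)
    (hΛ : max (c * n * lam ⟨k, hk⟩) (√(n * tailSq lam k)) < Lam lam reg k)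
    (hA : EventA lam reg k L Z) (hB : EventB lam mu k hk cB Z) :
    Regime lam mu reg k hk K Z := by
  have hn' : (0 : ℝ) < n := by exact_mod_cast hn
  obtain ⟨hΛ1, hΛ2⟩ := max_lt_iff.1 hΛ
  have hΛ0 : 0 < Lam lam reg k := lt_of_le_of_lt (Real.sqrt_nonneg _) hΛ2
  have hK1 : 1 ≤ K := hL.le.trans hLK
  have hK : 0 < K := by linarith
  have hts := tailSq_nonneg lam k
  have hsymm : (tailGram lam reg k Z)ᵀ = tailGram lam reg k Z := by
    simp [tailGram, Matrix.transpose_mul]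
  have hA' := fun v => le_dotProduct_mulVec_of_spectrum hsymm hA v
  have hB' := fun x => le_dotProduct_mulVec_of_spectrum
    (H := (headCols k Z)ᵀ * headCols k Z) (by simp [Matrix.transpose_mul]) hB.head_spectrum x
  simp only [WellConditioned.head_dotProduct] at hB'
  have hmu0 : 0 ≤ ∑ i : Tail p k, lam i.val * mu i.val ^ 2 :=
    Finset.sum_nonneg fun i _ => mul_nonneg (hlam _) (sq_nonneg _)
  refine ⟨⟨hK1, hn', hΛ0, hsymm, fun v => ?_, fun v => ?_, fun x => ?_, fun x => ?_⟩, hanti, hlam,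
    fun i => hpos _ i.2, ?_, ?_, fun v => ?_, ?_, ?_⟩
  · refine le_trans ?_ (hA' v).1
    refine mul_le_mul_of_nonneg_right ?_ (dotProduct_self_nonneg' v)
    rw [one_div_mul_eq_div]
    gcongr
  · refine (hA' v).2.trans ?_
    have := dotProduct_self_nonneg' v
    gcongr
  · refine le_trans ?_ (hB' x).1
    have := dotProduct_self_nonneg' x
    gcongr
  · refine (hB' x).2.trans ?_
    have := dotProduct_self_nonneg' x
    gcongr
  · exact hB.tail_mu.trans (by gcongr)
  · exact hB.tail_trace.trans (by gcongr)
  · refine (dotProduct_mulVec_le_of_norm_le hB.tail_norm v).trans ?_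
    have := dotProduct_self_nonneg' v
    gcongr
  · have := mul_nonneg hn'.le (hlam ⟨k, hk⟩)
    nlinarith
  · rw [Real.sqrt_lt' hΛ0] at hΛ2
    exact hΛ2.le

/-! ### The noise level and the final ratio -/

lemma sigmaEta_nonneg (η : ℝ) : 0 ≤ sigmaEta η := by
  rw [sigmaEta]; split_ifs <;> positivity

/-- `σ_η` is small for small `η`, although only logarithmically. -/
lemma mul_sigmaEta_le_one {η D : ℝ} (hD : 0 < D) (h0 : 0 ≤ η)
    (h : 2 * Real.exp (D ^ 2) ≤ η⁻¹ ∨ η = 0) :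
    D * sigmaEta η ≤ 1 := by
  rw [sigmaEta]
  split_ifs with hη
  · simp
  have h := h.resolve_right hη
  have h1 : D ^ 2 ≤ Real.log ((3 + η⁻¹) / 2) := by
    rw [Real.le_log_iff_exp_le (by positivity)]
    linarith
  have h2 : D ≤ √(Real.log ((3 + η⁻¹) / 2)) := Real.le_sqrt_of_sq_le h1
  rw [mul_one_div, div_le_one (by linarith)]
  exact h2

/-- The lower bound on the ratio, from the bounds on the rescaled margin and norm. -/
lemma ratio_bound {N D d S m r c : ℝ} (hc : 0 < c) (hS : 0 < S) (hN : 0 ≤ N) (hr : 0 ≤ r)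
    (h1 : c⁻¹ * N - c * d ≤ S * m) (h2 : S * r ≤ c * D) (hd : 2 * c ^ 2 * d < N) :
    0 < m ∧ (r ≠ 0 → 1 / (2 * c ^ 2) * (N / D) ≤ m / r) := by
  have h3 : c * d < N / (2 * c) := by
    rw [lt_div_iff₀ (by positivity)]; nlinarith
  have h4 : N / (2 * c) < S * m := by
    have : c⁻¹ * N = N / (2 * c) + N / (2 * c) := by field_simp; ring
    linarith
  have hm : 0 < m := by
    have : 0 < S * m := lt_of_le_of_lt (by positivity) h4
    exact pos_of_mul_pos_right this hS.le
  refine ⟨hm, fun hr0 => ?_⟩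
  have hr' : 0 < r := lt_of_le_of_ne hr (Ne.symm hr0)
  have hD : 0 < D := by
    have : 0 < c * D := lt_of_lt_of_le (by positivity) h2
    exact pos_of_mul_pos_right this hc.le
  rw [div_mul_div_comm, one_mul, div_le_div_iff₀ (by positivity) hr']
  rw [div_lt_iff₀ (by positivity)] at h4
  calc N * r ≤ S * m * (2 * c) * r := by gcongr
    _ = m * (2 * c) * (S * r) := by ring
    _ ≤ m * (2 * c) * (c * D) := by gcongr
    _ = m * (2 * c ^ 2 * D) := by ring

end RidgeClassification

theorem mainTheorem1 :
    ∀ cB : ℝ, 0 < cB → ∀ L : ℝ, 1 < L → ∃ c : ℝ, 0 < c ∧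
      ∀ (n p k : ℕ) (hk : k < p) (lam mu : Fin p → ℝ) (reg η t : ℝ)
        (Z : Matrix (Fin n) (Fin p) ℝ),
        Antitone lam → (∀ i, 0 ≤ lam i) → (∀ i : Fin p, i.val < k → 0 < lam i) →
        0 ≤ η → η ≤ 1 → η < c⁻¹ →
        (k : ℝ) < n / c →
        max (c * n * lam ⟨k, hk⟩) (√(n * tailSq lam k)) < Lam lam reg k →
        0 < t → t < √(n : ℝ) / c →
        EventA lam reg k L Z → EventB lam mu k hk cB Z →
        1 - c * Real.exp (-t ^ 2 / 2) ≤
          (labelLaw n η).real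
            {ω : (Fin n → ℝ) × (Fin n → ℝ) |
              let w : Fin p → ℝ := wRidge lam mu reg Z ω.1 (ω.1 * ω.2)
              IsUnit (ridgeGram lam mu reg Z ω.1).det ∧
              (∃ S : ℝ, 0 < S ∧
                c⁻¹ * N n lam mu reg k - c * t * Dia n lam mu reg k ≤ S * (mu ⬝ᵥ w) ∧
                S * sigmaNorm lam w ≤ c * denomBound n lam mu reg k hk η t) ∧
              (2 * c ^ 2 * t * Dia n lam mu reg k < N n lam mu reg k →
                0 < mu ⬝ᵥ w ∧
                (sigmaNorm lam w ≠ 0 →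
                  1 / (2 * c ^ 2) * (N n lam mu reg k / denomBound n lam mu reg k hk η t)
                    ≤ (mu ⬝ᵥ w) / sigmaNorm lam w))} := by
  intro cB hcB L hL
  set K := max (max cB L) 1 with hKdef
  have hcK : cB ≤ K := (le_max_left _ _).trans (le_max_left _ _)
  have hLK : L ≤ K := (le_max_right _ _).trans (le_max_left _ _)
  have hK1 : 1 ≤ K := le_max_right _ _
  set C := 2000 * K ^ 12 with hC
  have hKC : K ^ 2 ≤ C := by
    have : K ^ 2 ≤ K ^ 12 := pow_le_pow_right₀ hK1 (by norm_num)
    have : 0 ≤ K ^ 12 := by positivity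
    linarith
  have hC1 : 1 ≤ C := (one_le_pow₀ hK1).trans hKC
  have hC14 : C ≤ C ^ 4 := le_self_pow₀ hC1 (by norm_num)
  have hC24 : C ^ 2 ≤ C ^ 4 := pow_le_pow_right₀ hC1 (by norm_num)
  have hC34 : C ^ 3 ≤ C ^ 4 := pow_le_pow_right₀ hC1 (by norm_num)
  set E := 2 * Real.exp ((4 * C ^ 4) ^ 2) with hE
  have hE0 : 0 < E := by positivity
  -- `12 C⁴` dominates the constants of `Regime.ridge_bounds` and the lower bound on `n / t²` there;
  -- the exponential term of `c` makes the logarithmically small `σ_η` at most `1 / (4 C⁴)`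
  set c := 12 * C ^ 4 + E with hc
  have hcC : 12 * C ^ 4 ≤ c := by linarith
  have hcE : E ≤ c := by linarith [show 0 ≤ 12 * C ^ 4 by positivity]
  have hc12 : 12 ≤ c := by linarith
  have hc0 : 0 < c := by linarith
  refine ⟨c, hc0, ?_⟩
  intro n p k hk lam mu reg η t Z hanti hlam hpos hη0 hη1 hηc hkn hΛ ht htn hA hB
  have hprob := isProbabilityMeasure_labelLaw n hη0 hη1
  rcases lt_or_ge t 1 with ht1 | ht1
  · -- the claimed probability is not positive
    have h1 := Real.add_one_le_exp (-t ^ 2 / 2)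
    have h2 : 1 / 2 ≤ Real.exp (-t ^ 2 / 2) := by nlinarith
    have h3 : 12 * (1 / 2) ≤ c * Real.exp (-t ^ 2 / 2) := by gcongr
    exact le_trans (by linarith) measureReal_nonneg
  have hn : 0 < n := by
    rcases Nat.eq_zero_or_pos n with rfl | hn
    · simp at htn; linarith
    · exact hn
  have hn' : (0 : ℝ) < n := by exact_mod_cast hn
  have hreg : Regime lam mu reg k hk K Z := regime_of_events hcB hL hcK hLK
    (by linarith [sq_nonneg K]) hn hanti hlam hpos hΛ hA hB
  have htn2 : 8 * C ^ 4 * t ^ 2 ≤ n := by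
    have h1 : (c * t) ^ 2 ≤ n := by
      rw [lt_div_iff₀ hc0, mul_comm] at htn
      calc (c * t) ^ 2 ≤ √(n : ℝ) ^ 2 := by gcongr
        _ = (n : ℝ) := Real.sq_sqrt hn'.le
    have h2 : 8 * C ^ 4 ≤ c ^ 2 := by nlinarith
    calc 8 * C ^ 4 * t ^ 2 ≤ c ^ 2 * t ^ 2 := by gcongr
      _ = (c * t) ^ 2 := by ring
      _ ≤ n := h1
  have hkn8 : 8 * (k : ℝ) ≤ n := by
    rw [lt_div_iff₀ hc0] at hkn
    have : (0 : ℝ) ≤ k := Nat.cast_nonneg k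
    nlinarith
  have hkn1 : (k : ℝ) ≤ n := by
    have : (0 : ℝ) ≤ k := Nat.cast_nonneg k
    linarith
  have htn8 : 8 * t ^ 2 ≤ n := by
    refine le_trans ?_ htn2
    have : 1 ≤ C ^ 4 := hC1.trans hC14
    gcongr
    linarith
  have hσ : 4 * C ^ 4 * sigmaEta η ≤ 1 := by
    refine mul_sigmaEta_le_one (by positivity) hη0 ?_
    rcases hη0.eq_or_lt with h0 | h0
    · exact Or.inr h0.symm
    · left
      have := (lt_inv_comm₀ h0 hc0).1 hηc
      linarith
  have hbad := hreg.measure_not_labelBounds_le hη0 hη1 ht1 htn8 hkn8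
  set good := {ω : (Fin n → ℝ) × (Fin n → ℝ) |
    LabelBounds lam mu reg k hk K (sigmaEta η) t Z ω.1 (ω.1 * (ω.2 - 1))} with hgood
  have hmass : 1 - c * Real.exp (-t ^ 2 / 2) ≤ (labelLaw n η).real good := by
    have h1 := measure_univ_le_add_compl (μ := labelLaw n η) good
    rw [measure_univ] at h1
    have h2 := h1.trans (add_le_add le_rfl hbad)
    have h3 := ENNReal.toReal_mono (by finiteness) h2
    rw [ENNReal.toReal_add (by finiteness) (by finiteness), ENNReal.toReal_mul,
      ENNReal.toReal_ofReal (Real.exp_pos _).le] at h3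
    simp only [ENNReal.toReal_one, ENNReal.toReal_ofNat] at h3
    have h4 : 6 * Real.exp (-t ^ 2 / 2) ≤ c * Real.exp (-t ^ 2 / 2) := by
      gcongr; linarith
    rw [Measure.real]
    linarith
  refine hmass.trans (measureReal_mono (fun ω hω => ?_) (by finiteness))
  have hyhat : ω.1 + ω.1 * (ω.2 - 1) = ω.1 * ω.2 := by ring
  obtain ⟨hunit, S, hS, h1, h2⟩ := hreg.ridge_bounds hω hC (sigmaEta_nonneg η) hσ ht.le htn2 hkn1
  rw [hyhat] at h1 h2
  have hN := hreg.N_nonneg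
  have hd : 0 ≤ Dia n lam mu reg k := Real.sqrt_nonneg _
  have hD : 0 ≤ denomBound n lam mu reg k hk η t := by
    have := sigmaEta_nonneg η
    rw [denomBound]
    positivity
  have h1' : c⁻¹ * N n lam mu reg k - c * (t * Dia n lam mu reg k)
      ≤ S * (mu ⬝ᵥ wRidge lam mu reg Z ω.1 (ω.1 * ω.2)) := by
    refine le_trans ?_ h1
    have e1 : c⁻¹ * N n lam mu reg k ≤ N n lam mu reg k / (2 * C ^ 2) := by
      rw [div_eq_inv_mul]
      gcongr
      linarith
    have e2 : 2 * C * (t * Dia n lam mu reg k) ≤ c * (t * Dia n lam mu reg k) := by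
      gcongr; linarith
    linarith
  have h2' : S * sigmaNorm lam (wRidge lam mu reg Z ω.1 (ω.1 * ω.2))
      ≤ c * denomBound n lam mu reg k hk η t := by
    refine h2.trans ?_
    rw [← denomBound]
    gcongr
    linarith
  refine ⟨hunit, ⟨S, hS, by rwa [mul_assoc c], h2'⟩, fun hsig => ?_⟩
  exact ratio_bound hc0 hS hN (sigmaNorm_nonneg _ _) h1' h2' (by linarith)
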